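/- **Setting.** Let $(X_1,Y_1),\dots,(X_n,Y_n)$ be i.i.d. from a probability measure $\mu_0$ on $\mathbb{R}^p\times\mathbb{R}$ such that, for a constant $c_0>0$, $X\in[-c_0,c_0]^p$ and $|Y|\le c_0$ $\mu_0$-almost surely. Let $\mu_u$ be a probability measure on $\mathbb{R}^{\tilde d}$, $\tilde d\ge 1$, let $m_1\ge 1$, $m_2\ge 2$, and let $U_{b,i,k}$ ($b\le m_1$, $i\le n$, $k\le m_2$) be i.i.d. from $\mu_u$ and independent of the data. Put $d=p+\tilde d$. For $B>0$ let $\mathcal H$ be the class of functions $\mathrm{Tc}_{c_0}(g(x,u))$, $x\in\mathbb{R}^p$, $u\in\mathbb{R}^{\tilde d}$, where $\mathrm{Tc}_M(z)=\min\{|z|,M\}\,\mathrm{sign}(z)$ and $g$ is a fully connected ReLU network $g(x,u)=T_{L+1}\circ\bar\sigma\circ T_L\circ\cdots\circ\bar\sigma\circ T_1([x,u])$ with affine maps $T_l(z)=W_lz+b_l$, layer widths $(d,N,\dots,N,1)$ ($L$ hidden layers of width $N$), entrywise ReLU $\bar\sigma$, and all entries of all $W_l,b_l$ bounded by $B$ in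 absolute value. For $g\in\mathcal H$ let $$\mathsf R_{n,m}(g)=\frac1{m_1}\sum_{b=1}^{m_1}\frac1n\sum_{i=1}^n\Big(\frac2{m_2}\sum_{k=1}^{m_2}|Y_i-g(X_i,U_{b,i,k})|-\frac1{m_2(m_2-1)}\sum_{k\ne k'}|g(X_i,U_{b,i,k})-g(X_i,U_{b,i,k'})|\Big).$$ Let $\hat g$ be any (random) element of $\mathcal H$ with $\mathsf R_{n,m}(\hat g)\le\inf_{g\in\mathcal H}\mathsf R_{n,m}(g)+\delta_{\mathrm{opt}}$ almost surely, where the optimization error $\delta_{\mathrm{opt}}$ may be random. Let $F^\star(x,y)=\mathbb P(Y\le y\mid X=x)$ and $F_g(x,y)=\mathbb P_{U\sim\mu_u}(g(x,U)\le y)$ (with $g=\hat g$ held fixed in $F_{\hat g}$), and $$\|F-G\|_2^2=\int\Big(\int_{-\infty}^{\infty}(F(x,y)-G(x,y))^2\,dy\Big)\mu_{0,x}(dx),$$ where $\mu_{0,x}$ is the law of $X$. **Theorem.** For all $c_0>0$ and $c_1$ there is a constant $C>0$, depending only on $c_0$ and $c_1$, such that for every setting as above with $n\ge3$, $L\ge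 3$, $N\ge\tilde d+d+2$, $\log B\le c_1\log n$ and $\log(NL)\le c_1\log n$, and for every $t>0$, with probability at least $1-Ce^{-t}$, $$\|F_{\hat g}-F^\star\|_2^2\le C\Big(\delta_{\mathrm a}+\delta_{\mathrm s}+\sqrt{\delta_{\mathrm s}}\,\sqrt{\frac1{m_1m_2}}+\delta_{\mathrm{opt}}\Big),\qquad \delta_{\mathrm a}=\inf_{g\in\mathcal H}\|F_g-F^\star\|_2^2,\quad \delta_{\mathrm s}=\frac{(NL)^2\log n+t}{n}.$$ -/

import Mathlib

open MeasureTheory ProbabilityTheory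

namespace NDRE

noncomputable section

/-! ### Stochastic deep ReLU networks -/

/-- Layer widths `(d₀, d₁, …, d_L, d_{L+1}) = (d, N, …, N, 1)`. -/
def layerWidth (d L N : ℕ) : ℕ → ℕ
  | 0 => d
  | l + 1 => if l < L then N else 1

/-- Weight matrices and bias vectors. The affine map from layer `l` to layer `l + 1` is
`z ↦ weight l * z + bias l`; a network of depth `L` uses those with `l ≤ L`. -/
structure Params (d L N : ℕ) where
  weight : ∀ l : ℕ, Matrix (Fin (layerWidth d L N (l + 1))) (Fin (layerWidth d L N l)) ℝ
  bias : ∀ l : ℕ, Fin (layerWidth d L N (l + 1)) → ℝ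

namespace Params

variable {d L N : ℕ}

/-- All weights and biases that the network uses are bounded by `B` in absolute value. -/
def BoundedBy (θ : Params d L N) (B : ℝ) : Prop :=
  ∀ l ≤ L, (∀ i j, |θ.weight l i j| ≤ B) ∧ ∀ i, |θ.bias l i| ≤ B

/-- Vector of values at layer `l`: the input for `l = 0`, and afterwards the entrywise
ReLU of an affine image of the preceding layer. -/
def hidden (θ : Params d L N) (z : Fin d → ℝ) : ∀ l : ℕ, Fin (layerWidth d L N l) → ℝ
  | 0 => z
  | l + 1 => fun i => max 0 ((θ.weight l).mulVec (hidden θ z l) i + θ.bias l i)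

lemma layerWidth_last (d L N : ℕ) : 0 < layerWidth d L N (L + 1) := by
  simp [layerWidth]

/-- The real-valued network: the last affine map applied to the `L`-th hidden layer, with no
activation after it. -/
def eval (θ : Params d L N) (z : Fin d → ℝ) : ℝ :=
  (θ.weight L).mulVec (θ.hidden z L) ⟨0, layerWidth_last d L N⟩
    + θ.bias L ⟨0, layerWidth_last d L N⟩

end Params

/-- Truncation at level `M`. -/
def trunc (M z : ℝ) : ℝ := min |z| M * Real.sign z

/-- Stochastic deep ReLU networks `(x, u) ↦ Tc_M (g ([x, u]))` with covariate `x ∈ ℝ^p`, noise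
`u ∈ ℝ^q`, depth `L`, width `N`, truncation level `M` and weights bounded by `B`. -/
def stochasticNets (p L N q : ℕ) (M B : ℝ) : Set ((Fin p → ℝ) → (Fin q → ℝ) → ℝ) :=
  {g | ∃ θ : Params (p + q) L N, θ.BoundedBy B ∧
    ∀ x u, g x u = trunc M (θ.eval (Fin.append x u))}

/-! ### Conditional distribution functions and the empirical energy loss -/

/-- The conditional CDF `F_g(x, y) = P_{U ∼ μu} (g(x, U) ≤ y)` induced by `g`. -/
def inducedCDF {p q : ℕ} (μu : Measure (Fin q → ℝ)) (g : (Fin p → ℝ) → (Fin q → ℝ) → ℝ)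
    (x : Fin p → ℝ) (y : ℝ) : ℝ :=
  μu.real {u | g x u ≤ y}

/-- The conditional CDF of `Y` given `X = x` for `(X, Y) ∼ μ₀`. -/
def trueCDF {p : ℕ} (μ₀ : Measure ((Fin p → ℝ) × ℝ)) (x : Fin p → ℝ) (y : ℝ) : ℝ :=
  condCDF μ₀ x y

/-- The distance `‖F - G‖₂` between conditional CDFs, with covariate distribution `μX`. -/
def cdfDist {p : ℕ} (μX : Measure (Fin p → ℝ)) (F G : (Fin p → ℝ) → ℝ → ℝ) : ℝ :=
  √(∫ x, (∫ t : ℝ, (F x t - G x t) ^ 2) ∂μX)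

/-- The empirical energy loss `R_{n,m}(g)` on data `(x i, y i)` and noise `u b i k`. -/
def empiricalRisk {p q n m₁ m₂ : ℕ} (z : Fin n → (Fin p → ℝ) × ℝ)
    (u : Fin m₁ → Fin n → Fin m₂ → Fin q → ℝ) (g : (Fin p → ℝ) → (Fin q → ℝ) → ℝ) : ℝ :=
  1 / (m₁ : ℝ) * ∑ b, 1 / (n : ℝ) * ∑ i,
    (2 / (m₂ : ℝ) * ∑ k, |(z i).2 - g (z i).1 (u b i k)|
      - 1 / ((m₂ : ℝ) * ((m₂ : ℝ) - 1)) *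
        ∑ k, ∑ k' ∈ Finset.univ.erase k, |g (z i).1 (u b i k) - g (z i).1 (u b i k')|)

/-- The approximation error `δ_a`. -/
def approxError (p L N q : ℕ) (M B : ℝ) (μ₀ : Measure ((Fin p → ℝ) × ℝ))
    (μu : Measure (Fin q → ℝ)) : ℝ :=
  ⨅ g : stochasticNets p L N q M B,
    cdfDist (μ₀.map Prod.fst) (inducedCDF μu (g : (Fin p → ℝ) → (Fin q → ℝ) → ℝ))
      (trueCDF μ₀) ^ 2

/-- The stochastic error `δ_s = ((N L)² log n + t) / n`. -/
def stochError (L N n : ℕ) (t : ℝ) : ℝ :=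
  (((N : ℝ) * L) ^ 2 * Real.log n + t) / n

end

end NDRE

/-!
The proof is a localized empirical process argument for the loss differences of the class.

*Identification.* Conditionally on the data, the energy loss is an unbiased estimate of twice the
continuous ranked probability score, whose excess over the minimum is `‖F_g - F⋆‖₂²`. So the mean
loss difference of two networks is `2 (‖F_g - F⋆‖₂² - ‖F_h - F⋆‖₂²)` (`integral_sampleLoss_sub`). Its
second moment is at most a constant times `‖F_g - F⋆‖₂² + ‖F_h - F⋆‖₂² + 1 / (m₁ m₂)`
(`integral_sq_sampleLoss_sub_le`): the conditional mean given the data is controlled by the two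
distances, and the conditional variance over the `m₁ m₂` noise variables is of order `1 / (m₁ m₂)` by
the Efron-Stein inequality for bounded differences. This Bernstein condition gives the fast rate,
and it produces the term `√δ_s √(1 / (m₁ m₂))`.

*Complexity.* The noise is unbounded and the depth is arbitrary, so covering numbers in the
supremum norm are of no use. Instead, for every probability measure `Q` the class has a net of scale
`1 / n` in `L¹(Q)` of logarithmic size `O((N L)² log n)` (`exists_net_netFun`). This comes from
counting threshold patterns: for a fixed set of active units a ReLU network is a polynomial in its
parameters, and the number of sign patterns of a family of polynomials is bounded by counting the
nondegenerate zeros of a polynomial system (`card_nondegenerate_zeros_le`,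
`ncard_signPatterns_le`, `ncard_thresholdPatterns_le`). A random sample separates the functions of
a packing by their threshold patterns, so packings are small (`exists_net_of_patterns`).

*Deviations.* Let `θ` be the parameters of the approximate minimizer and `θ'` its neighbour in a
net for the population measure. Bernstein's inequality and a union bound over the net compare the
empirical and the mean loss differences of `θ'` and of a nearly optimal network
(`measure_exists_excess_le`). The losses of `θ` and `θ'` differ by at most four times their average
distance on the sample, and symmetrization with nets for the empirical measures bounds this
distance by eight times its mean, which is at most `1 / n`, plus a term of order `δ_s`, for all
pairs of networks at once (`measure_exists_meanDist_gt_le`). The theorem follows from these two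
bounds by an elementary computation (`risk_le_of_deviation_bounds`).
-/

namespace NDRE

/-! ### Nondegenerate zeros of polynomial maps -/

section Bezout

open MvPolynomial Filter Topology

variable {ι κ : Type*}

lemma mem_restrictDegree_iff_degreeOf (p : MvPolynomial ι ℝ) (n : ℕ) :
    p ∈ restrictDegree ι ℝ n ↔ ∀ i, p.degreeOf i ≤ n := by
  simp only [mem_restrictDegree, degreeOf_le_iff]
  exact ⟨fun h i s hs => h s hs i, fun h s hs i => h i s hs⟩

lemma finrank_restrictDegree [Fintype ι] (n : ℕ) :
    Module.finrank ℝ (restrictDegree ι ℝ n) = (n + 1) ^ Fintype.card ι := by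
  classical
  have e : {f : ι →₀ ℕ | ∀ i, f i ≤ n} ≃ (ι → Fin (n + 1)) :=
    { toFun := fun f i => ⟨f.1 i, Nat.lt_succ_of_le (f.2 i)⟩
      invFun := fun g => ⟨Finsupp.equivFunOnFinite.symm fun i => (g i : ℕ),
        fun i => by simpa using Nat.lt_succ_iff.mp (g i).2⟩
      left_inv := fun f => by ext i; simp
      right_inv := fun g => by ext i; simp }
  rw [restrictDegree, Module.finrank_eq_nat_card_basis (basisRestrictSupport ℝ {f : ι →₀ ℕ | ∀ i, f i ≤ n}),
    Nat.card_congr e]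
  simp

lemma degreeOf_bind₁_le [Fintype ι] {h : ι → MvPolynomial ι ℝ} {D s : ℕ}
    (hD : ∀ a j, (h a).degreeOf j ≤ D) {p : MvPolynomial ι ℝ} (hp : ∀ i, p.degreeOf i ≤ s)
    (j : ι) : (bind₁ h p).degreeOf j ≤ Fintype.card ι * (s * D) := by
  have hsum : bind₁ h p = ∑ d ∈ p.support, C (p.coeff d) * ∏ i, h i ^ d i := by
    conv_lhs => rw [p.as_sum]
    rw [map_sum]
    refine Finset.sum_congr rfl fun d _ => ?_
    rw [bind₁_monomial, Finset.prod_subset (Finset.subset_univ _)]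
    intro i _ hi
    rw [Finsupp.notMem_support_iff.mp hi, pow_zero]
  rw [hsum]
  refine (degreeOf_sum_le _ _ _).trans (Finset.sup_le fun d hd => ?_)
  refine (degreeOf_C_mul_le _ _ _).trans ((degreeOf_prod_le _ _ _).trans ?_)
  refine (Finset.sum_le_card_nsmul _ _ (s * D) fun i _ => ?_).trans (by simp)
  exact (degreeOf_pow_le _ _ _).trans
    (Nat.mul_le_mul (degreeOf_le_iff.mp (hp i) d hd) (hD i j))

/-- Lagrange interpolation at finitely many points of `ℝ^ι`. -/
lemma exists_interpolating_polynomials [Finite κ] (x : κ → ι → ℝ) (hx : Function.Injective x) :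
    ∃ e : κ → MvPolynomial ι ℝ, (∀ k, eval (x k) (e k) = 1) ∧
      ∀ k l, k ≠ l → eval (x l) (e k) = 0 := by
  classical
  have := Fintype.ofFinite κ
  have hsep : ∀ k l, k ≠ l → ∃ a, x k a ≠ x l a := fun k l hkl =>
    Function.ne_iff.mp (hx.ne hkl)
  rcases isEmpty_or_nonempty ι with hι | hι
  · exact ⟨fun _ => 1, fun _ => map_one _, fun k l hkl =>
      (hkl (hx (Subsingleton.elim _ _))).elim⟩
  choose! a ha using hsep
  refine ⟨fun k => ∏ l ∈ Finset.univ.erase k,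
    C ((x k (a k l) - x l (a k l))⁻¹) * (X (a k l) - C (x l (a k l))), fun k => ?_, ?_⟩
  · rw [map_prod]
    refine Finset.prod_eq_one fun l hl => ?_
    have : x k (a k l) - x l (a k l) ≠ 0 :=
      sub_ne_zero.mpr (ha k l (Finset.ne_of_mem_erase hl).symm)
    simp [inv_mul_cancel₀ this]
  · intro k l hkl
    rw [map_prod]
    exact Finset.prod_eq_zero (Finset.mem_erase.mpr ⟨hkl.symm, Finset.mem_univ l⟩) (by simp)

lemma contDiff_eval [Fintype ι] (p : MvPolynomial ι ℝ) {n : WithTop ℕ∞} :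
    ContDiff ℝ n fun x : ι → ℝ => eval x p :=
  (AnalyticOnNhd.eval_mvPolynomial (𝕜 := ℝ) p).contDiff.of_le le_top

/-- A polynomial vanishing on a nonempty open set is zero. -/
lemma eq_zero_of_eventually_eval_eq_zero [Fintype ι] {p : MvPolynomial ι ℝ} {v : ι → ℝ}
    (h : ∀ᶠ w in 𝓝 v, eval w p = 0) : p = 0 := by
  obtain ⟨ε, hε, hball⟩ := Metric.eventually_nhds_iff_ball.mp h
  refine funext_set (fun i => Set.Ioo (v i - ε) (v i + ε))
    (fun i => Set.Ioo_infinite (by linarith)) fun w hw => ?_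
  rw [map_zero]
  refine hball w ?_
  rw [Metric.mem_ball, dist_pi_lt_iff hε]
  intro i
  have := hw i (Set.mem_univ i)
  rw [Real.dist_eq, abs_lt]
  constructor <;> linarith [this.1, this.2]

/-- A weak form of Bézout's inequality. If `h` has `K` nondegenerate zeros `x k`, then by the
inverse function theorem every value near `0` has `K` preimages near the `x k`, and hence
`(P k) ↦ ∑ k, e k * P k (h)` is injective when `e k` interpolates at the points `x k`; comparing
dimensions of spaces of polynomials bounds `K`. -/
theorem card_nondegenerate_zeros_le [Fintype ι] [Fintype κ] (h : ι → MvPolynomial ι ℝ) (D : ℕ)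
    (hD : ∀ a j, (h a).degreeOf j ≤ D) (x : κ → ι → ℝ) (hx : Function.Injective x)
    (h0 : ∀ k a, eval (x k) (h a) = 0)
    (hnd : ∀ k, (fderiv ℝ (fun y a => eval y (h a)) (x k)).det ≠ 0) :
    Fintype.card κ ≤ (1 + Fintype.card ι * D) ^ Fintype.card ι := by
  classical
  obtain ⟨e, he1, he0⟩ := exists_interpolating_polynomials x hx
  obtain ⟨E, hE⟩ : ∃ E : ℕ, ∀ k j, (e k).degreeOf j ≤ E :=
    ⟨∑ k, ∑ j, (e k).degreeOf j, fun k j =>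
      (Finset.single_le_sum (f := fun j => (e k).degreeOf j) (fun _ _ => Nat.zero_le _)
        (Finset.mem_univ j)).trans
      (Finset.single_le_sum (f := fun k => ∑ j, (e k).degreeOf j) (fun _ _ => Nat.zero_le _)
        (Finset.mem_univ k))⟩
  set F : (ι → ℝ) → ι → ℝ := fun y a => eval y (h a) with hF
  have hFx : ∀ k, F (x k) = 0 := fun k => funext fun a => h0 k a
  have hFs : ContDiff ℝ 1 F := contDiff_pi.mpr fun a => contDiff_eval _
  -- every neighbourhood of a zero is mapped onto a neighbourhood of the origin
  have hopen : ∀ k, ∀ N ∈ 𝓝 (x k), F '' N ∈ 𝓝 (0 : ι → ℝ) := by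
    intro k N hN
    have hs := hFs.contDiffAt.hasStrictFDerivAt (x := x k) one_ne_zero
    have hs' : HasStrictFDerivAt F
        ((ContinuousLinearMap.toContinuousLinearEquivOfDetNeZero _ (hnd k) :
          (ι → ℝ) ≃L[ℝ] (ι → ℝ)) : (ι → ℝ) →L[ℝ] (ι → ℝ)) (x k) := by
      rw [ContinuousLinearMap.coe_toContinuousLinearEquivOfDetNeZero]; exact hs
    rw [← hFx k, ← hs'.map_nhds_eq_of_equiv]
    exact image_mem_map hN
  -- the interpolation matrix stays invertible near the zeros
  have hdet : ∀ᶠ y : κ → ι → ℝ in 𝓝 x, (Matrix.of fun k l => eval (y l) (e k)).det ≠ 0 := by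
    have hc : Continuous fun y : κ → ι → ℝ => (Matrix.of fun k l => eval (y l) (e k)).det :=
      Continuous.matrix_det (continuous_matrix fun k l =>
        (MvPolynomial.continuous_eval (e k)).comp (continuous_apply l))
    refine hc.continuousAt.eventually_ne ?_
    have : (Matrix.of fun k l => eval (x l) (e k)) = (1 : Matrix κ κ ℝ) := by
      ext k l
      by_cases hkl : k = l
      · subst hkl; simp [he1]
      · simp [he0 k l hkl, hkl]
    rw [this, Matrix.det_one]
    exact one_ne_zero
  rw [nhds_pi, Filter.eventually_iff, Filter.mem_pi'] at hdet
  obtain ⟨I, N, hN, hsub⟩ := hdet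
  have hev : ∀ᶠ v in 𝓝 (0 : ι → ℝ), ∀ k, v ∈ F '' N k :=
    eventually_all.mpr fun k => hopen k _ (hN k)
  let Φ : (κ → restrictDegree ι ℝ E) →ₗ[ℝ] MvPolynomial ι ℝ :=
    ∑ k, (LinearMap.mulLeft ℝ (e k)) ∘ₗ (bind₁ h).toLinearMap ∘ₗ
      (Submodule.subtype _) ∘ₗ LinearMap.proj k
  have hΦ : ∀ P, Φ P = ∑ k, e k * bind₁ h (P k : MvPolynomial ι ℝ) := fun P => by
    simp [Φ, LinearMap.sum_apply]
  have hinj : Function.Injective Φ := by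
    rw [← LinearMap.ker_eq_bot, LinearMap.ker_eq_bot']
    intro P hP
    have hz : ∀ᶠ v in 𝓝 (0 : ι → ℝ), ∀ k, eval v (P k : MvPolynomial ι ℝ) = 0 := by
      filter_upwards [hev] with v hv
      choose y hy hyv using hv
      have hM := hsub (show y ∈ Set.pi (I : Set κ) N from fun k _ => hy k)
      have hker : Matrix.vecMul (fun k => eval v (P k : MvPolynomial ι ℝ))
          (Matrix.of fun k l => eval (y l) (e k)) = 0 := by
        ext l
        have := congrArg (eval (y l)) ((hΦ P).symm.trans hP)
        rw [map_sum, map_zero] at this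
        rw [Pi.zero_apply, ← this]
        refine Finset.sum_congr rfl fun k _ => ?_
        rw [map_mul, mul_comm (eval (y l) (e k))]
        change eval v (P k : MvPolynomial ι ℝ) * eval (y l) (e k) = _
        congr 1
        have hb : eval (y l) (bind₁ h (P k : MvPolynomial ι ℝ)) =
            eval (F (y l)) (P k : MvPolynomial ι ℝ) := by
          rw [eval, eval₂Hom_bind₁]; rfl
        rw [hb, hyv l]
      exact fun k => congrFun (Matrix.eq_zero_of_vecMul_eq_zero hM hker) k
    ext1 k
    exact Subtype.ext (eq_zero_of_eventually_eval_eq_zero (hz.mono fun v hv => hv k))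
  have hrange : ∀ P, Φ P ∈ restrictDegree ι ℝ (E + Fintype.card ι * (E * D)) := by
    intro P
    rw [mem_restrictDegree_iff_degreeOf]
    intro j
    rw [hΦ]
    refine (degreeOf_sum_le _ _ _).trans (Finset.sup_le fun k _ => ?_)
    exact (degreeOf_mul_le _ _ _).trans (add_le_add (hE k j)
      (degreeOf_bind₁_le hD ((mem_restrictDegree_iff_degreeOf _ _).mp (P k).2) j))
  have hfin := LinearMap.finrank_le_finrank_of_injective
    (f := Φ.codRestrict _ hrange) (fun P Q hPQ => hinj (congrArg Subtype.val hPQ))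
  rw [Module.finrank_pi_fintype, Finset.sum_const, finrank_restrictDegree,
    finrank_restrictDegree, Finset.card_univ, smul_eq_mul] at hfin
  have hle : (E + Fintype.card ι * (E * D) + 1) ^ Fintype.card ι ≤
      (1 + Fintype.card ι * D) ^ Fintype.card ι * (E + 1) ^ Fintype.card ι := by
    rw [← mul_pow]
    exact Nat.pow_le_pow_left (by nlinarith [Nat.zero_le (Fintype.card ι * D)]) _
  exact Nat.le_of_mul_le_mul_right (hfin.trans hle) (by positivity)

end Bezout

/-! ### Sign patterns of polynomials -/

section SignPatterns

open MvPolynomial Filter Topology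

variable {ι κ J : Type*}

lemma degreeOf_pderiv_le (a j : ι) (p : MvPolynomial ι ℝ) :
    (pderiv a p).degreeOf j ≤ p.degreeOf j := by
  classical
  rw [degreeOf_le_iff]
  intro m hm
  rw [mem_support_iff, coeff_pderiv] at hm
  have hmem : m + Finsupp.single a 1 ∈ p.support :=
    mem_support_iff.mpr (left_ne_zero_of_mul hm)
  have := degreeOf_le_iff.mp (le_refl (p.degreeOf j)) _ hmem
  rw [Finsupp.add_apply] at this
  omega

lemma hasFDerivAt_eval [Fintype ι] (p : MvPolynomial ι ℝ) (x : ι → ℝ) :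
    HasFDerivAt (fun y : ι → ℝ => eval y p)
      (∑ a, eval x (pderiv a p) • ContinuousLinearMap.proj (R := ℝ) (φ := fun _ : ι => ℝ) a)
      x := by
  classical
  induction p using MvPolynomial.induction_on with
  | C c => simpa using hasFDerivAt_const c x
  | add p q hp hq =>
    simp only [map_add, add_smul, Finset.sum_add_distrib]
    exact hp.add hq
  | mul_X p i hp =>
    simp only [map_mul, eval_X, pderiv_mul, map_add, pderiv_X]
    convert! hp.mul (hasFDerivAt_apply (𝕜 := ℝ) i x) using 1
    simp only [add_smul, Finset.sum_add_distrib, Finset.smul_sum, smul_smul]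
    rw [add_comm]
    congr 1
    · rw [Finset.sum_eq_single i]
      · simp
      · intro b _ hb
        simp [hb.symm]
      · simp
    · exact Finset.sum_congr rfl fun a _ => by rw [mul_comm]

/-- Strict sign patterns. Let `q` be the product of all `p j` and of `R - |y|²`, with `R` so large
that all `θ k` lie in the ball. The function `q²` is positive at `θ k` and vanishes on the boundary
of the region where the signs are those at `θ k`, so `q² - ⟨c, ·⟩` has a critical point in that
region for every small `c`. By Sard's theorem `c` can be chosen so that all these critical points
are nondegenerate, and then Bézout's inequality bounds their number. -/
theorem card_le_of_strict_signPatterns [Fintype ι] [Fintype κ] [Fintype J]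
    (p : J → MvPolynomial ι ℝ) (D : ℕ) (hD : ∀ j i, (p j).degreeOf i ≤ D) (θ : κ → ι → ℝ)
    (hne : ∀ k j, eval (θ k) (p j) ≠ 0)
    (hsep : ∀ k l, k ≠ l → ∃ j, eval (θ k) (p j) * eval (θ l) (p j) < 0) :
    Fintype.card κ ≤
      (1 + Fintype.card ι * (2 * (Fintype.card J * D + 2))) ^ Fintype.card ι := by
  classical
  obtain ⟨R, hR⟩ : ∃ R : ℝ, ∀ k, ∑ i, θ k i ^ 2 < R := by
    refine ⟨∑ k, ∑ i, θ k i ^ 2 + 1, fun k => ?_⟩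
    have := Finset.single_le_sum (f := fun k => ∑ i, θ k i ^ 2)
      (fun _ _ => Finset.sum_nonneg fun _ _ => sq_nonneg _) (Finset.mem_univ k)
    exact lt_of_le_of_lt this (lt_add_one _)
  set b : MvPolynomial ι ℝ := C R - ∑ i, X i ^ 2 with hb
  have hbe : ∀ y : ι → ℝ, eval y b = R - ∑ i, y i ^ 2 := fun y => by simp [hb]
  set q : MvPolynomial ι ℝ := (∏ j, p j) * b with hq
  set G : MvPolynomial ι ℝ := q ^ 2 with hG
  have hqe : ∀ y : ι → ℝ, eval y q = (∏ j, eval y (p j)) * eval y b := fun y => by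
    rw [hq, map_mul, map_prod]
  have hGe : ∀ y : ι → ℝ, eval y G = (eval y q) ^ 2 := fun y => by rw [hG, map_pow]
  have hGD : ∀ j, G.degreeOf j ≤ 2 * (Fintype.card J * D + 2) := by
    intro j
    have h1 : (∏ j, p j).degreeOf j ≤ Fintype.card J * D := by
      refine (degreeOf_prod_le _ _ _).trans ?_
      exact (Finset.sum_le_card_nsmul _ _ D fun i _ => hD i j).trans (by simp)
    have h2 : b.degreeOf j ≤ 2 := by
      rw [hb, sub_eq_add_neg, ← neg_one_mul, ← C_1, ← C_neg]
      refine (degreeOf_add_le _ _ _).trans (max_le (by simp [degreeOf_C]) ?_)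
      refine (degreeOf_C_mul_le _ _ _).trans ?_
      refine (degreeOf_sum_le _ _ _).trans (Finset.sup_le fun i _ => ?_)
      refine (degreeOf_pow_le _ _ _).trans ?_
      rw [degreeOf_X]; split_ifs <;> simp
    exact (degreeOf_pow_le _ _ _).trans
      (Nat.mul_le_mul_left _ ((degreeOf_mul_le _ _ _).trans (add_le_add h1 h2)))
  have hcont : ∀ r : MvPolynomial ι ℝ, Continuous fun y : ι → ℝ => eval y r :=
    fun r => MvPolynomial.continuous_eval r
  -- open sign regions and the compact sets that contain them
  set S : κ → Set (ι → ℝ) := fun k =>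
    {y | (∀ j, 0 < eval y (p j) * eval (θ k) (p j)) ∧ 0 < eval y b} with hS
  set T : κ → Set (ι → ℝ) := fun k =>
    {y | (∀ j, 0 ≤ eval y (p j) * eval (θ k) (p j)) ∧ 0 ≤ eval y b} with hT
  have hSo : ∀ k, IsOpen (S k) := fun k => by
    refine IsOpen.and ?_ (isOpen_lt continuous_const (hcont b))
    simp only [Set.ofPred_forall]
    exact isOpen_iInter_of_finite fun j =>
      isOpen_lt continuous_const ((hcont _).mul continuous_const)
  have hST : ∀ k, S k ⊆ T k := fun k y hy => ⟨fun j => (hy.1 j).le, hy.2.le⟩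
  have hbd : ∀ k, ∀ y ∈ T k, ∀ i, |y i| ≤ R + 1 := by
    intro k y hy i
    have h1 : ∑ i, y i ^ 2 ≤ R := by have := hy.2; rw [hbe] at this; linarith
    have h2 := Finset.single_le_sum (f := fun i => y i ^ 2) (fun _ _ => sq_nonneg _)
      (Finset.mem_univ i)
    rw [abs_le]; constructor <;> nlinarith
  have hTc : ∀ k, IsCompact (T k) := fun k => by
    refine Metric.isCompact_of_isClosed_isBounded ?_ ?_
    · refine IsClosed.and ?_ (isClosed_le continuous_const (hcont b))
      simp only [Set.ofPred_forall]
      exact isClosed_iInter fun j =>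
        isClosed_le continuous_const ((hcont _).mul continuous_const)
    · refine (Metric.isBounded_closedBall (x := (0 : ι → ℝ)) (r := |R + 1|)).subset
        fun y hy => ?_
      rw [mem_closedBall_zero_iff, pi_norm_le_iff_of_nonneg (abs_nonneg _)]
      exact fun i => (hbd k y hy i).trans (le_abs_self _)
  have hθS : ∀ k, θ k ∈ S k := fun k =>
    ⟨fun j => mul_self_pos.mpr (hne k j), by rw [hbe]; linarith [hR k]⟩
  have hGpos : ∀ k, 0 < eval (θ k) G := fun k => by
    rw [hGe, hqe]
    exact sq_pos_of_ne_zero (mul_ne_zero (Finset.prod_ne_zero_iff.mpr fun j _ => hne k j)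
      (hθS k).2.ne')
  have hGzero : ∀ k, ∀ y ∈ T k, y ∉ S k → eval y G = 0 := by
    intro k y hy hyS
    rw [hGe, hqe, sq_eq_zero_iff, mul_eq_zero]
    by_contra hcon
    push Not at hcon
    refine hyS ⟨fun j => lt_of_le_of_ne (hy.1 j) (Ne.symm ?_),
      lt_of_le_of_ne hy.2 (Ne.symm hcon.2)⟩
    exact mul_ne_zero (Finset.prod_ne_zero_iff.mp hcon.1 j (Finset.mem_univ j)) (hne k j)
  -- the gradient map and a small regular value of it
  set H : (ι → ℝ) → ι → ℝ := fun y a => eval y (pderiv a G) with hH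
  have hHd : Differentiable ℝ H := differentiable_pi.mpr fun a =>
    (contDiff_eval _).differentiable one_ne_zero
  have hsard : volume (H '' {y | (fderiv ℝ H y).det = 0}) = 0 :=
    addHaar_image_eq_zero_of_det_fderivWithin_eq_zero volume
      (fun y _ => (hHd y).hasFDerivAt.hasFDerivWithinAt) fun y hy => hy
  have hsmall : ∀ᶠ c : ι → ℝ in 𝓝 0, ∀ k, ∑ i, |c i| * (R + 1) < eval (θ k) G / 2 := by
    refine eventually_all.mpr fun k => ?_
    have hc : Continuous fun c : ι → ℝ => ∑ i, |c i| * (R + 1) := by fun_prop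
    refine hc.continuousAt.eventually_lt continuousAt_const ?_
    simpa using hGpos k
  obtain ⟨c, hcsmall, hcreg⟩ : ∃ c : ι → ℝ, (∀ k, ∑ i, |c i| * (R + 1) < eval (θ k) G / 2) ∧
      c ∉ H '' {y | (fderiv ℝ H y).det = 0} := by
    by_contra hcon
    push Not at hcon
    have hnhds : H '' {y | (fderiv ℝ H y).det = 0} ∈ 𝓝 (0 : ι → ℝ) := by
      filter_upwards [hsmall] with c hc using hcon c hc
    exact (Measure.measure_pos_of_mem_nhds volume hnhds).ne' hsard
  have hlin : ∀ k, ∀ y ∈ T k, |∑ i, c i * y i| < eval (θ k) G / 2 := by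
    intro k y hy
    refine lt_of_le_of_lt ((Finset.abs_sum_le_sum_abs _ _).trans
      (Finset.sum_le_sum fun i _ => ?_)) (hcsmall k)
    rw [abs_mul]
    exact mul_le_mul_of_nonneg_left (hbd k y hy i) (abs_nonneg _)
  have hcrit : ∀ k, ∃ y ∈ S k, H y = c := by
    intro k
    have hφc : Continuous fun y : ι → ℝ => eval y G - ∑ i, c i * y i :=
      (hcont G).sub (by fun_prop)
    obtain ⟨y, hyT, hmax⟩ := (hTc k).exists_isMaxOn ⟨_, hST k (hθS k)⟩ hφc.continuousOn
    have hyS : y ∈ S k := by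
      by_contra hyS
      have h1 := hmax (hST k (hθS k))
      simp only [Set.mem_ofPred_eq, hGzero k y hyT hyS] at h1
      have h2 := abs_lt.mp (hlin k y hyT)
      have h3 := abs_lt.mp (hlin k _ (hST k (hθS k)))
      linarith [h2.1, h2.2, h3.1, h3.2]
    refine ⟨y, hyS, ?_⟩
    have hloc : IsLocalMax (fun y : ι → ℝ => eval y G - ∑ i, c i * y i) y :=
      hmax.isLocalMax (mem_of_superset ((hSo k).mem_nhds hyS) (hST k))
    have hder := (hasFDerivAt_eval G y).sub
      (HasFDerivAt.fun_sum (u := Finset.univ) fun i _ =>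
        (hasFDerivAt_apply (𝕜 := ℝ) (F' := fun _ : ι => ℝ) i y).const_mul (c i))
    have h0 := hloc.hasFDerivAt_eq_zero hder
    funext a
    have h1 := DFunLike.congr_fun h0 (Pi.single a (1 : ℝ))
    simp [Pi.single_apply] at h1
    simp only [hH]
    linarith
  choose y hyS hyc using hcrit
  have hyinj : Function.Injective y := by
    intro k l hkl
    by_contra hne'
    obtain ⟨j, hj⟩ := hsep k l hne'
    have h1 := (hyS k).1 j
    have h2 := (hyS l).1 j
    rw [← hkl] at h2
    nlinarith [mul_pos h1 h2, sq_nonneg (eval (y k) (p j))]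
  refine card_nondegenerate_zeros_le (fun a => pderiv a G - C (c a)) _ (fun a j => ?_) y hyinj
    (fun k a => ?_) (fun k => ?_)
  · rw [sub_eq_add_neg, ← C_neg]
    refine (degreeOf_add_le _ _ _).trans (max_le ?_ (by simp [degreeOf_C]))
    exact (degreeOf_pderiv_le _ _ _).trans (hGD j)
  · have := congrFun (hyc k) a
    simp only [hH] at this
    simp [this]
  · have heq : (fun (z : ι → ℝ) a => eval z (pderiv a G - C (c a))) = fun z => H z - c := by
      funext z a; simp [hH]
    rw [heq, fderiv_sub_const]
    exact fun hdet => hcreg ⟨y k, hdet, hyc k⟩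

/-- The number of sets of the form `{j | 0 < p j θ}`. Ties are removed by replacing `p j` by
`p j - η` with a small `η > 0`. -/
theorem ncard_signPatterns_le [Fintype ι] [Fintype J] (p : J → MvPolynomial ι ℝ) (D : ℕ)
    (hD : ∀ j i, (p j).degreeOf i ≤ D) :
    (Set.range fun (θ : ι → ℝ) (j : J) => 0 < eval θ (p j)).ncard ≤
      (1 + Fintype.card ι * (2 * (Fintype.card J * D + 2))) ^ Fintype.card ι := by
  classical
  set S := Set.range fun (θ : ι → ℝ) (j : J) => 0 < eval θ (p j) with hS
  have : Fintype S := Fintype.ofFinite S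
  choose θ hθ using fun s : S => s.2
  obtain ⟨η, hη0, hη⟩ : ∃ η : ℝ, 0 < η ∧
      ∀ s : S, ∀ j, 0 < eval (θ s) (p j) → η < eval (θ s) (p j) := by
    have : ∀ᶠ η : ℝ in 𝓝[>] 0, 0 < η ∧
        ∀ s : S, ∀ j, 0 < eval (θ s) (p j) → η < eval (θ s) (p j) := by
      refine (eventually_mem_nhdsWithin).and ?_
      refine eventually_all.mpr fun s => eventually_all.mpr fun j => ?_
      by_cases h : 0 < eval (θ s) (p j)
      · filter_upwards [nhdsWithin_le_nhds (Iio_mem_nhds h)] with η hη _ using hη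
      · exact Eventually.of_forall fun _ h' => (h h').elim
    exact this.exists
  rw [← Nat.card_coe_set_eq, Nat.card_eq_fintype_card]
  have hsign : ∀ s j, (0 < eval (θ s) (p j) → 0 < eval (θ s) (p j - C η)) ∧
      (¬ 0 < eval (θ s) (p j) → eval (θ s) (p j - C η) < 0) := by
    intro s j
    rw [map_sub, eval_C]
    exact ⟨fun h => by linarith [hη s j h], fun h => by linarith [not_lt.mp h]⟩
  refine card_le_of_strict_signPatterns (fun j => p j - C η) D (fun j i => ?_) θ
    (fun s j => ?_) fun s t hst => ?_
  · rw [sub_eq_add_neg, ← C_neg]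
    exact (degreeOf_add_le _ _ _).trans (max_le (hD j i) (by simp [degreeOf_C]))
  · by_cases h : 0 < eval (θ s) (p j)
    · exact ((hsign s j).1 h).ne'
    · exact ((hsign s j).2 h).ne
  · obtain ⟨j, hj⟩ : ∃ j, (0 < eval (θ s) (p j)) ≠ (0 < eval (θ t) (p j)) := by
      refine Function.ne_iff.mp fun heq => hst (Subtype.ext ?_)
      rw [← hθ s, ← hθ t]; exact heq
    refine ⟨j, ?_⟩
    by_cases h : 0 < eval (θ s) (p j) <;> by_cases h' : 0 < eval (θ t) (p j)
    · exact (hj (by simp [h, h'])).elim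
    · exact mul_neg_of_pos_of_neg ((hsign s j).1 h) ((hsign t j).2 h')
    · exact mul_neg_of_neg_of_pos ((hsign s j).2 h) ((hsign t j).1 h')
    · exact (hj (by simp [h, h'])).elim

end SignPatterns

/-! ### Threshold patterns of ReLU networks -/

section NetworkPatterns

open MvPolynomial

/-- Index set of the scalar parameters of a network: entries of the weight matrix and of the bias
vector of each of the `L + 1` affine maps. -/
abbrev ParamIndex (d L N : ℕ) : Type :=
  Σ l : Fin (L + 1), (Fin (layerWidth d L N (l + 1)) × Fin (layerWidth d L N l)) ⊕
    Fin (layerWidth d L N (l + 1))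

variable {d L N : ℕ}

/-- The network parameters with a given vector of entries; the affine maps that a network of depth
`L` does not use are set to zero. -/
def paramsOfVec (θ : ParamIndex d L N → ℝ) : Params d L N where
  weight l i j := if h : l < L + 1 then θ ⟨⟨l, h⟩, Sum.inl (i, j)⟩ else 0
  bias l i := if h : l < L + 1 then θ ⟨⟨l, h⟩, Sum.inr i⟩ else 0

lemma layerWidth_le (hd : d ≤ N) (hN : 1 ≤ N) : ∀ l, layerWidth d L N l ≤ N
  | 0 => hd
  | l + 1 => by simp only [layerWidth]; split_ifs <;> omega

lemma card_paramIndex_le (hd : d ≤ N) (hN : 1 ≤ N) :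
    Fintype.card (ParamIndex d L N) ≤ (L + 1) * (N * N + N) := by
  rw [Fintype.card_sigma]
  refine (Finset.sum_le_card_nsmul _ _ (N * N + N) fun l _ => ?_).trans (by simp)
  rw [Fintype.card_sum, Fintype.card_prod, Fintype.card_fin, Fintype.card_fin]
  have h1 := layerWidth_le (L := L) hd hN (l + 1)
  have h2 := layerWidth_le (L := L) hd hN l
  exact add_le_add (Nat.mul_le_mul h1 h2) h1

/-- The value that enters the activation of unit `i` in layer `l + 1`. -/
def Params.preact (θ : Params d L N) (z : Fin d → ℝ) (l : ℕ)
    (i : Fin (layerWidth d L N (l + 1))) : ℝ :=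
  (θ.weight l).mulVec (θ.hidden z l) i + θ.bias l i

/-- The affine image under the parameters of layer `l` of a vector of polynomials, as polynomials
in the parameters. -/
noncomputable def affinePoly (l : ℕ) (h : Fin (layerWidth d L N l) → MvPolynomial (ParamIndex d L N) ℝ)
    (i : Fin (layerWidth d L N (l + 1))) : MvPolynomial (ParamIndex d L N) ℝ :=
  if hl : l < L + 1 then
    ∑ j, X ⟨⟨l, hl⟩, Sum.inl (i, j)⟩ * h j + X ⟨⟨l, hl⟩, Sum.inr i⟩
  else 0

open Classical in
/-- The hidden layers as polynomials in the parameters, when `σ` prescribes which units are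
active. -/
noncomputable def hiddenPoly (σ : ∀ l, Fin (layerWidth d L N (l + 1)) → Prop) (z : Fin d → ℝ) :
    ∀ l, Fin (layerWidth d L N l) → MvPolynomial (ParamIndex d L N) ℝ
  | 0 => fun i => C (z i)
  | l + 1 => fun i => if σ l i then affinePoly l (hiddenPoly σ z l) i else 0

lemma degreeOf_affinePoly_le {l D : ℕ}
    {h : Fin (layerWidth d L N l) → MvPolynomial (ParamIndex d L N) ℝ}
    (hh : ∀ i a, (h i).degreeOf a ≤ D) (i) (a) : (affinePoly l h i).degreeOf a ≤ D + 1 := by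
  classical
  unfold affinePoly
  have hX : ∀ b : ParamIndex d L N, degreeOf a (X b : MvPolynomial _ ℝ) ≤ 1 := fun b => by
    rw [degreeOf_X]; split_ifs <;> simp
  split_ifs with hl
  · refine (degreeOf_add_le _ _ _).trans (max_le ?_ ((hX _).trans (by omega)))
    refine (degreeOf_sum_le _ _ _).trans (Finset.sup_le fun j _ => ?_)
    refine (degreeOf_mul_le _ _ _).trans ?_
    have := hX ⟨⟨l, hl⟩, Sum.inl (i, j)⟩
    have := hh j a
    omega
  · simp

lemma degreeOf_hiddenPoly_le (σ : ∀ l, Fin (layerWidth d L N (l + 1)) → Prop) (z : Fin d → ℝ) :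
    ∀ l i a, (hiddenPoly σ z l i).degreeOf a ≤ l
  | 0, i, a => by simp [hiddenPoly, degreeOf_C]
  | l + 1, i, a => by
    unfold hiddenPoly
    split_ifs
    · exact degreeOf_affinePoly_le (degreeOf_hiddenPoly_le σ z l) i a
    · simp

lemma eval_affinePoly (θ : ParamIndex d L N → ℝ) {l : ℕ} (hl : l < L + 1)
    (h : Fin (layerWidth d L N l) → MvPolynomial (ParamIndex d L N) ℝ) (i) :
    eval θ (affinePoly l h i) =
      ((paramsOfVec θ).weight l).mulVec (fun j => eval θ (h j)) i + (paramsOfVec θ).bias l i := by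
  simp [affinePoly, paramsOfVec, Nat.lt_succ_iff.mp hl, Matrix.mulVec, dotProduct]

/-- As long as `σ` is the true activation pattern, the polynomials compute the network. -/
lemma eval_hiddenPoly {σ : ∀ l, Fin (layerWidth d L N (l + 1)) → Prop} {z : Fin d → ℝ}
    {θ : ParamIndex d L N → ℝ} :
    ∀ {l : ℕ}, l ≤ L + 1 →
      (∀ l' < l, ∀ i, σ l' i ↔ 0 < (paramsOfVec θ).preact z l' i) →
      ∀ i, eval θ (hiddenPoly σ z l i) = (paramsOfVec θ).hidden z l i
  | 0, _, _, i => by simp [hiddenPoly, Params.hidden]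
  | l + 1, hl, hσ, i => by
    have ih := eval_hiddenPoly (l := l) (by omega) (fun l' h' => hσ l' (by omega))
    have hpre : eval θ (affinePoly l (hiddenPoly σ z l) i) = (paramsOfVec θ).preact z l i := by
      rw [eval_affinePoly θ (by omega), funext ih]; rfl
    have hi := hσ l (by omega) i
    unfold hiddenPoly Params.hidden
    change _ = max 0 ((paramsOfVec θ).preact z l i)
    split_ifs with h
    · rw [hpre, max_eq_right (hi.mp h).le]
    · rw [map_zero, max_eq_left (not_lt.mp fun hcon => h (hi.mpr hcon))]

/-- If `F` is determined by `f` and `g`, and given the value of `f` there are at most `Γ` values of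
`g`, then `F` has at most `Γ` times as many values as `f`. -/
lemma ncard_range_le_mul {T α β γ : Type*} (f : T → α) (g : T → β) (F : T → γ)
    (hF : ∀ t t', f t = f t' → g t = g t' → F t = F t') (c : α → T → β)
    (hc : ∀ t, g t = c (f t) t) {Γ m : ℕ}
    (hΓ : ∀ a, (Set.range (c a)).Finite ∧ (Set.range (c a)).ncard ≤ Γ)
    (hf : (Set.range f).Finite ∧ (Set.range f).ncard ≤ m) :
    (Set.range F).Finite ∧ (Set.range F).ncard ≤ m * Γ := by
  classical
  let P : Finset (Σ _ : α, β) := hf.1.toFinset.sigma fun a => (hΓ a).1.toFinset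
  have hP : P.card ≤ m * Γ := by
    rw [Finset.card_sigma]
    refine (Finset.sum_le_card_nsmul _ _ Γ fun a _ => ?_).trans ?_
    · rw [← Set.ncard_eq_toFinset_card _ (hΓ a).1]; exact (hΓ a).2
    · rw [← Set.ncard_eq_toFinset_card _ hf.1, smul_eq_mul]
      exact Nat.mul_le_mul_right _ hf.2
  have hfac : ∀ x : Set.range F, ∃ t, F t = x := fun x => x.2
  choose t ht using hfac
  let φ : Set.range F → P := fun x => ⟨⟨f (t x), g (t x)⟩, by
    refine Finset.mem_sigma.mpr ⟨by simp, ?_⟩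
    simp only [Set.Finite.mem_toFinset]
    exact ⟨t x, (hc (t x)).symm⟩⟩
  have hφ : Function.Injective φ := by
    intro x y hxy
    have h := congrArg Subtype.val hxy
    simp only [φ, Sigma.mk.injEq, heq_eq_eq] at h
    apply Subtype.ext
    rw [← ht x, ← ht y]
    exact hF _ _ h.1 h.2
  have : Finite (Set.range F) := Finite.of_injective φ hφ
  refine ⟨Set.toFinite _, ?_⟩
  rw [← Nat.card_coe_set_eq]
  refine (Nat.card_le_card_of_injective φ hφ).trans ?_
  simpa using hP

variable {k : ℕ}

/-- The number of activation patterns of the first `l` hidden layers on `k` data points. Given the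
pattern of the layers below, the next layer is a family of polynomials in the parameters. -/
lemma ncard_activationPatterns_le (hd : d ≤ N) (hN : 1 ≤ N) (z : Fin k → Fin d → ℝ) :
    ∀ l ≤ L,
      (Set.range fun (θ : ParamIndex d L N → ℝ) (l' : ℕ) (j : Fin k)
        (i : Fin (layerWidth d L N (l' + 1))) =>
          l' < l ∧ 0 < (paramsOfVec θ).preact (z j) l' i).Finite ∧
      (Set.range fun (θ : ParamIndex d L N → ℝ) (l' : ℕ) (j : Fin k)
        (i : Fin (layerWidth d L N (l' + 1))) =>
          l' < l ∧ 0 < (paramsOfVec θ).preact (z j) l' i).ncard ≤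
        ((1 + Fintype.card (ParamIndex d L N) * (2 * (k * N * (L + 1) + 2))) ^
          Fintype.card (ParamIndex d L N)) ^ l
  | 0, _ => by
    have : (Set.range fun (θ : ParamIndex d L N → ℝ) (l' : ℕ) (j : Fin k)
        (i : Fin (layerWidth d L N (l' + 1))) =>
          l' < 0 ∧ 0 < (paramsOfVec θ).preact (z j) l' i) ⊆ {fun _ _ _ => False} := by
      rintro _ ⟨θ, rfl⟩
      simp
    exact ⟨(Set.finite_singleton _).subset this,
      (Set.ncard_le_ncard this).trans (by simp)⟩
  | l + 1, hl => by
    have ih := ncard_activationPatterns_le hd hN z l (by omega)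
    rw [pow_succ]
    refine ncard_range_le_mul _ (fun θ (x : Fin k × Fin (layerWidth d L N (l + 1))) =>
      0 < (paramsOfVec θ).preact (z x.1) l x.2) _ ?_
      (fun a θ x => 0 < eval θ (affinePoly l
        (hiddenPoly (fun l' i => a l' x.1 i) (z x.1) l) x.2)) ?_ (fun a => ?_) ih
    · intro θ θ' h1 h2
      funext l' j i
      rcases lt_trichotomy l' l with h | h | h
      · have := congrFun (congrFun (congrFun h1 l') j) i
        simpa [h, Nat.lt_succ_of_lt h] using this
      · subst h
        have := congrFun h2 (j, i)
        simpa using this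
      · have : ¬ l' < l + 1 := by omega
        simp [this]
    · intro θ
      funext x
      rw [eval_affinePoly θ (by omega), funext (eval_hiddenPoly (by omega) fun l' hl' i => by
        simp [hl'])]
      rfl
    · refine ⟨Set.toFinite _, (ncard_signPatterns_le _ (L + 1) fun x a => ?_).trans ?_⟩
      · exact (degreeOf_affinePoly_le (degreeOf_hiddenPoly_le _ _ l) _ _).trans (by omega)
      · gcongr
        rw [Fintype.card_prod, Fintype.card_fin, Fintype.card_fin]
        exact Nat.mul_le_mul_left _ (layerWidth_le hd hN _)

/-- The number of subsets of `k` data points of the form `{j | s j < g (z j)}`, with `g` a network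
of depth `L` and width `N`. -/
theorem ncard_thresholdPatterns_le (hd : d ≤ N) (hN : 1 ≤ N) (z : Fin k → Fin d → ℝ)
    (s : Fin k → ℝ) :
    (Set.range fun (θ : ParamIndex d L N → ℝ) (j : Fin k) =>
      s j < (paramsOfVec θ).eval (z j)).ncard ≤
      ((1 + Fintype.card (ParamIndex d L N) * (2 * (k * N * (L + 1) + 2))) ^
          Fintype.card (ParamIndex d L N)) ^ (L + 1) := by
  have ih := ncard_activationPatterns_le (L := L) hd hN z L le_rfl
  rw [pow_succ]
  refine (ncard_range_le_mul _ (fun θ (j : Fin k) => s j < (paramsOfVec θ).eval (z j)) _ ?_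
    (fun a θ j => 0 < eval θ (affinePoly L (hiddenPoly (fun l' i => a l' j i) (z j) L)
      ⟨0, Params.layerWidth_last d L N⟩ - C (s j))) ?_ (fun a => ?_) ih).2
  · exact fun _ _ _ h => h
  · intro θ
    funext j
    rw [map_sub, eval_C, sub_pos, eval_affinePoly θ (by omega),
      funext (eval_hiddenPoly (by omega) fun l' hl' i => by simp [hl'])]
    rfl
  · refine ⟨Set.toFinite _, (ncard_signPatterns_le _ (L + 1) fun x a => ?_).trans ?_⟩
    · rw [sub_eq_add_neg, ← C_neg]
      exact (degreeOf_add_le _ _ _).trans (max_le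
        (degreeOf_affinePoly_le (degreeOf_hiddenPoly_le _ _ L) _ _) (by simp [degreeOf_C]))
    · gcongr
      rw [Fintype.card_fin]
      exact Nat.le_mul_of_pos_right _ hN

end NetworkPatterns

/-! ### Packing numbers of classes with few threshold patterns -/

section Packing

variable {S Θ κ : Type*}

/-- The set of `(z, s)` for which exactly one of the functions `f`, `g` exceeds `s` at `z`. -/
def disagreement (f g : S → ℝ) : Set (S × ℝ) :=
  {w | (w.2 < f w.1) ≠ (w.2 < g w.1)}

lemma disagreement_section (f g : S → ℝ) (z : S) :
    Prod.mk z ⁻¹' disagreement f g = Set.Ico (min (f z) (g z)) (max (f z) (g z)) := by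
  ext s
  simp only [disagreement, Set.mem_preimage, Set.mem_ofPred_eq, ne_eq, eq_iff_iff, Set.mem_Ico,
    min_le_iff, lt_max_iff]
  simp only [← not_lt]
  tauto

variable [MeasurableSpace S]

lemma measurableSet_disagreement {f g : S → ℝ} (hf : Measurable f) (hg : Measurable g) :
    MeasurableSet (disagreement f g) := by
  have h1 : MeasurableSet {w : S × ℝ | w.2 < f w.1} :=
    measurableSet_lt measurable_snd (hf.comp measurable_fst)
  have h2 : MeasurableSet {w : S × ℝ | w.2 < g w.1} :=
    measurableSet_lt measurable_snd (hg.comp measurable_fst)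
  have : disagreement f g = ({w : S × ℝ | w.2 < f w.1} \ {w | w.2 < g w.1}) ∪
      ({w : S × ℝ | w.2 < g w.1} \ {w | w.2 < f w.1}) := by
    ext w
    simp only [disagreement, Set.mem_ofPred_eq, Set.mem_union, Set.mem_sdiff, ne_eq, eq_iff_iff]
    tauto
  rw [this]
  exact (h1.diff h2).union (h2.diff h1)

/-- The uniform distribution on `[-c, c]`. -/
noncomputable def unifIcc (c : ℝ) : Measure ℝ :=
  (ENNReal.ofReal (2 * c))⁻¹ • volume.restrict (Set.Icc (-c) c)

lemma isProbabilityMeasure_unifIcc {c : ℝ} (hc : 0 < c) : IsProbabilityMeasure (unifIcc c) := by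
  constructor
  rw [unifIcc, Measure.smul_apply, Measure.restrict_apply_univ, Real.volume_Icc, smul_eq_mul,
    sub_neg_eq_add, ← two_mul]
  exact ENNReal.inv_mul_cancel (by simpa using hc) ENNReal.ofReal_ne_top

/-- A point `z` with an independent uniform threshold distinguishes `f` from `g` with probability
proportional to their `L¹` distance. -/
lemma prod_unifIcc_disagreement {c : ℝ} (hc : 0 < c) (Q : Measure S) [IsProbabilityMeasure Q]
    {f g : S → ℝ} (hf : Measurable f) (hg : Measurable g) (hfc : ∀ z, |f z| ≤ c)
    (hgc : ∀ z, |g z| ≤ c) :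
    (Q.prod (unifIcc c)) (disagreement f g) = ENNReal.ofReal ((∫ z, |f z - g z| ∂Q) / (2 * c)) := by
  have := isProbabilityMeasure_unifIcc hc
  have hsec : ∀ z, unifIcc c (Prod.mk z ⁻¹' disagreement f g) =
      ENNReal.ofReal (|f z - g z| / (2 * c)) := by
    intro z
    have h1 := abs_le.mp (hfc z)
    have h2 := abs_le.mp (hgc z)
    rw [disagreement_section, unifIcc, Measure.smul_apply,
      Measure.restrict_apply measurableSet_Ico, Set.inter_eq_left.mpr ?_, Real.volume_Ico,
      max_sub_min_eq_abs, abs_sub_comm, smul_eq_mul, ENNReal.ofReal_div_of_pos (by positivity),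
      mul_comm, div_eq_mul_inv]
    intro s hs
    exact ⟨(le_min h1.1 h2.1).trans hs.1, hs.2.le.trans (max_le h1.2 h2.2)⟩
  have hint : Integrable (fun z => |f z - g z| / (2 * c)) Q := by
    refine Integrable.of_bound (C := 1) (by fun_prop) (ae_of_all _ fun z => ?_)
    rw [Real.norm_of_nonneg (by positivity), div_le_one (by positivity)]
    exact (abs_sub _ _).trans (by linarith [hfc z, hgc z])
  rw [Measure.prod_apply (measurableSet_disagreement hf hg), lintegral_congr hsec,
    ← ofReal_integral_eq_lintegral_ofReal hint (ae_of_all _ fun z => by positivity),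
    integral_div]

/-- Pollard's packing bound: if the functions `f k` are `ε`-separated in `L¹(Q)`, then `m` random
points with random thresholds distinguish all of them with positive probability, so their number
is at most that of the threshold patterns on `m` points. -/
theorem card_le_of_separated {c ε : ℝ} (hc : 0 < c) (Q : Measure S)
    [IsProbabilityMeasure Q] [Fintype κ] (f : κ → S → ℝ) (hf : ∀ k, Measurable (f k))
    (hfc : ∀ k z, |f k z| ≤ c) (hsep : ∀ k l, k ≠ l → ε < ∫ z, |f k z - f l z| ∂Q)
    {m Γ : ℕ} (hm : (Fintype.card κ : ℝ) ^ 2 * Real.exp (-(m * (ε / (2 * c)))) < 1)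
    (hΓ : ∀ (z : Fin m → S) (s : Fin m → ℝ),
      (Set.range fun (k : κ) (j : Fin m) => s j < f k (z j)).ncard ≤ Γ) :
    Fintype.card κ ≤ Γ := by
  classical
  have := isProbabilityMeasure_unifIcc hc
  set ρ := Q.prod (unifIcc c) with hρ
  set μ : Measure (Fin m → S × ℝ) := Measure.pi fun _ => ρ with hμ
  let A : κ × κ → Set (Fin m → S × ℝ) := fun x =>
    if x.1 = x.2 then ∅ else Set.univ.pi fun _ => (disagreement (f x.1) (f x.2))ᶜ
  have hA : ∀ x, μ (A x) ≤ ENNReal.ofReal (Real.exp (-(m * (ε / (2 * c))))) := by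
    rintro ⟨k, l⟩
    by_cases hkl : k = l
    · simp [A, hkl]
    simp only [A, hkl, if_false]
    rw [Measure.pi_pi, Finset.prod_const, Finset.card_univ, Fintype.card_fin]
    have h1 : ρ (disagreement (f k) (f l))ᶜ ≤ ENNReal.ofReal (Real.exp (-(ε / (2 * c)))) := by
      rw [prob_compl_eq_one_sub (measurableSet_disagreement (hf k) (hf l)),
        prod_unifIcc_disagreement hc Q (hf k) (hf l) (hfc k) (hfc l), ← ENNReal.ofReal_one,
        ← ENNReal.ofReal_sub _ (div_nonneg (integral_nonneg fun _ => abs_nonneg _) (by linarith))]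
      refine ENNReal.ofReal_le_ofReal ?_
      have h2 : ε / (2 * c) ≤ (∫ z, |f k z - f l z| ∂Q) / (2 * c) := by
        gcongr; exact (hsep k l hkl).le
      linarith [Real.add_one_le_exp (-(ε / (2 * c)))]
    calc ρ (disagreement (f k) (f l))ᶜ ^ m
        ≤ ENNReal.ofReal (Real.exp (-(ε / (2 * c)))) ^ m := by gcongr
      _ = ENNReal.ofReal (Real.exp (-(m * (ε / (2 * c))))) := by
          rw [← ENNReal.ofReal_pow (Real.exp_pos _).le, ← Real.exp_nat_mul]
          ring_nf
  have hunion : μ (⋃ x, A x) < 1 := by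
    refine (measure_iUnion_fintype_le μ A).trans_lt ?_
    refine (Finset.sum_le_card_nsmul _ _ _ fun x _ => hA x).trans_lt ?_
    rw [Finset.card_univ, Fintype.card_prod, nsmul_eq_mul, ← ENNReal.ofReal_natCast,
      ← ENNReal.ofReal_mul (Nat.cast_nonneg _), ← ENNReal.ofReal_one,
      ENNReal.ofReal_lt_ofReal_iff one_pos]
    push_cast
    rw [← sq]
    exact hm
  obtain ⟨w, hw⟩ : ∃ w, w ∉ ⋃ x, A x := by
    by_contra hcon
    push Not at hcon
    rw [Set.eq_univ_of_forall hcon, measure_univ] at hunion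
    exact lt_irrefl _ hunion
  have hinj : Function.Injective fun (k : κ) (j : Fin m) => (w j).2 < f k (w j).1 := by
    intro k l hkl
    by_contra hne
    refine hw (Set.mem_iUnion.mpr ⟨(k, l), ?_⟩)
    simp only [A, hne, if_false]
    intro j _ hj
    exact hj (congrFun hkl j)
  refine le_trans (le_of_eq ?_) (hΓ (fun j => (w j).1) (fun j => (w j).2))
  rw [← Nat.card_coe_set_eq, Nat.card_range_of_injective hinj, Nat.card_eq_fintype_card]

/-- A class of functions without `ε`-separated subsets of size `M` has an `ε`-net of size less
than `M`. -/
theorem exists_net_of_patterns {c ε : ℝ} (hc : 0 < c) (hε : 0 ≤ ε) (Q : Measure S)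
    [IsProbabilityMeasure Q] (f : Θ → S → ℝ) (hf : ∀ θ, Measurable (f θ))
    (hfc : ∀ θ z, |f θ z| ≤ c) {m M Γ : ℕ}
    (hm : (M : ℝ) ^ 2 * Real.exp (-(m * (ε / (2 * c)))) < 1) (hΓM : Γ < M)
    (hΓ : ∀ (z : Fin m → S) (s : Fin m → ℝ),
      (Set.range fun (θ : Θ) (j : Fin m) => s j < f θ (z j)).ncard ≤ Γ) :
    ∃ T : Finset Θ, T.card ≤ M ∧ ∀ θ, ∃ θ' ∈ T, ∫ z, |f θ z - f θ' z| ∂Q ≤ ε := by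
  classical
  by_contra hcon
  push Not at hcon
  have hsep : ∀ n ≤ M, ∃ T : Finset Θ, T.card = n ∧
      ∀ θ ∈ T, ∀ θ' ∈ T, θ ≠ θ' → ε < ∫ z, |f θ z - f θ' z| ∂Q := by
    intro n
    induction n with
    | zero => exact fun _ => ⟨∅, by simp⟩
    | succ n ih =>
      intro hn
      obtain ⟨T, hT, hsepT⟩ := ih (by omega)
      obtain ⟨θ, hθ⟩ := hcon T (by omega)
      have hθT : θ ∉ T := fun hmem => by
        have := hθ θ hmem
        simp at this
        linarith
      refine ⟨insert θ T, by rw [Finset.card_insert_of_notMem hθT, hT], ?_⟩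
      intro a ha b hb hab
      rcases Finset.mem_insert.mp ha with rfl | ha' <;>
        rcases Finset.mem_insert.mp hb with rfl | hb'
      · exact (hab rfl).elim
      · exact hθ b hb'
      · have := hθ a ha'
        simpa only [abs_sub_comm] using this
      · exact hsepT a ha' b hb' hab
  obtain ⟨T, hT, hsepT⟩ := hsep M le_rfl
  have hcard := card_le_of_separated hc Q (fun θ : T => f θ) (fun θ => hf θ) (fun θ => hfc θ)
    (fun θ θ' h => hsepT θ θ.2 θ' θ'.2 fun h' => h (Subtype.ext h')) (m := m) (Γ := Γ)
    (by simpa [hT] using hm) (fun z s => by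
      refine (Set.ncard_le_ncard ?_ (Set.toFinite _)).trans (hΓ z s)
      rintro _ ⟨θ, rfl⟩
      exact ⟨θ, rfl⟩)
  rw [Fintype.card_coe, hT] at hcard
  omega

end Packing

/-! ### Covering numbers of the network class -/

section Covering

lemma trunc_eq_max_min {c : ℝ} (hc : 0 < c) (x : ℝ) : trunc c x = max (-c) (min c x) := by
  unfold trunc
  rcases lt_trichotomy x 0 with hx | rfl | hx
  · rw [Real.sign_of_neg hx, abs_of_neg hx, min_eq_right (by linarith : x ≤ c), mul_neg_one,
      ← max_neg_neg, neg_neg, max_comm]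
  · simp [hc.le]
  · rw [Real.sign_of_pos hx, abs_of_pos hx, mul_one, min_comm, max_eq_right]
    exact le_min (by linarith) (by linarith)

lemma abs_trunc_le {c : ℝ} (hc : 0 < c) (x : ℝ) : |trunc c x| ≤ c := by
  rw [trunc_eq_max_min hc, abs_le]
  exact ⟨le_max_left _ _, max_le (by linarith) (min_le_left _ _)⟩

lemma continuous_trunc {c : ℝ} (hc : 0 < c) : Continuous (trunc c) := by
  rw [show trunc c = fun x => max (-c) (min c x) from funext (trunc_eq_max_min hc)]
  fun_prop

variable {p q L N : ℕ}

/-- The truncated network with parameter vector `θ` as a function of the pair `(x, u)`. -/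
noncomputable def netFun (c : ℝ) (θ : ParamIndex (p + q) L N → ℝ)
    (z : (Fin p → ℝ) × (Fin q → ℝ)) : ℝ :=
  trunc c ((paramsOfVec θ).eval (Fin.append z.1 z.2))

lemma abs_netFun_le {c : ℝ} (hc : 0 < c) (θ : ParamIndex (p + q) L N → ℝ)
    (z : (Fin p → ℝ) × (Fin q → ℝ)) : |netFun c θ z| ≤ c :=
  abs_trunc_le hc _

lemma continuous_affine {d : ℕ} (l : ℕ) (i : Fin (layerWidth d L N (l + 1)))
    {h : (ParamIndex d L N → ℝ) × (Fin d → ℝ) → Fin (layerWidth d L N l) → ℝ}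
    (hh : Continuous h) :
    Continuous fun w : (ParamIndex d L N → ℝ) × (Fin d → ℝ) =>
      ((paramsOfVec w.1).weight l).mulVec (h w) i + (paramsOfVec w.1).bias l i := by
  have hW : Continuous fun w : (ParamIndex d L N → ℝ) × (Fin d → ℝ) =>
      (paramsOfVec w.1).weight l := by
    refine continuous_matrix fun i j => ?_
    unfold paramsOfVec; dsimp only; split_ifs <;> fun_prop
  have hb : Continuous fun w : (ParamIndex d L N → ℝ) × (Fin d → ℝ) =>
      (paramsOfVec w.1).bias l i := by
    unfold paramsOfVec; dsimp only; split_ifs <;> fun_prop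
  exact ((continuous_apply i).comp (hW.matrix_mulVec hh)).add hb

lemma continuous_hidden {d : ℕ} : ∀ l, Continuous fun w : (ParamIndex d L N → ℝ) × (Fin d → ℝ) =>
    (paramsOfVec w.1).hidden w.2 l
  | 0 => continuous_snd
  | l + 1 => continuous_pi fun i =>
    continuous_const.max (continuous_affine l i (continuous_hidden l))

lemma continuous_eval {d : ℕ} : Continuous fun w : (ParamIndex d L N → ℝ) × (Fin d → ℝ) =>
    (paramsOfVec w.1).eval w.2 :=
  continuous_affine L _ (continuous_hidden L)

lemma continuous_append : Continuous fun z : (Fin p → ℝ) × (Fin q → ℝ) =>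
    (Fin.append z.1 z.2 : Fin (p + q) → ℝ) := by
  refine continuous_pi fun i => ?_
  refine Fin.addCases (fun i => ?_) (fun i => ?_) i
  · simp only [Fin.append_left]; fun_prop
  · simp only [Fin.append_right]; fun_prop

lemma continuous_netFun {c : ℝ} (hc : 0 < c) :
    Continuous fun w : (ParamIndex (p + q) L N → ℝ) × ((Fin p → ℝ) × (Fin q → ℝ)) =>
      netFun c w.1 w.2 :=
  (continuous_trunc hc).comp (continuous_eval.comp
    (continuous_fst.prodMk (continuous_append.comp continuous_snd)))

lemma measurable_netFun {c : ℝ} (hc : 0 < c) (θ : ParamIndex (p + q) L N → ℝ) :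
    Measurable (netFun c θ : (Fin p → ℝ) × (Fin q → ℝ) → ℝ) :=
  ((continuous_netFun hc).comp (Continuous.prodMk_right θ)).measurable

lemma ncard_netFun_patterns_le {c : ℝ} (hc : 0 < c) (hd : p + q ≤ N) (hN : 1 ≤ N) {k : ℕ}
    (Θ : Set (ParamIndex (p + q) L N → ℝ)) (z : Fin k → (Fin p → ℝ) × (Fin q → ℝ))
    (s : Fin k → ℝ) :
    (Set.range fun (θ : Θ) (j : Fin k) =>
      s j < netFun c (θ : ParamIndex (p + q) L N → ℝ) (z j)).ncard ≤
      ((1 + Fintype.card (ParamIndex (p + q) L N) * (2 * (k * N * (L + 1) + 2))) ^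
          Fintype.card (ParamIndex (p + q) L N)) ^ (L + 1) := by
  refine le_trans ?_ (ncard_thresholdPatterns_le hd hN (fun j => Fin.append (z j).1 (z j).2) s)
  refine le_trans (Set.ncard_le_ncard ?_ (Set.toFinite _))
    (Set.ncard_image_le (f := fun (P : Fin k → Prop) j => s j < -c ∨ (s j < c ∧ P j))
      (Set.toFinite _))
  rintro _ ⟨θ, rfl⟩
  refine ⟨_, ⟨θ, rfl⟩, ?_⟩
  funext j
  simp only [netFun, trunc_eq_max_min hc, lt_max_iff, lt_min_iff]

lemma exists_nat_mul_log_lt (b : ℝ) : ∃ K : ℕ, 1 ≤ K ∧ 8 * (b + Real.log K) < K := by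
  have h1 : ∀ᶠ x : ℝ in Filter.atTop, ‖Real.log x‖ ≤ 1 / 16 * ‖x‖ :=
    Real.isLittleO_log_id_atTop.def (by norm_num)
  have h2 := (h1.and ((Filter.eventually_gt_atTop (16 * b)).and
    (Filter.eventually_ge_atTop (1 : ℝ))))
  obtain ⟨K, hK⟩ := (tendsto_natCast_atTop_atTop.eventually h2).exists
  refine ⟨K, by exact_mod_cast hK.2.2, ?_⟩
  have h3 := hK.1
  rw [Real.norm_of_nonneg (by positivity : (0 : ℝ) ≤ (K : ℝ))] at h3
  have := (le_abs_self _).trans h3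
  linarith [hK.2.1]

/-- Uniform covering numbers of the network class: for every probability measure `Q` on the space
of pairs `(x, u)` the class has a net of scale `1 / n` in `L¹(Q)` of logarithmic size
`O((N L)² log n)`, whatever the bound on the weights and however spread out `Q` is. -/
theorem exists_net_netFun (c c₁ : ℝ) (hc : 0 < c) :
    ∃ K : ℕ, ∀ (p q L N n : ℕ), 3 ≤ n → 1 ≤ L → p + q ≤ N → 1 ≤ N →
      Real.log ((N : ℝ) * L) ≤ c₁ * Real.log n →
      ∀ (Q : Measure ((Fin p → ℝ) × (Fin q → ℝ))) [IsProbabilityMeasure Q]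
        (Θ : Set (ParamIndex (p + q) L N → ℝ)),
        ∃ T : Finset Θ, T.card ≤ n ^ (K * (N * L) ^ 2) ∧
          ∀ θ : Θ, ∃ θ' ∈ T, ∫ z, |netFun c (θ : ParamIndex (p + q) L N → ℝ) z -
            netFun c (θ' : ParamIndex (p + q) L N → ℝ) z| ∂Q ≤ 1 / n := by
  obtain ⟨C, hC⟩ : ∃ C : ℕ, 4 * c < C := exists_nat_gt _
  have hC1 : 1 ≤ C := by
    by_contra h
    have : C = 0 := by omega
    subst this
    norm_num at hC
    linarith
  obtain ⟨K, hK1, hK⟩ := exists_nat_mul_log_lt (Real.log (33 * C) + 5 * c₁ + 2)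
  refine ⟨K, fun p q L N n hn hL hd hN hlog Q _ Θ => ?_⟩
  set a := N * L with ha
  set W := Fintype.card (ParamIndex (p + q) L N) with hW
  have ha1 : 1 ≤ a := Nat.mul_pos hN hL
  set m := C * K * a ^ 2 * n ^ 2 with hm
  have hm1 : 1 ≤ m := by
    have : 0 < n := by omega
    exact Nat.succ_le_of_lt (by positivity)
  have hn0 : (0 : ℝ) < n := by exact_mod_cast (by omega : 0 < n)
  have haR : (1 : ℝ) ≤ a := by exact_mod_cast ha1
  have hKR : (1 : ℝ) ≤ K := by exact_mod_cast hK1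
  have hCR : (1 : ℝ) ≤ C := by exact_mod_cast hC1
  have hlogn : 1 ≤ Real.log n := by
    rw [Real.le_log_iff_exp_le hn0]
    have : (3 : ℝ) ≤ n := by exact_mod_cast hn
    linarith [Real.exp_one_lt_d9]
  have hWle : W ≤ 4 * (L * N ^ 2) := by
    refine (card_paramIndex_le hd hN).trans ?_
    calc (L + 1) * (N * N + N) ≤ (2 * L) * (2 * N ^ 2) := by
          apply Nat.mul_le_mul <;> nlinarith
      _ = _ := by ring
  have hA : W * (L + 1) ≤ 8 * a ^ 2 := by
    calc W * (L + 1) ≤ 4 * (L * N ^ 2) * (2 * L) := Nat.mul_le_mul hWle (by omega)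
      _ = 8 * a ^ 2 := by rw [ha]; ring
  have hbase : 1 + W * (2 * (m * N * (L + 1) + 2)) ≤ 33 * a ^ 3 * m := by
    have h1 : W ≤ 4 * a ^ 2 := hWle.trans (by rw [ha]; nlinarith [Nat.mul_le_mul hL (le_refl (L * N ^ 2))])
    have h2 : N * (L + 1) ≤ 2 * a := by rw [ha]; nlinarith
    have h3 : m * N * (L + 1) ≤ m * (2 * a) := by
      rw [mul_assoc]; exact Nat.mul_le_mul_left _ h2
    calc 1 + W * (2 * (m * N * (L + 1) + 2)) ≤ 1 + 4 * a ^ 2 * (2 * (m * (2 * a) + 2)) := by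
          gcongr
      _ = 1 + 16 * (a ^ 3 * m) + 16 * (a ^ 2 * 1) := by ring
      _ ≤ a ^ 3 * m + 16 * (a ^ 3 * m) + 16 * (a ^ 3 * m) := by
          have h4 : 1 ≤ a ^ 3 * m := Nat.mul_pos (by positivity) hm1
          have h5 : a ^ 2 * 1 ≤ a ^ 3 * m :=
            Nat.mul_le_mul (Nat.pow_le_pow_right ha1 (by norm_num)) hm1
          gcongr
      _ = _ := by ring
  set β := 1 + W * (2 * (m * N * (L + 1) + 2)) with hβ
  have hβ1 : (1 : ℝ) ≤ β := by exact_mod_cast Nat.le_add_right 1 _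
  have hlogβ : Real.log β ≤ (Real.log (33 * C) + 5 * c₁ + 2 + Real.log K) * Real.log n := by
    have h1 : (β : ℝ) ≤ 33 * C * K * a ^ 5 * n ^ 2 := by
      calc (β : ℝ) ≤ ((33 * a ^ 3 * m : ℕ) : ℝ) := by exact_mod_cast hbase
        _ = _ := by rw [hm]; push_cast; ring
    have h2 : Real.log β ≤ Real.log (33 * C) + Real.log K + 5 * Real.log a + 2 * Real.log n := by
      refine (Real.log_le_log (by linarith) h1).trans (le_of_eq ?_)
      rw [Real.log_mul (by positivity) (by positivity), Real.log_mul (by positivity) (by positivity),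
        Real.log_mul (by positivity) (by positivity), Real.log_pow, Real.log_pow]
      norm_num
    have h3 : Real.log a ≤ c₁ * Real.log n := by rw [ha]; push_cast; exact hlog
    have h4 : 0 ≤ Real.log (33 * C) := Real.log_nonneg (by nlinarith)
    have h5 : 0 ≤ Real.log K := Real.log_nonneg hKR
    nlinarith [mul_nonneg h4 (sub_nonneg.mpr hlogn), mul_nonneg h5 (sub_nonneg.mpr hlogn)]
  refine exists_net_of_patterns hc (by positivity) Q (fun θ : Θ => netFun c θ.1)
    (fun θ => measurable_netFun hc _) (fun θ z => abs_netFun_le hc _ z) (m := m)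
    (Γ := (β ^ W) ^ (L + 1)) ?_ ?_ (fun z s => ncard_netFun_patterns_le hc hd hN Θ z s)
  · have h1 : ((n ^ (K * a ^ 2) : ℕ) : ℝ) = Real.exp (K * a ^ 2 * Real.log n) := by
      rw [mul_comm _ (Real.log _), Real.exp_mul, Real.exp_log hn0]
      push_cast
      rw [← Real.rpow_natCast]
      push_cast
      rfl
    rw [h1, ← Real.exp_nat_mul, ← Real.exp_add, Real.exp_lt_one_iff]
    have h2 : (m : ℝ) * (1 / n / (2 * c)) = K * a ^ 2 * n * (C / (2 * c)) := by
      rw [hm]; push_cast; field_simp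
    have h3 : 2 < C / (2 * c) := by rw [lt_div_iff₀ (by positivity)]; linarith
    have h4 : Real.log n < n := (Real.log_le_sub_one_of_pos hn0).trans_lt (by linarith)
    rw [h2]
    have h5 : K * a ^ 2 * Real.log n < K * a ^ 2 * n := by gcongr
    have h6 : K * a ^ 2 * n * 2 < K * a ^ 2 * n * (C / (2 * c)) := by gcongr
    push_cast
    linarith
  · have hβ0 : (0 : ℝ) < β := by linarith
    have : ((β ^ W) ^ (L + 1) : ℝ) < (n : ℝ) ^ (K * a ^ 2) := by
      rw [← Real.log_lt_log_iff (by positivity) (by positivity), ← pow_mul, Real.log_pow,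
        Real.log_pow]
      push_cast
      have h1 : (W : ℝ) * (L + 1) ≤ 8 * a ^ 2 := by exact_mod_cast hA
      calc (W : ℝ) * (L + 1) * Real.log β ≤ 8 * a ^ 2 *
            ((Real.log (33 * C) + 5 * c₁ + 2 + Real.log K) * Real.log n) :=
            mul_le_mul h1 hlogβ (Real.log_nonneg hβ1) (by positivity)
        _ = (8 * (Real.log (33 * C) + 5 * c₁ + 2 + Real.log K)) * (a ^ 2 * Real.log n) := by ring
        _ < K * (a ^ 2 * Real.log n) := by gcongr
        _ = _ := by ring
    exact_mod_cast this

end Covering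

/-! ### Uniform multiplicative deviations of nonnegative functions -/

section Symmetrization

variable {V Θ : Type*}

lemma exp_swap_le {b x y : ℝ} (hb : 0 < b) (hx : 0 ≤ x) (hxb : x ≤ b) (hy : 0 ≤ y) (hyb : y ≤ b) :
    Real.exp (1 / (6 * b) * (x - 4 * y)) + Real.exp (1 / (6 * b) * (y - 4 * x)) ≤ 2 := by
  set s := x / (6 * b) with hs
  set t := y / (6 * b) with ht
  have hs0 : 0 ≤ s := by positivity
  have ht0 : 0 ≤ t := by positivity
  have hs1 : s ≤ 1 / 6 := by rw [hs, div_le_div_iff₀ (by positivity) (by norm_num)]; linarith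
  have ht1 : t ≤ 1 / 6 := by rw [ht, div_le_div_iff₀ (by positivity) (by norm_num)]; linarith
  have e1 : 1 / (6 * b) * (x - 4 * y) = s - 4 * t := by rw [hs, ht]; ring
  have e2 : 1 / (6 * b) * (y - 4 * x) = t - 4 * s := by rw [hs, ht]; ring
  rw [e1, e2]
  have h1 := (abs_le.mp (Real.abs_exp_sub_one_sub_id_le (x := s - 4 * t)
    (abs_le.mpr ⟨by linarith, by linarith⟩))).2
  have h2 := (abs_le.mp (Real.abs_exp_sub_one_sub_id_le (x := t - 4 * s)
    (abs_le.mpr ⟨by linarith, by linarith⟩))).2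
  nlinarith [mul_nonneg hs0 ht0, mul_nonneg hs0 (sub_nonneg.mpr hs1),
    mul_nonneg ht0 (sub_nonneg.mpr ht1)]

/-- Exchange of the two copies of a pair of samples in the coordinates selected by `σ`. -/
def swapAt {n : ℕ} (σ : Fin n → Bool) (w : Fin n → V × V) : Fin n → V × V :=
  fun i => if σ i then (w i).swap else w i

/-- For fixed data, the fraction of coordinate exchanges after which some function of a class with
a net of size `M` has a much larger sum over the first sample than over the second. -/
lemma sum_indicator_swapAt_le {n M : ℕ} {b a η : ℝ} (hb : 0 < b) (A : Θ → V → ℝ)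
    (hA0 : ∀ θ v, 0 ≤ A θ v) (hAb : ∀ θ v, A θ v ≤ b) (w : Fin n → V × V) (T : Finset Θ)
    (hT : T.card ≤ M)
    (hnet : ∀ θ, ∃ θ' ∈ T,
      ∑ i, (|A θ (w i).1 - A θ' (w i).1| + |A θ (w i).2 - A θ' (w i).2|) ≤ n * η)
    (E : Set (Fin n → V × V))
    (hE : ∀ w ∈ E, ∃ θ, n * a < ∑ i, (A θ (w i).1 - 4 * A θ (w i).2)) :
    ∑ σ : Fin n → Bool, E.indicator (1 : (Fin n → V × V) → ℝ) (swapAt σ w) ≤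
      2 ^ n * (M * Real.exp (-(1 / (6 * b) * (n * (a - 4 * η))))) := by
  set l := 1 / (6 * b) with hl
  have hl0 : 0 ≤ l := by positivity
  have hpt : ∀ σ : Fin n → Bool, E.indicator (1 : (Fin n → V × V) → ℝ) (swapAt σ w) ≤
      ∑ θ ∈ T, Real.exp (-(l * (n * (a - 4 * η)))) *
        ∏ i, Real.exp (l * (A θ (swapAt σ w i).1 - 4 * A θ (swapAt σ w i).2)) := by
    intro σ
    by_cases hσ : swapAt σ w ∈ E
    · rw [Set.indicator_of_mem hσ, Pi.one_apply]
      obtain ⟨θ, hθ⟩ := hE _ hσ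
      obtain ⟨θ', hθ'T, hθ'⟩ := hnet θ
      refine le_trans ?_ (Finset.single_le_sum (f := fun θ => Real.exp (-(l * (n * (a - 4 * η)))) *
        ∏ i, Real.exp (l * (A θ (swapAt σ w i).1 - 4 * A θ (swapAt σ w i).2)))
        (fun _ _ => by positivity) hθ'T)
      rw [← Real.exp_sum, ← Real.exp_add, Real.one_le_exp_iff, ← Finset.mul_sum]
      have h1 : ∑ i, (A θ (swapAt σ w i).1 - 4 * A θ (swapAt σ w i).2) ≤
          ∑ i, (A θ' (swapAt σ w i).1 - 4 * A θ' (swapAt σ w i).2) + 4 * (n * η) := by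
        refine le_trans ?_ (add_le_add_right (mul_le_mul_of_nonneg_left hθ' (by norm_num)) _)
        rw [Finset.mul_sum, ← Finset.sum_add_distrib]
        refine Finset.sum_le_sum fun i _ => ?_
        have h2 := abs_le.mp (le_refl |A θ (w i).1 - A θ' (w i).1|)
        have h3 := abs_le.mp (le_refl |A θ (w i).2 - A θ' (w i).2|)
        have h4 := abs_nonneg (A θ (w i).1 - A θ' (w i).1)
        have h5 := abs_nonneg (A θ (w i).2 - A θ' (w i).2)
        unfold swapAt
        cases σ i
        · simp only [Bool.false_eq_true, if_false]; linarith
        · simp only [if_true, Prod.fst_swap, Prod.snd_swap]; linarith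
      nlinarith
    · rw [Set.indicator_of_notMem hσ]
      exact Finset.sum_nonneg fun _ _ => by positivity
  refine (Finset.sum_le_sum fun σ _ => hpt σ).trans ?_
  rw [Finset.sum_comm]
  have hθ : ∀ θ ∈ T, ∑ σ : Fin n → Bool, Real.exp (-(l * (n * (a - 4 * η)))) *
      ∏ i, Real.exp (l * (A θ (swapAt σ w i).1 - 4 * A θ (swapAt σ w i).2)) ≤
      Real.exp (-(l * (n * (a - 4 * η)))) * 2 ^ n := by
    intro θ _
    rw [← Finset.mul_sum]
    refine mul_le_mul_of_nonneg_left ?_ (Real.exp_pos _).le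
    have hprod := Finset.prod_univ_sum (fun _ : Fin n => (Finset.univ : Finset Bool))
      (fun i s => Real.exp (l * (A θ (if s then (w i).swap else w i).1 -
        4 * A θ (if s then (w i).swap else w i).2)))
    rw [Fintype.piFinset_univ] at hprod
    refine (le_of_eq hprod.symm).trans ?_
    refine (Finset.prod_le_prod (fun i _ => Finset.sum_nonneg fun _ _ => (Real.exp_pos _).le)
      (g := fun _ => 2) fun i _ => ?_).trans (by simp)
    rw [Fintype.sum_bool]
    simp only [if_true, Prod.fst_swap, Prod.snd_swap, Bool.false_eq_true, if_false]
    rw [add_comm]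
    exact exp_swap_le hb (hA0 _ _) (hAb _ _) (hA0 _ _) (hAb _ _)
  refine (Finset.sum_le_card_nsmul _ _ _ hθ).trans ?_
  rw [nsmul_eq_mul]
  have : (T.card : ℝ) ≤ M := by exact_mod_cast hT
  calc (T.card : ℝ) * (Real.exp (-(l * (n * (a - 4 * η)))) * 2 ^ n)
      ≤ M * (Real.exp (-(l * (n * (a - 4 * η)))) * 2 ^ n) := by gcongr
    _ = _ := by ring

variable [MeasurableSpace V]

lemma measurePreserving_swapAt {n : ℕ} (ν : Measure V) [IsProbabilityMeasure ν]
    (σ : Fin n → Bool) :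
    MeasurePreserving (swapAt σ) (Measure.pi fun _ : Fin n => ν.prod ν)
      (Measure.pi fun _ : Fin n => ν.prod ν) := by
  have h := measurePreserving_pi (fun _ : Fin n => ν.prod ν) (fun _ : Fin n => ν.prod ν)
    (f := fun i (x : V × V) => if σ i then x.swap else x) (fun i => by
      cases σ i
      · simp only [Bool.false_eq_true, if_false]; exact MeasurePreserving.id (ν.prod ν)
      · simpa using Measure.measurePreserving_swap)
  exact h

/-- The sum over an independent sample is at most twice its mean with probability at least
one half. -/
lemma half_le_measure_sum_le {n : ℕ} (ν : Measure V) [IsProbabilityMeasure ν] {b : ℝ}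
    (f : V → ℝ) (hf : Measurable f) (hf0 : ∀ v, 0 ≤ f v) (hfb : ∀ v, f v ≤ b) :
    (2 : ENNReal)⁻¹ ≤ (Measure.pi fun _ : Fin n => ν)
      {v | ∑ i, f (v i) ≤ n * (2 * ∫ x, f x ∂ν)} := by
  set P := Measure.pi fun _ : Fin n => ν with hP
  have hint : Integrable f ν := Integrable.of_bound hf.aestronglyMeasurable b
    (ae_of_all _ fun v => by rw [Real.norm_of_nonneg (hf0 v)]; exact hfb v)
  have hi : ∀ i : Fin n, Integrable (fun v : Fin n → V => f (v i)) P := fun i =>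
    (measurePreserving_eval (fun _ : Fin n => ν) i).integrable_comp_of_integrable hint
  have hmean : ∫ v, ∑ i, f (v i) ∂P = n * ∫ x, f x ∂ν := by
    rw [integral_finsetSum _ fun i _ => hi i]
    have : ∀ i : Fin n, ∫ v, f (v i) ∂P = ∫ x, f x ∂ν := fun i => by
      have h := measurePreserving_eval (fun _ : Fin n => ν) i
      calc ∫ v, f (v i) ∂P = ∫ x, f x ∂(P.map (Function.eval i)) :=
            (integral_map h.measurable.aemeasurable hf.aestronglyMeasurable).symm
        _ = ∫ x, f x ∂ν := by rw [h.map_eq]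
    simp [this]
  have hmeas : Measurable fun v : Fin n → V => ∑ i, f (v i) := by fun_prop
  have hset : MeasurableSet {v : Fin n → V | ∑ i, f (v i) ≤ n * (2 * ∫ x, f x ∂ν)} :=
    measurableSet_le hmeas measurable_const
  set m := n * ∫ x, f x ∂ν with hm
  have hm0 : 0 ≤ m := mul_nonneg (Nat.cast_nonneg n) (integral_nonneg hf0)
  have hcompl : P.real {v : Fin n → V | ∑ i, f (v i) ≤ n * (2 * ∫ x, f x ∂ν)}ᶜ ≤ 1 / 2 := by
    have hsub : {v : Fin n → V | ∑ i, f (v i) ≤ n * (2 * ∫ x, f x ∂ν)}ᶜ =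
        {v : Fin n → V | 2 * m < ∑ i, f (v i)} := by
      ext v
      simp only [Set.mem_compl_iff, Set.mem_ofPred_eq, not_le, hm]
      rw [show (n : ℝ) * (2 * ∫ x, f x ∂ν) = 2 * (n * ∫ x, f x ∂ν) by ring]
    rw [hsub]
    have hS0 : 0 ≤ᵐ[P] fun v : Fin n → V => ∑ i, f (v i) :=
      ae_of_all _ fun v => Finset.sum_nonneg fun i _ => hf0 _
    have hSi : Integrable (fun v : Fin n → V => ∑ i, f (v i)) P :=
      integrable_finsetSum _ fun i _ => hi i
    rcases hm0.eq_or_lt with h0 | hpos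
    · have hz : (fun v : Fin n → V => ∑ i, f (v i)) =ᵐ[P] 0 :=
        (integral_eq_zero_iff_of_nonneg_ae hS0 hSi).mp (hmean.trans h0.symm)
      have : P {v : Fin n → V | 2 * m < ∑ i, f (v i)} = 0 := by
        rw [← h0, mul_zero]
        refine measure_mono_null (fun v hv => ?_) (ae_iff.mp hz)
        exact (show (0 : ℝ) < ∑ i, f (v i) from hv).ne'
      simp [Measure.real, this]
    · have hmk := mul_meas_ge_le_integral_of_nonneg hS0 hSi (2 * m)
      rw [hmean] at hmk
      have hle : P.real {v : Fin n → V | 2 * m < ∑ i, f (v i)} ≤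
          P.real {v : Fin n → V | 2 * m ≤ ∑ i, f (v i)} :=
        measureReal_mono fun v (hv : 2 * m < _) => hv.le
      nlinarith
  rw [probReal_compl_eq_one_sub hset] at hcompl
  have : (1 / 2 : ℝ) ≤ P.real {v : Fin n → V | ∑ i, f (v i) ≤ n * (2 * ∫ x, f x ∂ν)} := by
    linarith
  rw [← ofReal_measureReal (measure_ne_top P _),
    show (2 : ENNReal)⁻¹ = ENNReal.ofReal (1 / 2) by
      rw [one_div, ENNReal.ofReal_inv_of_pos two_pos, ENNReal.ofReal_ofNat]]
  exact ENNReal.ofReal_le_ofReal this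

/-- Uniform multiplicative deviation inequality. Every function of the class has empirical mean at
most `8` times its mean plus `a`, up to an event of exponentially small probability. The proof
compares with an independent second sample, whose sums are controlled by Markov's inequality, and
then conditions on the union of both samples: only finitely many functions matter, and for each of
them the coordinate exchanges act like independent signs. -/
theorem measure_exists_sum_gt_le [TopologicalSpace Θ] [TopologicalSpace.SeparableSpace Θ]
    [FirstCountableTopology Θ] {n M : ℕ} (ν : Measure V) [IsProbabilityMeasure ν] {b a η : ℝ}
    (hb : 0 < b) (A : Θ → V → ℝ) (hAm : ∀ θ, Measurable (A θ)) (hA0 : ∀ θ v, 0 ≤ A θ v)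
    (hAb : ∀ θ v, A θ v ≤ b) (hAc : ∀ v, Continuous fun θ => A θ v)
    (hnet : ∀ w : Fin n → V × V, ∃ T : Finset Θ, T.card ≤ M ∧ ∀ θ, ∃ θ' ∈ T,
      ∑ i, (|A θ (w i).1 - A θ' (w i).1| + |A θ (w i).2 - A θ' (w i).2|) ≤ n * η) :
    (Measure.pi fun _ : Fin n => ν)
      {v | ∃ θ, n * (8 * ∫ x, A θ x ∂ν + a) < ∑ i, A θ (v i)} ≤
      ENNReal.ofReal (2 * (M * Real.exp (-(1 / (6 * b) * (n * (a - 4 * η)))))) := by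
  obtain ⟨D, hDc, hDd⟩ := TopologicalSpace.exists_countable_dense Θ
  set P := Measure.pi fun _ : Fin n => ν with hP
  set E₁ : Set (Fin n → V) :=
    ⋃ θ ∈ D, {v | n * (8 * ∫ x, A θ x ∂ν + a) < ∑ i, A θ (v i)} with hE₁
  have hsum : ∀ θ, Measurable fun v : Fin n → V => ∑ i, A θ (v i) := fun θ =>
    Finset.measurable_fun_sum _ fun i _ => (hAm θ).comp (measurable_pi_apply i)
  have hE₁m : MeasurableSet E₁ := MeasurableSet.biUnion hDc fun θ _ =>
    measurableSet_lt measurable_const (hsum θ)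
  have hsub : {v | ∃ θ, n * (8 * ∫ x, A θ x ∂ν + a) < ∑ i, A θ (v i)} ⊆ E₁ := by
    rintro v ⟨θ, hθ⟩
    have hci : Continuous fun θ => ∫ x, A θ x ∂ν :=
      continuous_of_dominated (bound := fun _ => b) (fun θ => (hAm θ).aestronglyMeasurable)
        (fun θ => ae_of_all _ fun x => by rw [Real.norm_of_nonneg (hA0 θ x)]; exact hAb θ x)
        (integrable_const b) (ae_of_all _ hAc)
    have hop : IsOpen {θ | n * (8 * ∫ x, A θ x ∂ν + a) < ∑ i, A θ (v i)} :=
      isOpen_lt (by fun_prop) (continuous_finsetSum _ fun i _ => hAc (v i))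
    obtain ⟨θ', hθ', hD⟩ := hDd.exists_mem_open hop ⟨θ, hθ⟩
    exact Set.mem_biUnion hθ' hD
  refine (measure_mono hsub).trans ?_
  -- comparison with an independent second sample
  set F : Set ((Fin n → V) × (Fin n → V)) :=
    ⋃ θ ∈ D, {x | n * a < ∑ i, (A θ (x.1 i) - 4 * A θ (x.2 i))} with hF
  have hFm : MeasurableSet F := MeasurableSet.biUnion hDc fun θ _ => by
    refine measurableSet_lt measurable_const ?_
    refine Finset.measurable_fun_sum _ fun i _ => ?_
    exact ((hAm θ).comp ((measurable_pi_apply i).comp measurable_fst)).sub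
      (((hAm θ).comp ((measurable_pi_apply i).comp measurable_snd)).const_mul 4)
  have hghost : P E₁ * 2⁻¹ ≤ (P.prod P) F := by
    rw [Measure.prod_apply hFm, mul_comm, ← setLIntegral_const]
    refine (setLIntegral_mono' hE₁m fun v hv => ?_).trans (setLIntegral_le_lintegral E₁ _)
    obtain ⟨θ, hθD, hθ⟩ := Set.mem_iUnion₂.mp hv
    refine (half_le_measure_sum_le ν (A θ) (hAm θ) (hA0 θ) (hAb θ)).trans
      (measure_mono fun v' hv' => ?_)
    refine Set.mem_biUnion hθD ?_
    simp only [Set.mem_ofPred_eq] at hθ hv' ⊢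
    rw [Finset.sum_sub_distrib, ← Finset.mul_sum]
    linarith
  -- symmetrization by coordinate exchanges
  set ρ := Measure.pi fun _ : Fin n => ν.prod ν with hρ
  set G : Set (Fin n → V × V) :=
    MeasurableEquiv.arrowProdEquivProdArrow V V (Fin n) ⁻¹' F with hG
  have hGm : MeasurableSet G := (MeasurableEquiv.measurable _) hFm
  have hFG : (P.prod P) F = ρ G := by
    have h := measurePreserving_arrowProdEquivProdArrow V V (Fin n) (fun _ => ν) (fun _ => ν)
    exact (h.measure_preimage hFm.nullMeasurableSet).symm
  have hGmem : ∀ w ∈ G, ∃ θ, n * a < ∑ i, (A θ (w i).1 - 4 * A θ (w i).2) := by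
    intro w hw
    obtain ⟨θ, _, hθ⟩ := Set.mem_iUnion₂.mp hw
    exact ⟨θ, hθ⟩
  set B := M * Real.exp (-(1 / (6 * b) * (n * (a - 4 * η)))) with hB
  have hswap : (2 : ENNReal) ^ n * ρ G ≤ 2 ^ n * ENNReal.ofReal B := by
    have hind : ∀ σ : Fin n → Bool,
        ρ G = ∫⁻ w, ENNReal.ofReal (G.indicator (1 : (Fin n → V × V) → ℝ) (swapAt σ w)) ∂ρ := by
      intro σ
      have hσ := measurePreserving_swapAt (n := n) ν σ
      rw [← hσ.measure_preimage hGm.nullMeasurableSet,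
        ← lintegral_indicator_one (hσ.measurable hGm)]
      refine lintegral_congr fun w => ?_
      by_cases hw : swapAt σ w ∈ G
      · rw [Set.indicator_of_mem hw, Set.indicator_of_mem (show w ∈ swapAt σ ⁻¹' G from hw)]
        simp
      · rw [Set.indicator_of_notMem hw,
          Set.indicator_of_notMem (show w ∉ swapAt σ ⁻¹' G from hw)]
        simp
    have hcard : (2 : ENNReal) ^ n * ρ G = ∑ _σ : Fin n → Bool, ρ G := by simp
    rw [hcard, Finset.sum_congr rfl fun σ _ => hind σ, ← lintegral_finsetSum' _ fun σ _ => ?_]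
    · have hpt : ∀ w, ∑ σ : Fin n → Bool,
          ENNReal.ofReal (G.indicator (1 : (Fin n → V × V) → ℝ) (swapAt σ w)) ≤
          2 ^ n * ENNReal.ofReal B := by
        intro w
        obtain ⟨T, hT, hTnet⟩ := hnet w
        have h01 : ∀ w, 0 ≤ G.indicator (1 : (Fin n → V × V) → ℝ) w :=
          fun w => Set.indicator_nonneg (fun _ _ => zero_le_one) w
        rw [← ENNReal.ofReal_sum_of_nonneg fun σ _ => h01 (swapAt σ w)]
        refine (ENNReal.ofReal_le_ofReal
          (sum_indicator_swapAt_le hb A hA0 hAb w T hT hTnet G hGmem)).trans (le_of_eq ?_)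
        rw [ENNReal.ofReal_mul (by positivity), ENNReal.ofReal_pow (by norm_num),
          ENNReal.ofReal_ofNat]
      refine (lintegral_mono hpt).trans ?_
      simp
    · have hGi : Measurable (G.indicator (1 : (Fin n → V × V) → ℝ)) :=
        measurable_one.indicator hGm
      exact (ENNReal.measurable_ofReal.comp (hGi.comp
        (measurePreserving_swapAt (n := n) ν σ).measurable)).aemeasurable
  have hρG : ρ G ≤ ENNReal.ofReal B :=
    (ENNReal.mul_le_mul_iff_right (by simp) (by simp)).mp hswap
  calc P E₁ = 2 * (P E₁ * 2⁻¹) := by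
        rw [mul_comm, mul_assoc, ENNReal.inv_mul_cancel (by simp) (by simp), mul_one]
    _ ≤ 2 * ENNReal.ofReal B := by gcongr; exact hghost.trans (hFG.le.trans hρG)
    _ = ENNReal.ofReal (2 * B) := by
        rw [ENNReal.ofReal_mul (p := 2) (by norm_num), ENNReal.ofReal_ofNat]

end Symmetrization

/-! ### Bounded differences -/

section BoundedDifferences

variable {E : Type*} [MeasurableSpace E]

/-- The average of a function on a probability space deviates from its values by at most the
oscillation. -/
lemma abs_sub_integral_le (μ : Measure E) [IsProbabilityMeasure μ] {f : E → ℝ} {δ : ℝ}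
    (hint : Integrable f μ) (hδ : ∀ x y, |f x - f y| ≤ δ) (x : E) : |f x - ∫ y, f y ∂μ| ≤ δ := by
  have h : f x - ∫ y, f y ∂μ = ∫ y, (f x - f y) ∂μ := by
    rw [integral_sub (integrable_const _) hint]; simp
  rw [h]
  refine (abs_integral_le_integral_abs).trans ?_
  have := integral_mono ((integrable_const (f x)).sub hint).abs (integrable_const δ)
    (fun y => hδ x y)
  simpa using this

lemma integrable_of_measurable_bounded {μ : Measure E} [IsFiniteMeasure μ] {f : E → ℝ}
    (hf : Measurable f) {K : ℝ} (hK : ∀ x, |f x| ≤ K) : Integrable f μ :=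
  Integrable.of_bound hf.aestronglyMeasurable K (ae_of_all _ hK)

lemma variance_le_of_bounded_differences_fin (μ : Measure E) [IsProbabilityMeasure μ] {δ K : ℝ}
    (hδ : 0 ≤ δ) : ∀ (n : ℕ) (f : (Fin n → E) → ℝ), Measurable f → (∀ u, |f u| ≤ K) →
    (∀ u j x, |f (Function.update u j x) - f u| ≤ δ) →
    ∫ u, (f u - ∫ w, f w ∂(Measure.pi fun _ => μ)) ^ 2 ∂(Measure.pi fun _ : Fin n => μ) ≤
      n * δ ^ 2
  | 0, f, _, _, _ => by
    have : ∀ u, f u = f isEmptyElim := fun u => congrArg f (Subsingleton.elim _ _)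
    simp [this]
  | n + 1, f, hf, hK, hd => by
    set P := Measure.pi fun _ : Fin n => μ with hP
    set e := MeasurableEquiv.piFinSuccAbove (fun _ : Fin (n + 1) => E) 0 with he
    have hmp : MeasurePreserving e (Measure.pi fun _ : Fin (n + 1) => μ) (μ.prod P) :=
      measurePreserving_piFinSuccAbove (fun _ : Fin (n + 1) => μ) 0
    set g : E × (Fin n → E) → ℝ := fun x => f (Fin.cons x.1 x.2) with hg
    have hge : ∀ u, g (e u) = f u := fun u => by
      simp only [hg, he, MeasurableEquiv.piFinSuccAbove_apply, Fin.insertNthEquiv_zero,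
        Fin.consEquiv_symm_apply, Fin.cons_self_tail]
    have hgm : Measurable g := by
      have : g = f ∘ e.symm := by
        funext x
        rw [Function.comp_apply, ← hge, MeasurableEquiv.apply_symm_apply]
      rw [this]; exact hf.comp e.symm.measurable
    have hgK : ∀ x, |g x| ≤ K := fun x => hK _
    have hK0 : 0 ≤ K := by
      by_contra hneg
      have hem : IsEmpty (Fin (n + 1) → E) :=
        ⟨fun u => by linarith [abs_nonneg (f u), hK u]⟩
      have := IsProbabilityMeasure.measure_univ (μ := Measure.pi fun _ : Fin (n + 1) => μ)
      rw [Set.univ_eq_empty_iff.mpr hem, measure_empty] at this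
      exact zero_ne_one this
    have hsec : ∀ v, Measurable fun x => g (x, v) := fun v =>
      hgm.comp (measurable_id.prodMk measurable_const)
    set F : (Fin n → E) → ℝ := fun v => ∫ x, g (x, v) ∂μ with hF
    have hFm : Measurable F :=
      (hgm.stronglyMeasurable.integral_prod_left' (μ := μ)).measurable
    have hFK : ∀ v, |F v| ≤ K := fun v => by
      have := norm_integral_le_of_norm_le_const (μ := μ) (f := fun x => g (x, v))
        (ae_of_all _ fun x => hgK _)
      simpa using this
    have hgi : ∀ v, Integrable (fun x => g (x, v)) μ := fun v =>
      integrable_of_measurable_bounded (hsec v) fun x => hgK _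
    have hmean : ∫ u, f u ∂(Measure.pi fun _ : Fin (n + 1) => μ) = ∫ v, F v ∂P := by
      rw [← integral_prod_symm _ (integrable_of_measurable_bounded hgm hgK),
        ← hmp.integral_comp' g]
      exact integral_congr_ae (ae_of_all _ fun u => (hge u).symm)
    set m := ∫ v, F v ∂P with hm
    have hmK : |m| ≤ K := by
      have := norm_integral_le_of_norm_le_const (μ := P) (f := F) (ae_of_all _ hFK)
      simpa using this
    have ih := variance_le_of_bounded_differences_fin μ hδ n F hFm hFK (fun u j x => by
      have h : F (Function.update u j x) - F u =
          ∫ y, (g (y, Function.update u j x) - g (y, u)) ∂μ := (integral_sub (hgi _) (hgi _)).symm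
      rw [h]
      refine abs_integral_le_integral_abs.trans ?_
      have := integral_mono (μ := μ) ((hgi (Function.update u j x)).sub (hgi u)).abs
        (integrable_const δ) (fun y => by
          have := hd (Fin.cons y u) j.succ x
          rwa [← Fin.cons_update] at this)
      simpa using this)
    have hosc : ∀ v x, |g (x, v) - F v| ≤ δ := fun v x => by
      refine abs_sub_integral_le μ (hgi v) (fun x y => ?_) x
      have := hd (Fin.cons y v) 0 x
      rwa [Fin.update_cons_zero] at this
    have hsq : Measurable fun x => (g x - m) ^ 2 := (hgm.sub_const m).pow_const 2
    have hsqK : ∀ x, |(g x - m) ^ 2| ≤ (2 * K) ^ 2 := fun x => by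
      rw [abs_pow]
      exact pow_le_pow_left₀ (abs_nonneg _)
        ((abs_sub _ _).trans (by linarith [hgK x])) 2
    have hinner : ∀ v, ∫ x, (g (x, v) - m) ^ 2 ∂μ ≤ δ ^ 2 + (F v - m) ^ 2 := by
      intro v
      have hexp : ∀ x, (g (x, v) - m) ^ 2 =
          (g (x, v) - F v) ^ 2 + (2 * (F v - m) * (g (x, v) - F v) + (F v - m) ^ 2) :=
        fun x => by ring
      have hi1 : Integrable (fun x => g (x, v) - F v) μ := (hgi v).sub (integrable_const _)
      have hi2 : Integrable (fun x => (g (x, v) - F v) ^ 2) μ :=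
        integrable_of_measurable_bounded (((hsec v).sub_const _).pow_const 2) (K := δ ^ 2)
          fun x => by rw [abs_pow]; exact pow_le_pow_left₀ (abs_nonneg _) (hosc v x) 2
      have hi3 : Integrable
          (fun x => 2 * (F v - m) * (g (x, v) - F v) + (F v - m) ^ 2) μ :=
        (hi1.const_mul _).add (integrable_const _)
      have hz : ∫ x, (g (x, v) - F v) ∂μ = 0 := by
        rw [integral_sub (hgi v) (integrable_const _)]; simp [hF]
      have hle : ∫ x, (g (x, v) - F v) ^ 2 ∂μ ≤ δ ^ 2 := by
        have := integral_mono (μ := μ) hi2 (integrable_const (δ ^ 2)) fun x => by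
          have := pow_le_pow_left₀ (abs_nonneg _) (hosc v x) 2
          rwa [sq_abs] at this
        simpa using this
      rw [integral_congr_ae (ae_of_all _ hexp),
        integral_add hi2 hi3,
        integral_add (hi1.const_mul _) (integrable_const _), integral_const_mul, hz]
      simpa using hle
    have hFmi : Integrable (fun v => (F v - m) ^ 2) P :=
      integrable_of_measurable_bounded ((hFm.sub_const m).pow_const 2) (K := (2 * K) ^ 2)
        fun v => by
          rw [abs_pow]
          exact pow_le_pow_left₀ (abs_nonneg _) ((abs_sub _ _).trans (by linarith [hFK v])) 2
    have hprod : ∫ u, (f u - m) ^ 2 ∂(Measure.pi fun _ : Fin (n + 1) => μ) =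
        ∫ v, ∫ x, (g (x, v) - m) ^ 2 ∂μ ∂P := by
      rw [← integral_prod_symm _ (integrable_of_measurable_bounded hsq hsqK),
        ← hmp.integral_comp' fun x => (g x - m) ^ 2]
      exact integral_congr_ae (ae_of_all _ fun u => by simp only [hge])
    rw [hmean, hprod]
    have hout : Integrable (fun v => ∫ x, (g (x, v) - m) ^ 2 ∂μ) P :=
      (integrable_of_measurable_bounded (μ := μ.prod P) hsq hsqK).integral_prod_right
    refine (integral_mono hout ((integrable_const _).add hFmi) hinner).trans ?_
    rw [integral_add' (integrable_const _) hFmi]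
    push_cast
    simp only [integral_const, probReal_univ, one_smul]
    linarith

/-- A function of independent variables that changes by at most `δ` when one of them changes has
variance at most `δ²` times the number of variables. -/
theorem variance_le_of_bounded_differences {ι : Type*} [Fintype ι] [DecidableEq ι]
    (μ : Measure E) [IsProbabilityMeasure μ] {δ K : ℝ} (hδ : 0 ≤ δ) (f : (ι → E) → ℝ)
    (hf : Measurable f) (hK : ∀ u, |f u| ≤ K)
    (hd : ∀ u j x, |f (Function.update u j x) - f u| ≤ δ) :
    ∫ u, (f u - ∫ w, f w ∂(Measure.pi fun _ => μ)) ^ 2 ∂(Measure.pi fun _ : ι => μ) ≤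
      Fintype.card ι * δ ^ 2 := by
  set e := MeasurableEquiv.piCongrLeft (fun _ : ι => E) (Fintype.equivFin ι).symm with he
  have hmp : MeasurePreserving e (Measure.pi fun _ => μ) (Measure.pi fun _ : ι => μ) :=
    measurePreserving_piCongrLeft (fun _ : ι => μ) (Fintype.equivFin ι).symm
  have hea : ∀ u i, e u i = u (Fintype.equivFin ι i) := by
    intro u i
    have := MeasurableEquiv.piCongrLeft_apply_apply (β := fun _ : ι => E) (Fintype.equivFin ι).symm u
      (Fintype.equivFin ι i)
    rwa [Equiv.symm_apply_apply] at this
  have h := variance_le_of_bounded_differences_fin μ hδ (Fintype.card ι) (fun u => f (e u))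
    (hf.comp e.measurable) (fun u => hK _) (fun u j x => by
      have : e (Function.update u j x) =
          Function.update (e u) ((Fintype.equivFin ι).symm j) x := by
        funext i
        rw [hea]
        by_cases hi : i = (Fintype.equivFin ι).symm j
        · subst hi; simp
        · rw [Function.update_of_ne hi, Function.update_of_ne, hea]
          rintro rfl; simp at hi
      rw [this]
      exact hd _ _ _)
  rw [hmp.integral_comp' f] at h
  rwa [hmp.integral_comp' fun u => (f u - ∫ w, f w ∂(Measure.pi fun _ => μ)) ^ 2] at h

/-- The contribution of one data point to the empirical energy loss, as a function of the response
`y` and of the array `a` of generated values. -/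
noncomputable def energyLoss {m₁ m₂ : ℕ} (y : ℝ) (a : Fin m₁ × Fin m₂ → ℝ) : ℝ :=
  1 / (m₁ : ℝ) * ∑ b, (2 / (m₂ : ℝ) * ∑ k, |y - a (b, k)| -
    1 / ((m₂ : ℝ) * ((m₂ : ℝ) - 1)) * ∑ k, ∑ k' ∈ Finset.univ.erase k, |a (b, k) - a (b, k')|)

lemma sum_sum_erase_add {m : ℕ} (d : Fin m → ℝ) :
    ∑ k, ∑ k' ∈ Finset.univ.erase k, (d k + d k') = 2 * ((m : ℝ) - 1) * ∑ k, d k := by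
  have h : ∀ k : Fin m, ∑ k' ∈ Finset.univ.erase k, (d k + d k') =
      (m : ℝ) * d k + ∑ k', d k' - 2 * d k := by
    intro k
    have h : d k + d k + ∑ k' ∈ Finset.univ.erase k, (d k + d k') = ∑ k', (d k + d k') :=
      Finset.add_sum_erase Finset.univ (fun k' => d k + d k') (Finset.mem_univ k)
    have h' : ∑ k', (d k + d k') = m * d k + ∑ k', d k' := by
      simp [Finset.sum_add_distrib]
    linarith
  simp_rw [h]
  rw [Finset.sum_sub_distrib, Finset.sum_add_distrib, ← Finset.mul_sum, ← Finset.mul_sum]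
  simp
  ring

lemma abs_energyLoss_sub_le {m₁ m₂ : ℕ} (hm₁ : 1 ≤ m₁) (hm₂ : 2 ≤ m₂) (y : ℝ)
    (a a' : Fin m₁ × Fin m₂ → ℝ) :
    |energyLoss y a - energyLoss y a'| ≤ 4 / (m₁ * m₂) * ∑ x, |a x - a' x| := by
  have h1 : (0 : ℝ) < m₁ := by exact_mod_cast hm₁
  have h2 : (2 : ℝ) ≤ m₂ := by exact_mod_cast hm₂
  set c := 1 / ((m₂ : ℝ) * ((m₂ : ℝ) - 1)) with hc
  have hc0 : 0 ≤ c := by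
    rw [hc]; exact div_nonneg zero_le_one (mul_nonneg (by linarith) (by linarith))
  have hb : ∀ b, |(2 / (m₂ : ℝ) * ∑ k, |y - a (b, k)| -
      c * ∑ k, ∑ k' ∈ Finset.univ.erase k, |a (b, k) - a (b, k')|) -
      (2 / (m₂ : ℝ) * ∑ k, |y - a' (b, k)| -
      c * ∑ k, ∑ k' ∈ Finset.univ.erase k, |a' (b, k) - a' (b, k')|)| ≤
      4 / m₂ * ∑ k, |a (b, k) - a' (b, k)| := by
    intro b
    have e1 : |(∑ k, |y - a (b, k)|) - (∑ k, |y - a' (b, k)|)| ≤ ∑ k, |a (b, k) - a' (b, k)| := by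
      rw [← Finset.sum_sub_distrib]
      refine (Finset.abs_sum_le_sum_abs _ _).trans (Finset.sum_le_sum fun k _ => ?_)
      refine (abs_abs_sub_abs_le _ _).trans (le_of_eq ?_)
      rw [abs_sub_comm]; ring_nf
    have e2 : |(∑ k, ∑ k' ∈ Finset.univ.erase k, |a (b, k) - a (b, k')|) -
        (∑ k, ∑ k' ∈ Finset.univ.erase k, |a' (b, k) - a' (b, k')|)| ≤
        2 * ((m₂ : ℝ) - 1) * ∑ k, |a (b, k) - a' (b, k)| := by
      rw [← sum_sum_erase_add fun k => |a (b, k) - a' (b, k)|, ← Finset.sum_sub_distrib]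
      refine (Finset.abs_sum_le_sum_abs _ _).trans (Finset.sum_le_sum fun k _ => ?_)
      rw [← Finset.sum_sub_distrib]
      refine (Finset.abs_sum_le_sum_abs _ _).trans (Finset.sum_le_sum fun k' _ => ?_)
      refine (abs_abs_sub_abs_le _ _).trans ?_
      rw [show a (b, k) - a (b, k') - (a' (b, k) - a' (b, k')) =
        (a (b, k) - a' (b, k)) - (a (b, k') - a' (b, k')) by ring]
      exact abs_sub _ _
    have e3 : c * (2 * ((m₂ : ℝ) - 1) * ∑ k, |a (b, k) - a' (b, k)|) =
        2 / m₂ * ∑ k, |a (b, k) - a' (b, k)| := by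
      have : (m₂ : ℝ) - 1 ≠ 0 := by linarith
      rw [hc]; field_simp
    rw [show ∀ p q r s : ℝ, (p - q) - (r - s) = (p - r) - (q - s) from fun _ _ _ _ => by ring,
      ← mul_sub, ← mul_sub]
    refine (abs_sub _ _).trans ?_
    rw [abs_mul, abs_mul, abs_of_nonneg hc0, abs_of_nonneg (by positivity : 0 ≤ 2 / (m₂ : ℝ))]
    have e4 := mul_le_mul_of_nonneg_left e1 (by positivity : 0 ≤ 2 / (m₂ : ℝ))
    have e5 := mul_le_mul_of_nonneg_left e2 hc0
    rw [e3] at e5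
    calc _ ≤ 2 / (m₂ : ℝ) * ∑ k, |a (b, k) - a' (b, k)| +
          2 / (m₂ : ℝ) * ∑ k, |a (b, k) - a' (b, k)| := add_le_add e4 e5
      _ = _ := by ring
  unfold energyLoss
  rw [← mul_sub, abs_mul, abs_of_nonneg (by positivity : 0 ≤ 1 / (m₁ : ℝ)),
    ← Finset.sum_sub_distrib]
  calc _ ≤ 1 / (m₁ : ℝ) * ∑ b, 4 / m₂ * ∑ k, |a (b, k) - a' (b, k)| := by
        refine mul_le_mul_of_nonneg_left ?_ (by positivity)
        exact (Finset.abs_sum_le_sum_abs _ _).trans (Finset.sum_le_sum fun b _ => hb b)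
    _ = _ := by
        rw [← Finset.mul_sum, Fintype.sum_prod_type]
        field_simp

end BoundedDifferences

/-! ### Energy distance and distribution functions -/

section EnergyDistance

/-- The distribution function of the point mass at `y`. -/
noncomputable def step (y s : ℝ) : ℝ := if y ≤ s then 1 else 0

lemma step_nonneg (y s : ℝ) : 0 ≤ step y s := by unfold step; split_ifs <;> norm_num

lemma step_le_one (y s : ℝ) : step y s ≤ 1 := by unfold step; split_ifs <;> norm_num

lemma step_sq (y s : ℝ) : step y s ^ 2 = step y s := by unfold step; split_ifs <;> norm_num

lemma measurable_step : Measurable fun w : ℝ × ℝ => step w.1 w.2 :=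
  Measurable.ite (measurableSet_le measurable_fst measurable_snd) measurable_const measurable_const

lemma measurable_step_right (y : ℝ) : Measurable (step y) :=
  measurable_step.comp (measurable_const.prodMk measurable_id)

/-- The squared distance of two point masses in `L²` of their distribution functions. -/
lemma abs_sub_eq_integral_step {c a b : ℝ} (ha : |a| ≤ c) (hb : |b| ≤ c) :
    |a - b| = ∫ s in Set.Icc (-c) c, (step a s + step b s - 2 * step a s * step b s) := by
  wlog hab : a ≤ b generalizing a b
  · rw [abs_sub_comm, this hb ha (le_of_not_ge hab)]
    congr 1
    funext s
    ring
  have ha' := abs_le.mp ha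
  have hb' := abs_le.mp hb
  have h : (fun s => step a s + step b s - 2 * step a s * step b s) =
      (Set.Ico a b).indicator 1 := by
    funext s
    unfold step
    by_cases h1 : a ≤ s <;> by_cases h2 : b ≤ s
    · rw [Set.indicator_of_notMem (fun h => absurd h.2 (not_lt.mpr h2))]; norm_num [h1, h2]
    · rw [Set.indicator_of_mem (show s ∈ Set.Ico a b from ⟨h1, not_le.mp h2⟩)]; norm_num [h1, h2]
    · exact absurd (hab.trans h2) h1
    · rw [Set.indicator_of_notMem (fun h => absurd h.1 h1)]; norm_num [h1, h2]
  rw [h, integral_indicator_one measurableSet_Ico, measureReal_restrict_apply measurableSet_Ico,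
    Set.inter_eq_left.mpr (Set.Ico_subset_Icc_self.trans (Set.Icc_subset_Icc ha'.1 hb'.2)),
    measureReal_def,
    Real.volume_Ico, ENNReal.toReal_ofReal (by linarith), abs_sub_comm, abs_of_nonneg (by linarith)]

lemma integral_step_comp {E : Type*} [MeasurableSpace E] (μ : Measure E) {h : E → ℝ}
    (hh : Measurable h) (s : ℝ) : ∫ u, step (h u) s ∂μ = μ.real {u | h u ≤ s} := by
  have hS : MeasurableSet {u | h u ≤ s} := measurableSet_le hh measurable_const
  rw [← integral_indicator_one hS]
  refine integral_congr_ae (ae_of_all _ fun u => ?_)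
  by_cases hu : h u ≤ s
  · simp [step, hu]
  · simp [step, hu]

variable {E : Type*} [MeasurableSpace E] (μ : Measure E) [IsProbabilityMeasure μ] {c : ℝ}

/-- Mean distance of a bounded random variable from a point, in terms of its distribution
function. -/
lemma integral_abs_sub_eq {y : ℝ} (hy : |y| ≤ c) {h : E → ℝ} (hh : Measurable h)
    (hc : ∀ u, |h u| ≤ c) :
    ∫ u, |y - h u| ∂μ = ∫ s in Set.Icc (-c) c,
      (step y s + μ.real {u | h u ≤ s} - 2 * step y s * μ.real {u | h u ≤ s}) := by
  have hm1 : Measurable fun w : E × ℝ => step (h w.1) w.2 :=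
    measurable_step.comp ((hh.comp measurable_fst).prodMk measurable_snd)
  have hm2 : Measurable fun w : E × ℝ => step y w.2 :=
    (measurable_step_right y).comp measurable_snd
  have hint : Integrable (fun w : E × ℝ => step y w.2 + step (h w.1) w.2 -
      2 * step y w.2 * step (h w.1) w.2) (μ.prod (volume.restrict (Set.Icc (-c) c))) := by
    refine integrable_of_measurable_bounded ((hm2.add hm1).sub ((hm2.const_mul 2).mul hm1))
      (K := 2) fun w => ?_
    have := step_nonneg y w.2
    have := step_le_one y w.2
    have := step_nonneg (h w.1) w.2
    have := step_le_one (h w.1) w.2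
    rw [abs_le]; constructor <;> nlinarith
  calc ∫ u, |y - h u| ∂μ = ∫ u, (∫ s in Set.Icc (-c) c,
        (step y s + step (h u) s - 2 * step y s * step (h u) s)) ∂μ :=
        integral_congr_ae (ae_of_all _ fun u => abs_sub_eq_integral_step hy (hc u))
    _ = ∫ s in Set.Icc (-c) c, ∫ u, (step y s + step (h u) s - 2 * step y s * step (h u) s) ∂μ :=
        integral_integral_swap hint
    _ = _ := by
        refine integral_congr_ae (ae_of_all _ fun s => ?_)
        have hi : Integrable (fun u => step (h u) s) μ :=
          integrable_of_measurable_bounded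
            (measurable_step.comp (hh.prodMk measurable_const)) (K := 1) fun u => by
              rw [abs_of_nonneg (step_nonneg _ _)]; exact step_le_one _ _
        have hi2 : Integrable (fun u => step y s + step (h u) s) μ := (integrable_const _).add hi
        dsimp only
        rw [integral_sub hi2 (hi.const_mul _), integral_add (integrable_const _) hi,
          integral_const_mul, integral_step_comp μ hh]
        simp

lemma measurable_measureReal_le {h : E → ℝ} : Measurable fun s : ℝ => μ.real {u | h u ≤ s} := by
  refine (Monotone.measurable fun s t hst => ?_)
  exact measureReal_mono fun u hu => le_trans hu hst

/-- Mean distance of two independent copies of a bounded random variable. -/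
lemma integral_integral_abs_sub_eq {h : E → ℝ} (hh : Measurable h) (hc : ∀ u, |h u| ≤ c) :
    ∫ v, ∫ u, |h v - h u| ∂μ ∂μ = ∫ s in Set.Icc (-c) c,
      (2 * μ.real {u | h u ≤ s} - 2 * μ.real {u | h u ≤ s} ^ 2) := by
  have hm1 : Measurable fun w : E × ℝ => step (h w.1) w.2 :=
    measurable_step.comp ((hh.comp measurable_fst).prodMk measurable_snd)
  have hm2 : Measurable fun w : E × ℝ => μ.real {u | h u ≤ w.2} :=
    (measurable_measureReal_le μ).comp measurable_snd
  have hint : Integrable (fun w : E × ℝ => step (h w.1) w.2 + μ.real {u | h u ≤ w.2} -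
      2 * step (h w.1) w.2 * μ.real {u | h u ≤ w.2})
      (μ.prod (volume.restrict (Set.Icc (-c) c))) := by
    refine integrable_of_measurable_bounded ((hm1.add hm2).sub ((hm1.const_mul 2).mul hm2))
      (K := 2) fun w => ?_
    have := step_nonneg (h w.1) w.2
    have := step_le_one (h w.1) w.2
    have : 0 ≤ μ.real {u | h u ≤ w.2} := measureReal_nonneg
    have : μ.real {u | h u ≤ w.2} ≤ 1 := measureReal_le_one
    rw [abs_le]; constructor <;> nlinarith
  calc ∫ v, ∫ u, |h v - h u| ∂μ ∂μ = ∫ v, (∫ s in Set.Icc (-c) c,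
        (step (h v) s + μ.real {u | h u ≤ s} - 2 * step (h v) s * μ.real {u | h u ≤ s})) ∂μ :=
        integral_congr_ae (ae_of_all _ fun v => integral_abs_sub_eq μ (hc v) hh hc)
    _ = ∫ s in Set.Icc (-c) c, ∫ v,
        (step (h v) s + μ.real {u | h u ≤ s} - 2 * step (h v) s * μ.real {u | h u ≤ s}) ∂μ :=
        integral_integral_swap hint
    _ = _ := by
        refine integral_congr_ae (ae_of_all _ fun s => ?_)
        have hi : Integrable (fun u => step (h u) s) μ :=
          integrable_of_measurable_bounded
            (measurable_step.comp (hh.prodMk measurable_const)) (K := 1) fun u => by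
              rw [abs_of_nonneg (step_nonneg _ _)]; exact step_le_one _ _
        have hi2 : Integrable (fun u => step (h u) s + μ.real {u | h u ≤ s}) μ :=
          hi.add (integrable_const _)
        dsimp only
        rw [integral_sub hi2 ((hi.const_mul 2).mul_const _), integral_add hi (integrable_const _),
          integral_mul_const, integral_const_mul, integral_step_comp μ hh]
        simp
        ring

lemma integral_pi_pair {ι : Type*} [Fintype ι] {i j : ι} (hij : i ≠ j) {f : E × E → ℝ}
    (hf : Measurable f) {K : ℝ} (hK : ∀ x, |f x| ≤ K) :
    ∫ u, f (u i, u j) ∂(Measure.pi fun _ : ι => μ) = ∫ v, ∫ w, f (v, w) ∂μ ∂μ := by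
  have hind : IndepFun (fun u : ι → E => u i) (fun u => u j) (Measure.pi fun _ : ι => μ) :=
    (iIndepFun_pi (μ := fun _ : ι => μ) (X := fun _ x => x) fun _ => aemeasurable_id).indepFun hij
  have hmap := (indepFun_iff_map_prod_eq_prod_map_map (measurable_pi_apply i).aemeasurable
    (measurable_pi_apply j).aemeasurable).mp hind
  have hi : Measure.map (fun u : ι → E => u i) (Measure.pi fun _ : ι => μ) = μ :=
    (measurePreserving_eval (fun _ : ι => μ) i).map_eq
  have hj : Measure.map (fun u : ι → E => u j) (Measure.pi fun _ : ι => μ) = μ :=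
    (measurePreserving_eval (fun _ : ι => μ) j).map_eq
  rw [hi, hj] at hmap
  rw [← integral_prod _ (integrable_of_measurable_bounded hf hK), ← hmap, integral_map
    ((measurable_pi_apply i).prodMk (measurable_pi_apply j)).aemeasurable hf.aestronglyMeasurable]

/-- The continuous ranked probability score on `[-c, c]` of the distribution function `F` at the
observation `y`. -/
noncomputable def crps (c : ℝ) (F : ℝ → ℝ) (y : ℝ) : ℝ :=
  ∫ s in Set.Icc (-c) c, (F s - step y s) ^ 2

/-- Averaging the energy loss over the noise gives twice the ranked probability score. -/
theorem integral_energyLoss {m₁ m₂ : ℕ} (hm₁ : 1 ≤ m₁) (hm₂ : 2 ≤ m₂) {y : ℝ} (hy : |y| ≤ c)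
    {h : E → ℝ} (hh : Measurable h) (hc : ∀ u, |h u| ≤ c) :
    ∫ u, energyLoss y (fun i => h (u i)) ∂(Measure.pi fun _ : Fin m₁ × Fin m₂ => μ) =
      2 * crps c (fun s => μ.real {u | h u ≤ s}) y := by
  set P := Measure.pi fun _ : Fin m₁ × Fin m₂ => μ with hP
  have hm1 : (m₁ : ℝ) ≠ 0 := by positivity
  have hm2 : (2 : ℝ) ≤ m₂ := by exact_mod_cast hm₂
  have hm2' : (m₂ : ℝ) - 1 ≠ 0 := by linarith
  have hyh : Measurable fun u => |y - h u| := (measurable_const.sub hh).abs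
  have hyK : ∀ u, |(|y - h u|)| ≤ 2 * c := fun u => by
    rw [abs_abs]; exact (abs_sub _ _).trans (by linarith [hc u])
  have hhh : Measurable fun x : E × E => |h x.1 - h x.2| :=
    ((hh.comp measurable_fst).sub (hh.comp measurable_snd)).abs
  have hhK : ∀ x : E × E, |(|h x.1 - h x.2|)| ≤ 2 * c := fun x => by
    rw [abs_abs]; exact (abs_sub _ _).trans (by linarith [hc x.1, hc x.2])
  have hi1 : ∀ i, Integrable (fun u : Fin m₁ × Fin m₂ → E => |y - h (u i)|) P := fun i =>
    integrable_of_measurable_bounded (hyh.comp (measurable_pi_apply i)) fun u => hyK _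
  have hi2 : ∀ i j, Integrable (fun u : Fin m₁ × Fin m₂ → E => |h (u i) - h (u j)|) P :=
    fun i j => integrable_of_measurable_bounded
      ((hh.comp (measurable_pi_apply i)).sub (hh.comp (measurable_pi_apply j))).abs
      fun u => hhK (u i, u j)
  have e1 : ∀ i, ∫ u, |y - h (u i)| ∂P = ∫ u, |y - h u| ∂μ := fun i =>
    integral_comp_eval (μ := fun _ : Fin m₁ × Fin m₂ => μ) (i := i) hyh.aestronglyMeasurable
  have e2 : ∀ i j, i ≠ j → ∫ u, |h (u i) - h (u j)| ∂P = ∫ v, ∫ u, |h v - h u| ∂μ ∂μ :=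
    fun i j hij => integral_pi_pair μ hij hhh hhK
  have hI1 : ∀ b : Fin m₁, Integrable (fun u : Fin m₁ × Fin m₂ → E =>
      2 / (m₂ : ℝ) * ∑ k, |y - h (u (b, k))|) P := fun b =>
    (integrable_finsetSum _ fun k _ => hi1 _).const_mul _
  have hI2 : ∀ b : Fin m₁, Integrable (fun u : Fin m₁ × Fin m₂ → E =>
      1 / ((m₂ : ℝ) * ((m₂ : ℝ) - 1)) *
        ∑ k, ∑ k' ∈ Finset.univ.erase k, |h (u (b, k)) - h (u (b, k'))|) P := fun b =>
    (integrable_finsetSum _ fun k _ => integrable_finsetSum _ fun k' _ => hi2 _ _).const_mul _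
  have hb : ∀ b : Fin m₁, ∫ u, (2 / (m₂ : ℝ) * ∑ k, |y - h (u (b, k))| -
      1 / ((m₂ : ℝ) * ((m₂ : ℝ) - 1)) *
        ∑ k, ∑ k' ∈ Finset.univ.erase k, |h (u (b, k)) - h (u (b, k'))|) ∂P =
      2 * ∫ u, |y - h u| ∂μ - ∫ v, ∫ u, |h v - h u| ∂μ ∂μ := by
    intro b
    rw [integral_sub (hI1 b) (hI2 b), integral_const_mul, integral_const_mul,
      integral_finsetSum _ fun k _ => hi1 _,
      integral_finsetSum _ fun k _ => integrable_finsetSum _ fun k' _ => hi2 _ _]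
    have : ∀ k : Fin m₂, ∫ u, ∑ k' ∈ Finset.univ.erase k, |h (u (b, k)) - h (u (b, k'))| ∂P =
        ((m₂ : ℝ) - 1) * ∫ v, ∫ u, |h v - h u| ∂μ ∂μ := by
      intro k
      rw [integral_finsetSum _ fun k' _ => hi2 _ _, Finset.sum_congr rfl fun k' hk' =>
        e2 (b, k) (b, k') (fun heq => (Finset.ne_of_mem_erase hk') (congrArg Prod.snd heq).symm),
        Finset.sum_const, Finset.card_erase_of_mem (Finset.mem_univ k), Finset.card_univ,
        Fintype.card_fin, nsmul_eq_mul, Nat.cast_sub (by omega), Nat.cast_one]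
    simp only [e1, this, Finset.sum_const, Finset.card_univ, Fintype.card_fin, nsmul_eq_mul]
    field_simp
  have hI : ∀ b : Fin m₁, Integrable (fun u : Fin m₁ × Fin m₂ → E =>
      2 / (m₂ : ℝ) * ∑ k, |y - h (u (b, k))| - 1 / ((m₂ : ℝ) * ((m₂ : ℝ) - 1)) *
        ∑ k, ∑ k' ∈ Finset.univ.erase k, |h (u (b, k)) - h (u (b, k'))|) P := fun b =>
    (hI1 b).sub (hI2 b)
  unfold energyLoss
  dsimp only
  rw [integral_const_mul, integral_finsetSum _ fun b _ => hI b,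
    Finset.sum_congr rfl fun b _ => hb b, Finset.sum_const, Finset.card_univ, Fintype.card_fin,
    nsmul_eq_mul, ← mul_assoc, one_div_mul_cancel hm1, one_mul, integral_abs_sub_eq μ hy hh hc,
    integral_integral_abs_sub_eq μ hh hc, crps, ← integral_const_mul, ← integral_const_mul,
    ← integral_sub]
  · refine integral_congr_ae (ae_of_all _ fun s => ?_)
    have := step_sq y s
    dsimp only
    linear_combination (-2) * this
  · refine integrable_of_measurable_bounded (K := 4) ?_ fun s => ?_
    · have h1 := measurable_step_right y
      have h2 := measurable_measureReal_le μ (h := h)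
      exact ((h1.add h2).sub ((h1.const_mul 2).mul h2)).const_mul 2
    · have := step_nonneg y s
      have := step_le_one y s
      have : 0 ≤ μ.real {u | h u ≤ s} := measureReal_nonneg
      have : μ.real {u | h u ≤ s} ≤ 1 := measureReal_le_one
      rw [abs_le]; constructor <;> nlinarith
  · refine integrable_of_measurable_bounded (K := 4) ?_ fun s => ?_
    · have h2 := measurable_measureReal_le μ (h := h)
      exact (h2.const_mul 2).sub ((h2.pow_const 2).const_mul 2)
    · have : 0 ≤ μ.real {u | h u ≤ s} := measureReal_nonneg
      have : μ.real {u | h u ≤ s} ≤ 1 := measureReal_le_one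
      rw [abs_le]; constructor <;> nlinarith

end EnergyDistance

/-! ### The risk as a distance of conditional distribution functions -/

section Risk

/-- Bias-variance decomposition of the mean ranked probability score of `F` when the observation
has law `κ`. -/
lemma integral_crps_eq {c : ℝ} (κ : Measure ℝ) [IsProbabilityMeasure κ] {F : ℝ → ℝ}
    (hF : Measurable F) (hF0 : ∀ s, 0 ≤ F s) (hF1 : ∀ s, F s ≤ 1) :
    ∫ y, crps c F y ∂κ = (∫ s in Set.Icc (-c) c, (F s - κ.real (Set.Iic s)) ^ 2) +
      ∫ s in Set.Icc (-c) c, (κ.real (Set.Iic s) - κ.real (Set.Iic s) ^ 2) := by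
  have hK : Measurable fun s => κ.real (Set.Iic s) := measurable_measureReal_le κ (h := id)
  have hFs : Measurable fun w : ℝ × ℝ => F w.2 := hF.comp measurable_snd
  have hint : Integrable (fun w : ℝ × ℝ => (F w.2 - step w.1 w.2) ^ 2)
      (κ.prod (volume.restrict (Set.Icc (-c) c))) := by
    refine integrable_of_measurable_bounded ((hFs.sub measurable_step).pow_const 2) (K := 1)
      fun w => ?_
    have := step_nonneg w.1 w.2
    have := step_le_one w.1 w.2
    rw [abs_of_nonneg (sq_nonneg _)]
    nlinarith [hF0 w.2, hF1 w.2]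
  have hb : ∀ s, 0 ≤ κ.real (Set.Iic s) ∧ κ.real (Set.Iic s) ≤ 1 := fun s =>
    ⟨measureReal_nonneg, measureReal_le_one⟩
  unfold crps
  rw [integral_integral_swap hint, ← integral_add]
  · refine integral_congr_ae (ae_of_all _ fun s => ?_)
    have hi : Integrable (fun y => step y s) κ :=
      integrable_of_measurable_bounded (measurable_step.comp (measurable_id.prodMk
        measurable_const)) (K := 1) fun u => by
          rw [abs_of_nonneg (step_nonneg _ _)]; exact step_le_one _ _
    have hexp : ∀ y, (F s - step y s) ^ 2 = F s ^ 2 + (1 - 2 * F s) * step y s := fun y => by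
      have := step_sq y s
      linear_combination this
    dsimp only
    rw [integral_congr_ae (ae_of_all _ hexp), integral_add (integrable_const _) (hi.const_mul _),
      integral_const_mul, show ∫ y, step y s ∂κ = κ.real (Set.Iic s) from
        integral_step_comp κ measurable_id s]
    simp only [integral_const, probReal_univ, one_smul]
    ring
  · refine integrable_of_measurable_bounded ((hF.sub hK).pow_const 2) (K := 1) fun s => ?_
    rw [abs_of_nonneg (sq_nonneg _)]
    nlinarith [hF0 s, hF1 s, hb s]
  · refine integrable_of_measurable_bounded (hK.sub (hK.pow_const 2)) (K := 1) fun s => ?_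
    rw [abs_le]
    constructor <;> nlinarith [hb s]

variable {p q : ℕ} (μ₀ : Measure ((Fin p → ℝ) × ℝ)) (μu : Measure (Fin q → ℝ)) {c : ℝ}

lemma trueCDF_nonneg (x : Fin p → ℝ) (s : ℝ) : 0 ≤ trueCDF μ₀ x s := condCDF_nonneg _ _ _

lemma trueCDF_le_one (x : Fin p → ℝ) (s : ℝ) : trueCDF μ₀ x s ≤ 1 := condCDF_le_one _ _ _

variable {μu} in
lemma inducedCDF_nonneg (g : (Fin p → ℝ) → (Fin q → ℝ) → ℝ) (x : Fin p → ℝ) (s : ℝ) :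
    0 ≤ inducedCDF μu g x s := measureReal_nonneg

variable [IsProbabilityMeasure μu]

lemma inducedCDF_le_one (g : (Fin p → ℝ) → (Fin q → ℝ) → ℝ) (x : Fin p → ℝ) (s : ℝ) :
    inducedCDF μu g x s ≤ 1 := measureReal_le_one

variable {g h : (Fin p → ℝ) → (Fin q → ℝ) → ℝ}

lemma measurable_inducedCDF (hg : Measurable (Function.uncurry g)) :
    Measurable fun w : (Fin p → ℝ) × ℝ => inducedCDF μu g w.1 w.2 := by
  have ht : MeasurableSet {x : ((Fin p → ℝ) × ℝ) × (Fin q → ℝ) | g x.1.1 x.2 ≤ x.1.2} :=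
    measurableSet_le (hg.comp ((measurable_fst.comp measurable_fst).prodMk measurable_snd))
      (measurable_snd.comp measurable_fst)
  exact (measurable_measure_prodMk_left (ν := μu) ht).ennreal_toReal

/-- The squared distance of the distribution functions at `x`, restricted to `[-c, c]`. -/
noncomputable def pointDist (c : ℝ) (μ₀ : Measure ((Fin p → ℝ) × ℝ)) (μu : Measure (Fin q → ℝ))
    (g : (Fin p → ℝ) → (Fin q → ℝ) → ℝ) (x : Fin p → ℝ) : ℝ :=
  ∫ s in Set.Icc (-c) c, (inducedCDF μu g x s - trueCDF μ₀ x s) ^ 2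

lemma abs_setIntegral_Icc_le (hc : 0 ≤ c) {f : ℝ → ℝ} (hf : ∀ s, |f s| ≤ 1) :
    |∫ s in Set.Icc (-c) c, f s| ≤ 2 * c := by
  have := norm_integral_le_of_norm_le_const (μ := volume.restrict (Set.Icc (-c) c))
    (f := f) (C := 1) (ae_of_all _ hf)
  rw [measureReal_restrict_apply_univ, Real.volume_real_Icc_of_le (by linarith), one_mul] at this
  rw [Real.norm_eq_abs] at this
  linarith

lemma abs_pointDist_le (hc : 0 ≤ c) (x : Fin p → ℝ) : |pointDist c μ₀ μu g x| ≤ 2 * c := by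
  refine abs_setIntegral_Icc_le hc fun s => ?_
  have := inducedCDF_nonneg (μu := μu) g x s
  have := inducedCDF_le_one μu g x s
  have := trueCDF_nonneg μ₀ x s
  have := trueCDF_le_one μ₀ x s
  rw [abs_of_nonneg (sq_nonneg _)]
  nlinarith

lemma measurable_crps (hg : Measurable (Function.uncurry g)) :
    Measurable fun z : (Fin p → ℝ) × ℝ => crps c (inducedCDF μu g z.1) z.2 := by
  have h : Measurable fun w : ((Fin p → ℝ) × ℝ) × ℝ =>
      (inducedCDF μu g w.1.1 w.2 - step w.1.2 w.2) ^ 2 := by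
    refine Measurable.pow_const (Measurable.sub ?_ ?_) 2
    · exact (measurable_inducedCDF μu hg).comp
        ((measurable_fst.comp measurable_fst).prodMk measurable_snd)
    · exact measurable_step.comp ((measurable_snd.comp measurable_fst).prodMk measurable_snd)
  exact (h.stronglyMeasurable.integral_prod_right'
    (ν := volume.restrict (Set.Icc (-c) c))).measurable

lemma abs_crps_le (hc : 0 ≤ c) (x : Fin p → ℝ) (y : ℝ) :
    |crps c (inducedCDF μu g x) y| ≤ 2 * c := by
  refine abs_setIntegral_Icc_le hc fun s => ?_
  have := inducedCDF_nonneg (μu := μu) g x s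
  have := inducedCDF_le_one μu g x s
  have := step_nonneg y s
  have := step_le_one y s
  rw [abs_of_nonneg (sq_nonneg _)]
  nlinarith

variable [IsProbabilityMeasure μ₀]

/-- The conditional law of the response given the covariate, with distribution functions
`trueCDF μ₀ x`. -/
noncomputable def responseKernel : Kernel (Fin p → ℝ) ℝ :=
  ((isCondKernelCDF_condCDF μ₀).toKernel _).comap (fun x => ((), x)) measurable_prodMk_left

instance : IsMarkovKernel (responseKernel μ₀) := by
  unfold responseKernel
  infer_instance

lemma responseKernel_real_Iic (x : Fin p → ℝ) (s : ℝ) :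
    (responseKernel μ₀ x).real (Set.Iic s) = trueCDF μ₀ x s := by
  rw [responseKernel, measureReal_def, Kernel.comap_apply, IsCondKernelCDF.toKernel_Iic,
    ENNReal.toReal_ofReal (condCDF_nonneg _ _ _)]
  rfl

lemma compProd_responseKernel : μ₀.fst ⊗ₘ responseKernel μ₀ = μ₀ := by
  have h := compProd_toKernel (isCondKernelCDF_condCDF μ₀)
  have h2 : Kernel.prodMkLeft Unit (responseKernel μ₀) =
      (isCondKernelCDF_condCDF μ₀).toKernel _ := by
    ext ⟨⟨⟩, x⟩ : 1
    rw [Kernel.prodMkLeft_apply, responseKernel, Kernel.comap_apply]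
  rw [Measure.compProd, h2, h]
  simp

lemma measurable_trueCDF : Measurable fun w : (Fin p → ℝ) × ℝ => trueCDF μ₀ w.1 w.2 := by
  have ht : MeasurableSet {x : ((Fin p → ℝ) × ℝ) × ℝ | x.2 ≤ x.1.2} :=
    measurableSet_le measurable_snd (measurable_snd.comp measurable_fst)
  have h := Kernel.measurable_kernel_prodMk_left
    (κ := (responseKernel μ₀).comap (Prod.fst : (Fin p → ℝ) × ℝ → Fin p → ℝ) measurable_fst) ht
  convert! h.ennreal_toReal using 1
  funext w
  rw [← responseKernel_real_Iic μ₀, measureReal_def, Kernel.comap_apply]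
  rfl

lemma measurable_pointDist (hg : Measurable (Function.uncurry g)) :
    Measurable (pointDist c μ₀ μu g) := by
  have h : Measurable fun w : (Fin p → ℝ) × ℝ =>
      (inducedCDF μu g w.1 w.2 - trueCDF μ₀ w.1 w.2) ^ 2 :=
    ((measurable_inducedCDF μu hg).sub (measurable_trueCDF μ₀)).pow_const 2
  exact (h.stronglyMeasurable.integral_prod_right'
    (ν := volume.restrict (Set.Icc (-c) c))).measurable

/-- Outside of `[-c, c]` the distribution functions agree, so that the distance of the conditional
distribution functions only involves that interval. -/
lemma cdfDist_sq_eq (hY : ∀ᵐ z ∂μ₀, |z.2| ≤ c) (hgc : ∀ x u, |g x u| ≤ c) :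
    cdfDist (μ₀.map Prod.fst) (inducedCDF μu g) (trueCDF μ₀) ^ 2 =
      ∫ x, pointDist c μ₀ μu g x ∂μ₀.fst := by
  have hfst : μ₀.map Prod.fst = μ₀.fst := rfl
  unfold cdfDist
  rw [Real.sq_sqrt (integral_nonneg fun x => integral_nonneg fun s => sq_nonneg _), hfst]
  have hae : ∀ᵐ x ∂μ₀.fst, ∀ᵐ y ∂responseKernel μ₀ x, |y| ≤ c := by
    rw [← compProd_responseKernel μ₀] at hY
    exact Measure.ae_ae_of_ae_compProd hY
  refine integral_congr_ae ?_
  filter_upwards [hae] with x hx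
  refine (setIntegral_eq_integral_of_forall_compl_eq_zero fun s hs => ?_).symm
  rw [sq_eq_zero_iff, sub_eq_zero, ← responseKernel_real_Iic]
  unfold inducedCDF
  rcases lt_or_ge s (-c) with hs' | hs'
  · have h1 : {u | g x u ≤ s} = ∅ := by
      ext u
      have := (abs_le.mp (hgc x u)).1
      simp only [Set.mem_ofPred_eq, Set.mem_empty_iff_false, iff_false, not_le]
      linarith
    have h2 : responseKernel μ₀ x (Set.Iic s) = 0 := by
      refine measure_mono_null (fun y hy => ?_) (ae_iff.mp hx)
      intro hyc
      have := (abs_le.mp hyc).1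
      have : y ≤ s := hy
      linarith
    rw [h1, measureReal_empty, measureReal_def, h2, ENNReal.toReal_zero]
  · have hcs : c < s := by
      by_contra hcon
      exact hs ⟨hs', not_lt.mp hcon⟩
    have h1 : {u | g x u ≤ s} = Set.univ := by
      ext u
      have := (abs_le.mp (hgc x u)).2
      simp only [Set.mem_ofPred_eq, Set.mem_univ, iff_true]
      linarith
    have h2 : responseKernel μ₀ x (Set.Iic s) = 1 := by
      refine (mem_ae_iff_prob_eq_one measurableSet_Iic).mp ?_
      filter_upwards [hx] with y hy
      exact (abs_le.mp hy).2.trans hcs.le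
    rw [h1, probReal_univ, measureReal_def, h2, ENNReal.toReal_one]

/-- The part of the mean ranked probability score that does not depend on the model. -/
noncomputable def bayesRisk (c : ℝ) (μ₀ : Measure ((Fin p → ℝ) × ℝ)) : ℝ :=
  ∫ x, (∫ s in Set.Icc (-c) c, (trueCDF μ₀ x s - trueCDF μ₀ x s ^ 2)) ∂μ₀.fst

theorem integral_crps_inducedCDF (hc : 0 ≤ c) (hg : Measurable (Function.uncurry g)) :
    ∫ z, crps c (inducedCDF μu g z.1) z.2 ∂μ₀ =
      (∫ x, pointDist c μ₀ μu g x ∂μ₀.fst) + bayesRisk c μ₀ := by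
  have hF : ∀ x, Measurable (inducedCDF μu g x) := fun x =>
    (measurable_inducedCDF μu hg).comp (measurable_const.prodMk measurable_id)
  conv_lhs => rw [← compProd_responseKernel μ₀]
  rw [Measure.integral_compProd (integrable_of_measurable_bounded (measurable_crps μu hg)
    fun z => abs_crps_le μu hc z.1 z.2)]
  have h : ∀ x, ∫ y, crps c (inducedCDF μu g x) y ∂responseKernel μ₀ x =
      pointDist c μ₀ μu g x +
        ∫ s in Set.Icc (-c) c, (trueCDF μ₀ x s - trueCDF μ₀ x s ^ 2) := by
    intro x
    rw [integral_crps_eq (responseKernel μ₀ x) (hF x) (inducedCDF_nonneg g x)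
      (inducedCDF_le_one μu g x)]
    simp only [responseKernel_real_Iic]
    rfl
  dsimp only
  rw [integral_congr_ae (ae_of_all _ h), integral_add, bayesRisk]
  · exact integrable_of_measurable_bounded (measurable_pointDist μ₀ μu hg)
      (abs_pointDist_le μ₀ μu hc)
  · have hm : Measurable fun w : (Fin p → ℝ) × ℝ =>
        trueCDF μ₀ w.1 w.2 - trueCDF μ₀ w.1 w.2 ^ 2 :=
      (measurable_trueCDF μ₀).sub ((measurable_trueCDF μ₀).pow_const 2)
    refine integrable_of_measurable_bounded (hm.stronglyMeasurable.integral_prod_right'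
      (ν := volume.restrict (Set.Icc (-c) c))).measurable (K := 2 * c) fun x =>
        abs_setIntegral_Icc_le hc fun s => ?_
    have := trueCDF_nonneg μ₀ x s
    have := trueCDF_le_one μ₀ x s
    rw [abs_le]
    constructor <;> nlinarith

/-- The difference of the ranked probability scores of two models is controlled by their distances
to the true conditional distribution. -/
lemma sq_crps_sub_le (hc : 0 ≤ c) (hg : Measurable (Function.uncurry g))
    (hh : Measurable (Function.uncurry h)) (x : Fin p → ℝ) (y : ℝ) :
    (crps c (inducedCDF μu g x) y - crps c (inducedCDF μu h x) y) ^ 2 ≤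
      16 * c * (pointDist c μ₀ μu g x + pointDist c μ₀ μu h x) := by
  set I := volume.restrict (Set.Icc (-c) c) with hI
  set F := inducedCDF μu g x with hFdef
  set H := inducedCDF μu h x with hHdef
  set K := trueCDF μ₀ x with hKdef
  have hF : Measurable F :=
    (measurable_inducedCDF μu hg).comp (measurable_const.prodMk measurable_id)
  have hH : Measurable H :=
    (measurable_inducedCDF μu hh).comp (measurable_const.prodMk measurable_id)
  have hK : Measurable K :=
    (measurable_trueCDF μ₀).comp (measurable_const.prodMk measurable_id)
  have hS := measurable_step_right y
  have bF : ∀ s, 0 ≤ F s ∧ F s ≤ 1 := fun s =>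
    ⟨inducedCDF_nonneg g x s, inducedCDF_le_one μu g x s⟩
  have bH : ∀ s, 0 ≤ H s ∧ H s ≤ 1 := fun s =>
    ⟨inducedCDF_nonneg h x s, inducedCDF_le_one μu h x s⟩
  have bK : ∀ s, 0 ≤ K s ∧ K s ≤ 1 := fun s => ⟨trueCDF_nonneg μ₀ x s, trueCDF_le_one μ₀ x s⟩
  have bS : ∀ s, 0 ≤ step y s ∧ step y s ≤ 1 := fun s => ⟨step_nonneg y s, step_le_one y s⟩
  have hi : ∀ {f k : ℝ → ℝ}, Measurable f → Measurable k → (∀ s, 0 ≤ f s ∧ f s ≤ 1) →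
      (∀ s, 0 ≤ k s ∧ k s ≤ 1) → Integrable (fun s => (f s - k s) ^ 2) I :=
    fun {f k} hf hk bf bk => by
      refine integrable_of_measurable_bounded ((hf.sub hk).pow_const 2) (K := 1) fun s => ?_
      rw [abs_of_nonneg (sq_nonneg _)]
      nlinarith [bf s, bk s]
  set a := pointDist c μ₀ μu g x + pointDist c μ₀ μu h x with ha
  have ha0 : 0 ≤ a := add_nonneg (integral_nonneg fun _ => sq_nonneg _)
    (integral_nonneg fun _ => sq_nonneg _)
  -- both integrands are compared through the elementary inequality `2 |t| ≤ r t² + 1 / r`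
  have key : ∀ r : ℝ, 0 < r →
      |crps c F y - crps c H y| ≤ 2 * r * a + 2 * c / r := by
    intro r hr
    have hd : crps c F y - crps c H y =
        ∫ s, ((F s - step y s) ^ 2 - (H s - step y s) ^ 2) ∂I :=
      (integral_sub (hi hF hS bF bS) (hi hH hS bH bS)).symm
    have hI2 : ∫ _s, (1 / r) ∂I = 2 * c / r := by
      rw [integral_const, measureReal_restrict_apply_univ,
        Real.volume_real_Icc_of_le (by linarith), smul_eq_mul]
      ring
    have ha2 : 2 * r * a = ∫ s, (2 * r * ((F s - K s) ^ 2 + (H s - K s) ^ 2)) ∂I := by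
      rw [integral_const_mul, integral_add (hi hF hK bF bK) (hi hH hK bH bK)]
      rfl
    have hii : Integrable (fun s => 2 * r * ((F s - K s) ^ 2 + (H s - K s) ^ 2)) I :=
      ((hi hF hK bF bK).add (hi hH hK bH bK)).const_mul _
    rw [hd, ha2, ← hI2, ← integral_add hii (integrable_const _)]
    refine abs_integral_le_integral_abs.trans (integral_mono
      ((hi hF hS bF bS).sub (hi hH hS bH bS)).abs (hii.add (integrable_const _)) fun s => ?_)
    have e1 : (F s - step y s) ^ 2 - (H s - step y s) ^ 2 =
        (F s - H s) * (F s + H s - 2 * step y s) := by ring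
    have e2 : |F s + H s - 2 * step y s| ≤ 2 := by
      rw [abs_le]
      constructor <;> linarith [bF s, bH s, bS s]
    have e3 : |(F s - step y s) ^ 2 - (H s - step y s) ^ 2| ≤ 2 * |F s - H s| := by
      rw [e1, abs_mul, mul_comm]
      exact mul_le_mul_of_nonneg_right e2 (abs_nonneg _)
    have e4 : 2 * |F s - H s| ≤ r * (F s - H s) ^ 2 + 1 / r := by
      have h0 : 0 ≤ r * (|F s - H s| - 1 / r) ^ 2 := by positivity
      have h1 : r * (|F s - H s| - 1 / r) ^ 2 =
          r * (F s - H s) ^ 2 - 2 * |F s - H s| + 1 / r := by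
        rw [sub_sq, sq_abs]; field_simp
      linarith
    have e5 : r * (F s - H s) ^ 2 ≤ 2 * r * ((F s - K s) ^ 2 + (H s - K s) ^ 2) := by
      nlinarith [mul_nonneg hr.le (sq_nonneg ((F s - K s) + (H s - K s)))]
    change |(F s - step y s) ^ 2 - (H s - step y s) ^ 2| ≤
      2 * r * ((F s - K s) ^ 2 + (H s - K s) ^ 2) + 1 / r
    linarith
  rcases hc.eq_or_lt with h0 | hpos
  · simp [crps, ← h0]
  rcases ha0.eq_or_lt with h0 | hapos
  · have hz : crps c F y - crps c H y = 0 := by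
      by_contra hne
      have hpos' := abs_pos.mpr hne
      have := key (4 * c / |crps c F y - crps c H y|) (by positivity)
      rw [← h0, mul_zero, zero_add, div_div_eq_mul_div] at this
      have h2 : 2 * c * |crps c F y - crps c H y| / (4 * c) = |crps c F y - crps c H y| / 2 := by
        field_simp; norm_num
      rw [h2] at this
      linarith
    rw [hz, ← h0]; norm_num
  · have := key (Real.sqrt (c / a)) (Real.sqrt_pos.mpr (by positivity))
    have hs1 : Real.sqrt (c / a) * a = Real.sqrt (c * a) := by
      rw [Real.sqrt_div hpos.le, Real.sqrt_mul hpos.le]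
      have := Real.mul_self_sqrt hapos.le
      field_simp
      nlinarith
    have hs2 : c / Real.sqrt (c / a) = Real.sqrt (c * a) := by
      rw [Real.sqrt_div hpos.le, Real.sqrt_mul hpos.le]
      have := Real.mul_self_sqrt hpos.le
      have := Real.sqrt_pos.mpr hpos
      field_simp
      nlinarith
    have h4 : |crps c F y - crps c H y| ≤ 4 * Real.sqrt (c * a) := by
      calc _ ≤ 2 * Real.sqrt (c / a) * a + 2 * c / Real.sqrt (c / a) := this
        _ = 2 * (Real.sqrt (c / a) * a) + 2 * (c / Real.sqrt (c / a)) := by ring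
        _ = 4 * Real.sqrt (c * a) := by rw [hs1, hs2]; ring
    calc _ = |crps c F y - crps c H y| ^ 2 := (sq_abs _).symm
      _ ≤ (4 * Real.sqrt (c * a)) ^ 2 := pow_le_pow_left₀ (abs_nonneg _) h4 2
      _ = 16 * c * a := by rw [mul_pow, Real.sq_sqrt (by positivity)]; ring

end Risk

/-! ### First and second moments of the loss differences -/

section Moments

/-- A data point together with the noise variables attached to it. -/
abbrev Sample (p q m₁ m₂ : ℕ) : Type :=
  ((Fin p → ℝ) × ℝ) × (Fin m₁ × Fin m₂ → Fin q → ℝ)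

variable {p q m₁ m₂ : ℕ}

/-- The loss of the model `g` at a data point with its noise. -/
noncomputable def sampleLoss (g : (Fin p → ℝ) → (Fin q → ℝ) → ℝ) (v : Sample p q m₁ m₂) : ℝ :=
  energyLoss v.1.2 fun i => g v.1.1 (v.2 i)

/-- The average distance of the values that two models generate at a data point. -/
noncomputable def meanDist (g h : (Fin p → ℝ) → (Fin q → ℝ) → ℝ) (v : Sample p q m₁ m₂) : ℝ :=
  1 / ((m₁ : ℝ) * m₂) * ∑ i, |g v.1.1 (v.2 i) - h v.1.1 (v.2 i)|

variable {g h : (Fin p → ℝ) → (Fin q → ℝ) → ℝ} {c : ℝ}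

lemma abs_sampleLoss_sub_le (hm₁ : 1 ≤ m₁) (hm₂ : 2 ≤ m₂) (v : Sample p q m₁ m₂) :
    |sampleLoss g v - sampleLoss h v| ≤ 4 * meanDist g h v := by
  refine (abs_energyLoss_sub_le hm₁ hm₂ _ _ _).trans (le_of_eq ?_)
  unfold meanDist
  ring

lemma meanDist_nonneg (v : Sample p q m₁ m₂) : 0 ≤ meanDist g h v := by
  unfold meanDist
  positivity

lemma average_le_of_le {f : Fin m₁ × Fin m₂ → ℝ} {K : ℝ} (hm₁ : 1 ≤ m₁) (hm₂ : 2 ≤ m₂)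
    (hf : ∀ i, f i ≤ K) : 1 / ((m₁ : ℝ) * m₂) * ∑ i, f i ≤ K := by
  have h1 : (0 : ℝ) < m₁ := by exact_mod_cast hm₁
  have h2 : (0 : ℝ) < m₂ := by exact_mod_cast (by omega : 0 < m₂)
  have h3 : ∑ i, f i ≤ (m₁ * m₂ : ℝ) * K := by
    refine (Finset.sum_le_card_nsmul _ _ K fun i _ => hf i).trans (le_of_eq ?_)
    simp
  rw [one_div, inv_mul_le_iff₀ (by positivity)]
  exact h3

lemma abs_sub_le_of_bounded (hgc : ∀ x u, |g x u| ≤ c) (hhc : ∀ x u, |h x u| ≤ c)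
    (x : Fin p → ℝ) (u : Fin q → ℝ) : |g x u - h x u| ≤ 2 * c :=
  (abs_sub _ _).trans (by linarith [hgc x u, hhc x u])

lemma meanDist_le (hm₁ : 1 ≤ m₁) (hm₂ : 2 ≤ m₂) (hgc : ∀ x u, |g x u| ≤ c)
    (hhc : ∀ x u, |h x u| ≤ c) (v : Sample p q m₁ m₂) : meanDist g h v ≤ 2 * c :=
  average_le_of_le hm₁ hm₂ fun _ => abs_sub_le_of_bounded hgc hhc _ _

lemma measurable_model (hg : Measurable (Function.uncurry g)) (i : Fin m₁ × Fin m₂) :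
    Measurable fun v : Sample p q m₁ m₂ => g v.1.1 (v.2 i) :=
  hg.comp ((measurable_fst.comp measurable_fst).prodMk
    ((measurable_pi_apply i).comp measurable_snd))

lemma measurable_sampleLoss (hg : Measurable (Function.uncurry g)) :
    Measurable (sampleLoss g : Sample p q m₁ m₂ → ℝ) := by
  have hgi := measurable_model (m₁ := m₁) (m₂ := m₂) hg
  have hy : Measurable fun v : Sample p q m₁ m₂ => v.1.2 := measurable_snd.comp measurable_fst
  unfold sampleLoss energyLoss
  refine Measurable.const_mul (Finset.measurable_fun_sum _ fun b _ => Measurable.sub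
    (Measurable.const_mul (Finset.measurable_fun_sum _ fun k _ => ?_) _)
    (Measurable.const_mul (Finset.measurable_fun_sum _ fun k _ =>
      Finset.measurable_fun_sum _ fun k' _ => ?_) _)) _
  · exact (hy.sub (hgi _)).abs
  · exact ((hgi _).sub (hgi _)).abs

lemma measurable_meanDist (hg : Measurable (Function.uncurry g))
    (hh : Measurable (Function.uncurry h)) :
    Measurable (meanDist g h : Sample p q m₁ m₂ → ℝ) := by
  unfold meanDist
  exact Measurable.const_mul (Finset.measurable_fun_sum _ fun i _ =>
    ((measurable_model hg i).sub (measurable_model hh i)).abs) _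

lemma abs_sampleLoss_sub_le' (hm₁ : 1 ≤ m₁) (hm₂ : 2 ≤ m₂) (hgc : ∀ x u, |g x u| ≤ c)
    (hhc : ∀ x u, |h x u| ≤ c) (v : Sample p q m₁ m₂) :
    |sampleLoss g v - sampleLoss h v| ≤ 8 * c :=
  (abs_sampleLoss_sub_le hm₁ hm₂ v).trans (by linarith [meanDist_le hm₁ hm₂ hgc hhc v])

lemma energyLoss_zero (hm₁ : 1 ≤ m₁) (hm₂ : 2 ≤ m₂) (y : ℝ) :
    energyLoss y (fun _ : Fin m₁ × Fin m₂ => 0) = 2 * |y| := by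
  have h1 : (m₁ : ℝ) ≠ 0 := by positivity
  have h2 : (m₂ : ℝ) ≠ 0 := by positivity
  simp [energyLoss]
  field_simp

lemma abs_energyLoss_le (hm₁ : 1 ≤ m₁) (hm₂ : 2 ≤ m₂) (y : ℝ) {a : Fin m₁ × Fin m₂ → ℝ}
    (ha : ∀ i, |a i| ≤ c) : |energyLoss y a| ≤ 4 * c + 2 * |y| := by
  have h1 := abs_energyLoss_sub_le hm₁ hm₂ y a fun _ => 0
  have h2 := average_le_of_le hm₁ hm₂ ha
  rw [energyLoss_zero hm₁ hm₂] at h1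
  simp only [sub_zero] at h1
  have h3 : 4 / ((m₁ : ℝ) * m₂) * ∑ i, |a i| = 4 * (1 / ((m₁ : ℝ) * m₂) * ∑ i, |a i|) := by ring
  have h4 := abs_sub_abs_le_abs_sub (energyLoss y a) (2 * |y|)
  rw [abs_of_nonneg (by positivity : 0 ≤ 2 * |y|)] at h4
  linarith

variable (μ₀ : Measure ((Fin p → ℝ) × ℝ)) (μu : Measure (Fin q → ℝ))

/-- The law of a data point with its noise variables. -/
noncomputable def sampleLaw (m₁ m₂ : ℕ) : Measure (Sample p q m₁ m₂) :=
  μ₀.prod (Measure.pi fun _ => μu)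

variable [IsProbabilityMeasure μ₀] [IsProbabilityMeasure μu]

instance : IsProbabilityMeasure (sampleLaw μ₀ μu m₁ m₂) := by
  unfold sampleLaw
  infer_instance

lemma integral_meanDist (hm₁ : 1 ≤ m₁) (hm₂ : 2 ≤ m₂) (hg : Measurable (Function.uncurry g))
    (hh : Measurable (Function.uncurry h)) (hgc : ∀ x u, |g x u| ≤ c)
    (hhc : ∀ x u, |h x u| ≤ c) :
    ∫ v, meanDist g h v ∂sampleLaw μ₀ μu m₁ m₂ =
      ∫ z, |g z.1 z.2 - h z.1 z.2| ∂μ₀.fst.prod μu := by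
  have hK := abs_sub_le_of_bounded hgc hhc
  have hd : Measurable fun z : (Fin p → ℝ) × (Fin q → ℝ) => |g z.1 z.2 - h z.1 z.2| :=
    (hg.sub hh).abs
  have hdi : Integrable (fun z : (Fin p → ℝ) × (Fin q → ℝ) => |g z.1 z.2 - h z.1 z.2|)
      (μ₀.fst.prod μu) :=
    integrable_of_measurable_bounded hd fun z => by rw [abs_abs]; exact hK _ _
  have hi : ∀ i, Integrable (fun v : Sample p q m₁ m₂ => |g v.1.1 (v.2 i) - h v.1.1 (v.2 i)|)
      (sampleLaw μ₀ μu m₁ m₂) := fun i =>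
    integrable_of_measurable_bounded ((measurable_model hg i).sub (measurable_model hh i)).abs
      fun v => by rw [abs_abs]; exact hK _ _
  have he : ∀ i, ∫ v, |g v.1.1 (v.2 i) - h v.1.1 (v.2 i)| ∂sampleLaw μ₀ μu m₁ m₂ =
      ∫ z, |g z.1 z.2 - h z.1 z.2| ∂μ₀.fst.prod μu := by
    intro i
    have h1 : ∀ z : (Fin p → ℝ) × ℝ, ∫ u, |g z.1 (u i) - h z.1 (u i)|
        ∂(Measure.pi fun _ : Fin m₁ × Fin m₂ => μu) = ∫ w, |g z.1 w - h z.1 w| ∂μu := fun z =>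
      integral_comp_eval (μ := fun _ : Fin m₁ × Fin m₂ => μu) (i := i)
        (hd.comp (measurable_const.prodMk measurable_id)).aestronglyMeasurable
    have hin := hi i
    unfold sampleLaw at hin ⊢
    rw [integral_prod _ hin, integral_prod _ hdi]
    simp only [h1]
    have hF : AEStronglyMeasurable (fun x => ∫ w, |g x w - h x w| ∂μu) (μ₀.map Prod.fst) :=
      (hd.stronglyMeasurable.integral_prod_right' (ν := μu)).aestronglyMeasurable
    exact (integral_map measurable_fst.aemeasurable hF).symm
  have h1 : (m₁ : ℝ) ≠ 0 := by positivity
  have h2 : (m₂ : ℝ) ≠ 0 := by positivity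
  unfold meanDist
  rw [integral_const_mul, integral_finsetSum _ fun i _ => hi i, Finset.sum_congr rfl fun i _ => he i]
  simp
  field_simp

variable {μ₀}

lemma integral_sampleLoss_noise (hm₁ : 1 ≤ m₁) (hm₂ : 2 ≤ m₂)
    (hg : Measurable (Function.uncurry g)) (hh : Measurable (Function.uncurry h))
    (hgc : ∀ x u, |g x u| ≤ c) (hhc : ∀ x u, |h x u| ≤ c) {z : (Fin p → ℝ) × ℝ}
    (hz : |z.2| ≤ c) :
    ∫ u, (sampleLoss g ((z, u) : Sample p q m₁ m₂) - sampleLoss h ((z, u) : Sample p q m₁ m₂))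
        ∂(Measure.pi fun _ : Fin m₁ × Fin m₂ => μu) =
      2 * (crps c (inducedCDF μu g z.1) z.2 - crps c (inducedCDF μu h z.1) z.2) := by
  have hi : ∀ {f : (Fin p → ℝ) → (Fin q → ℝ) → ℝ}, Measurable (Function.uncurry f) →
      (∀ x u, |f x u| ≤ c) → Integrable (fun u => sampleLoss f ((z, u) : Sample p q m₁ m₂))
        (Measure.pi fun _ : Fin m₁ × Fin m₂ => μu) := fun {f} hf hfc =>
    integrable_of_measurable_bounded
      ((measurable_sampleLoss hf).comp (measurable_const.prodMk measurable_id))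
      (K := 4 * c + 2 * |z.2|) (fun u => abs_energyLoss_le hm₁ hm₂ z.2 fun i => hfc z.1 (u i))
  have hx : ∀ {f : (Fin p → ℝ) → (Fin q → ℝ) → ℝ}, Measurable (Function.uncurry f) →
      Measurable (f z.1) := fun {f} hf => hf.comp (measurable_const.prodMk measurable_id)
  rw [integral_sub (hi hg hgc) (hi hh hhc)]
  unfold sampleLoss
  rw [integral_energyLoss μu hm₁ hm₂ hz (hx hg) (hgc z.1),
    integral_energyLoss μu hm₁ hm₂ hz (hx hh) (hhc z.1)]
  unfold inducedCDF
  ring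

/-- The mean loss is twice the squared distance to the true conditional distribution functions, up
to a constant that does not depend on the model. -/
theorem integral_sampleLoss_sub (hc : 0 ≤ c) (hY : ∀ᵐ z ∂μ₀, |z.2| ≤ c) (hm₁ : 1 ≤ m₁)
    (hm₂ : 2 ≤ m₂) (hg : Measurable (Function.uncurry g)) (hh : Measurable (Function.uncurry h))
    (hgc : ∀ x u, |g x u| ≤ c) (hhc : ∀ x u, |h x u| ≤ c) :
    ∫ v, (sampleLoss g v - sampleLoss h v) ∂sampleLaw μ₀ μu m₁ m₂ =
      2 * ((∫ x, pointDist c μ₀ μu g x ∂μ₀.fst) - ∫ x, pointDist c μ₀ μu h x ∂μ₀.fst) := by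
  have hD : Integrable (fun v : Sample p q m₁ m₂ => sampleLoss g v - sampleLoss h v)
      (sampleLaw μ₀ μu m₁ m₂) :=
    integrable_of_measurable_bounded ((measurable_sampleLoss hg).sub (measurable_sampleLoss hh))
      (abs_sampleLoss_sub_le' hm₁ hm₂ hgc hhc)
  unfold sampleLaw at hD ⊢
  have hcr : ∀ {f : (Fin p → ℝ) → (Fin q → ℝ) → ℝ}, Measurable (Function.uncurry f) →
      Integrable (fun z : (Fin p → ℝ) × ℝ => crps c (inducedCDF μu f z.1) z.2) μ₀ :=
    fun {f} hf => integrable_of_measurable_bounded (measurable_crps μu hf)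
      fun z => abs_crps_le μu hc z.1 z.2
  rw [integral_prod _ hD]
  have hae : ∀ᵐ z ∂μ₀, ∫ u, (sampleLoss g ((z, u) : Sample p q m₁ m₂) -
      sampleLoss h ((z, u) : Sample p q m₁ m₂)) ∂(Measure.pi fun _ => μu) =
      2 * (crps c (inducedCDF μu g z.1) z.2 - crps c (inducedCDF μu h z.1) z.2) := by
    filter_upwards [hY] with z hz
    exact integral_sampleLoss_noise μu hm₁ hm₂ hg hh hgc hhc hz
  rw [integral_congr_ae hae, integral_const_mul, integral_sub (hcr hg) (hcr hh),
    integral_crps_inducedCDF μ₀ μu hc hg, integral_crps_inducedCDF μ₀ μu hc hh]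
  ring

/-- Bernstein condition: the second moment of a loss difference is controlled by the excess risks,
up to the variance that comes from the `m₁ m₂` noise variables. -/
theorem integral_sq_sampleLoss_sub_le (hc : 0 ≤ c) (hY : ∀ᵐ z ∂μ₀, |z.2| ≤ c) (hm₁ : 1 ≤ m₁)
    (hm₂ : 2 ≤ m₂) (hg : Measurable (Function.uncurry g)) (hh : Measurable (Function.uncurry h))
    (hgc : ∀ x u, |g x u| ≤ c) (hhc : ∀ x u, |h x u| ≤ c) :
    ∫ v, (sampleLoss g v - sampleLoss h v) ^ 2 ∂sampleLaw μ₀ μu m₁ m₂ ≤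
      64 * c * ((∫ x, pointDist c μ₀ μu g x ∂μ₀.fst) + ∫ x, pointDist c μ₀ μu h x ∂μ₀.fst) +
        256 * c ^ 2 / (m₁ * m₂) := by
  have h1 : (0 : ℝ) < m₁ := by exact_mod_cast hm₁
  have h2 : (0 : ℝ) < m₂ := by exact_mod_cast (by omega : 0 < m₂)
  have hDm : Measurable fun v : Sample p q m₁ m₂ => sampleLoss g v - sampleLoss h v :=
    (measurable_sampleLoss hg).sub (measurable_sampleLoss hh)
  have hDK := abs_sampleLoss_sub_le' (g := g) (h := h) hm₁ hm₂ hgc hhc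
  have hD2 : Integrable (fun v : Sample p q m₁ m₂ => (sampleLoss g v - sampleLoss h v) ^ 2)
      (sampleLaw μ₀ μu m₁ m₂) :=
    integrable_of_measurable_bounded (hDm.pow_const 2) (K := (8 * c) ^ 2) fun v => by
      rw [abs_pow]; exact pow_le_pow_left₀ (abs_nonneg _) (hDK v) 2
  have hpd : ∀ {f : (Fin p → ℝ) → (Fin q → ℝ) → ℝ}, Measurable (Function.uncurry f) →
      Integrable (pointDist c μ₀ μu f) μ₀.fst := fun {f} hf =>
    integrable_of_measurable_bounded (measurable_pointDist μ₀ μu hf) (abs_pointDist_le μ₀ μu hc)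
  have hfst : MeasurePreserving (Prod.fst : (Fin p → ℝ) × ℝ → Fin p → ℝ) μ₀ μ₀.fst :=
    ⟨measurable_fst, rfl⟩
  have hpd' : ∀ {f : (Fin p → ℝ) → (Fin q → ℝ) → ℝ}, Measurable (Function.uncurry f) →
      Integrable (fun z : (Fin p → ℝ) × ℝ => pointDist c μ₀ μu f z.1) μ₀ := fun {f} hf =>
    hfst.integrable_comp_of_integrable (hpd hf)
  have hmap : ∀ {f : (Fin p → ℝ) → (Fin q → ℝ) → ℝ}, Measurable (Function.uncurry f) →
      ∫ z, pointDist c μ₀ μu f z.1 ∂μ₀ = ∫ x, pointDist c μ₀ μu f x ∂μ₀.fst := fun {f} hf =>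
    (integral_map measurable_fst.aemeasurable
      (measurable_pointDist μ₀ μu hf).aestronglyMeasurable).symm
  unfold sampleLaw at hD2 ⊢
  rw [integral_prod _ hD2]
  set P := Measure.pi fun _ : Fin m₁ × Fin m₂ => μu with hP
  have hz : ∀ᵐ z ∂μ₀, ∫ u, (sampleLoss g ((z, u) : Sample p q m₁ m₂) -
      sampleLoss h ((z, u) : Sample p q m₁ m₂)) ^ 2 ∂P ≤
      64 * c * (pointDist c μ₀ μu g z.1 + pointDist c μ₀ μu h z.1) +
        256 * c ^ 2 / (m₁ * m₂) := by
    filter_upwards [hY] with z hz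
    set D : (Fin m₁ × Fin m₂ → Fin q → ℝ) → ℝ := fun u =>
      sampleLoss g ((z, u) : Sample p q m₁ m₂) - sampleLoss h ((z, u) : Sample p q m₁ m₂) with hD
    have hDzm : Measurable D := hDm.comp (measurable_const.prodMk measurable_id)
    have hDzK : ∀ u, |D u| ≤ 8 * c := fun u => hDK (z, u)
    have hDi : Integrable D P := integrable_of_measurable_bounded hDzm hDzK
    have hmean : ∫ u, D u ∂P =
        2 * (crps c (inducedCDF μu g z.1) z.2 - crps c (inducedCDF μu h z.1) z.2) :=
      integral_sampleLoss_noise μu hm₁ hm₂ hg hh hgc hhc hz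
    have hosc : ∀ {f : (Fin p → ℝ) → (Fin q → ℝ) → ℝ}, (∀ x u, |f x u| ≤ c) → ∀ u j x,
        |sampleLoss f ((z, Function.update u j x) : Sample p q m₁ m₂) -
          sampleLoss f ((z, u) : Sample p q m₁ m₂)| ≤ 8 * c / (m₁ * m₂) := by
      intro f hfc u j x
      refine (abs_energyLoss_sub_le hm₁ hm₂ _ _ _).trans ?_
      rw [Finset.sum_eq_single j (fun i _ hij => by
        simp [Function.update_of_ne hij]) (by simp)]
      have := (abs_sub (f z.1 (Function.update u j x j)) (f z.1 (u j))).trans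
        (add_le_add (hfc _ _) (hfc _ _))
      calc 4 / ((m₁ : ℝ) * m₂) * |f z.1 (Function.update u j x j) - f z.1 (u j)|
          ≤ 4 / ((m₁ : ℝ) * m₂) * (c + c) := by gcongr
        _ = _ := by ring
    have hvar := variance_le_of_bounded_differences μu (δ := 16 * c / (m₁ * m₂))
      (by positivity) D hDzm hDzK (fun u j x => by
        have e1 := abs_le.mp (hosc hgc u j x)
        have e2 := abs_le.mp (hosc hhc u j x)
        have e3 : 16 * c / ((m₁ : ℝ) * m₂) = 8 * c / (m₁ * m₂) + 8 * c / (m₁ * m₂) := by ring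
        rw [e3, abs_le]
        simp only [hD]
        constructor <;> linarith [e1.1, e1.2, e2.1, e2.2])
    set m := ∫ u, D u ∂P with hm
    have hsq : ∫ u, D u ^ 2 ∂P = ∫ u, (D u - m) ^ 2 ∂P + m ^ 2 := by
      have hi2 : Integrable (fun u => (D u - m) ^ 2) P := by
        refine integrable_of_measurable_bounded ((hDzm.sub_const m).pow_const 2)
          (K := (8 * c + |m|) ^ 2) fun u => ?_
        rw [abs_pow]
        exact pow_le_pow_left₀ (abs_nonneg _) ((abs_sub _ _).trans (by linarith [hDzK u])) 2
      have hexp : ∀ u, D u ^ 2 = (D u - m) ^ 2 + (2 * m * D u - m ^ 2) := fun u => by ring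
      have hi3 : Integrable (fun u => 2 * m * D u - m ^ 2) P :=
        (hDi.const_mul _).sub (integrable_const _)
      rw [integral_congr_ae (ae_of_all _ hexp), integral_add hi2 hi3,
        integral_sub (hDi.const_mul _) (integrable_const _), integral_const_mul, ← hm]
      simp
      ring
    have hcr := sq_crps_sub_le μ₀ μu hc hg hh z.1 z.2
    have hcard : (Fintype.card (Fin m₁ × Fin m₂) : ℝ) * (16 * c / (m₁ * m₂)) ^ 2 =
        256 * c ^ 2 / (m₁ * m₂) := by
      simp only [Fintype.card_prod, Fintype.card_fin]
      push_cast
      field_simp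
      ring
    rw [hcard] at hvar
    change ∫ u, D u ^ 2 ∂P ≤ _
    rw [hsq]
    have hm2 : m ^ 2 = 4 * (crps c (inducedCDF μu g z.1) z.2 -
        crps c (inducedCDF μu h z.1) z.2) ^ 2 := by rw [hmean]; ring
    linarith
  have hsum : Integrable (fun z : (Fin p → ℝ) × ℝ =>
      64 * c * (pointDist c μ₀ μu g z.1 + pointDist c μ₀ μu h z.1)) μ₀ :=
    ((hpd' hg).add (hpd' hh)).const_mul _
  have hR : Integrable (fun z : (Fin p → ℝ) × ℝ =>
      64 * c * (pointDist c μ₀ μu g z.1 + pointDist c μ₀ μu h z.1) + 256 * c ^ 2 / (m₁ * m₂)) μ₀ :=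
    hsum.add (integrable_const _)
  refine (integral_mono_ae hD2.integral_prod_left hR hz).trans (le_of_eq ?_)
  rw [integral_add hsum (integrable_const _),
    integral_const_mul, integral_add (hpd' hg) (hpd' hh), hmap hg, hmap hh]
  simp

end Moments

/-! ### Deviation inequalities for the network class -/

section Deviations

/-- Bernstein's inequality for the lower tail of a sum of independent copies of a bounded
function. -/
theorem measure_sum_le_mean_sub_le {V : Type*} [MeasurableSpace V] {n : ℕ} (ν : Measure V)
    [IsProbabilityMeasure ν] {D : V → ℝ} (hD : Measurable D) {b l s σ : ℝ}
    (hDb : ∀ v, |D v| ≤ b) (hl : 0 ≤ l) (hlb : l * b ≤ 1) (hσ : ∫ v, D v ^ 2 ∂ν ≤ σ) :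
    (Measure.pi fun _ : Fin n => ν) {v | ∑ i, D (v i) ≤ n * ((∫ x, D x ∂ν) - s)} ≤
      ENNReal.ofReal (Real.exp (-(n * (l * s - l ^ 2 * σ)))) := by
  set P := Measure.pi fun _ : Fin n => ν with hP
  set m := ∫ x, D x ∂ν with hm
  have hexpm : Measurable fun v => Real.exp (-(l * D v)) := (hD.const_mul l).neg.exp
  have hlD : ∀ v, |l * D v| ≤ 1 := fun v => by
    rw [abs_mul, abs_of_nonneg hl]
    exact (mul_le_mul_of_nonneg_left (hDb v) hl).trans hlb
  have hDi : Integrable D ν := integrable_of_measurable_bounded hD hDb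
  have hD2i : Integrable (fun v => D v ^ 2) ν :=
    integrable_of_measurable_bounded (hD.pow_const 2) (K := b ^ 2) fun v => by
      rw [abs_pow]; exact pow_le_pow_left₀ (abs_nonneg _) (hDb v) 2
  have hexpi : Integrable (fun v => Real.exp (-(l * D v))) ν :=
    integrable_of_measurable_bounded hexpm (K := Real.exp 1) fun v => by
      rw [abs_of_pos (Real.exp_pos _), Real.exp_le_exp]
      linarith [(abs_le.mp (hlD v)).1]
  have hone : ∫ v, Real.exp (-(l * D v)) ∂ν ≤ Real.exp (-(l * m) + l ^ 2 * σ) := by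
    have h1 : ∀ v, Real.exp (-(l * D v)) ≤ 1 - l * D v + l ^ 2 * D v ^ 2 := fun v => by
      have := (abs_le.mp (Real.abs_exp_sub_one_sub_id_le (x := -(l * D v))
        (by rw [abs_neg]; exact hlD v))).2
      nlinarith
    have hi1 : Integrable (fun v => 1 - l * D v) ν := (integrable_const _).sub (hDi.const_mul _)
    have h2 := integral_mono hexpi (hi1.add (hD2i.const_mul (l ^ 2))) h1
    rw [integral_add' hi1 (hD2i.const_mul _), integral_sub (integrable_const _) (hDi.const_mul _),
      integral_const_mul, integral_const_mul] at h2
    simp only [integral_const, probReal_univ, one_smul] at h2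
    refine h2.trans (le_trans ?_ (Real.add_one_le_exp _))
    have := mul_le_mul_of_nonneg_left hσ (sq_nonneg l)
    linarith
  have hprodi : Integrable (fun v : Fin n → V => ∏ i, Real.exp (-(l * D (v i)))) P :=
    Integrable.fintype_prod (μ := fun _ : Fin n => ν) fun _ => hexpi
  have hprod : ∫ v, ∏ i, Real.exp (-(l * D (v i))) ∂P ≤
      Real.exp (n * (-(l * m) + l ^ 2 * σ)) := by
    rw [hP, integral_fintype_prod_eq_pow (ι := Fin n) (μ := ν) fun v => Real.exp (-(l * D v)),
      Fintype.card_fin, Real.exp_nat_mul]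
    exact pow_le_pow_left₀ (integral_nonneg fun _ => (Real.exp_pos _).le) hone n
  have hmk := mul_meas_ge_le_integral_of_nonneg (μ := P)
    (ae_of_all _ fun v => Finset.prod_nonneg fun i _ => (Real.exp_pos (-(l * D (v i)))).le)
    hprodi (Real.exp (-(l * (n * (m - s)))))
  have hsub : {v : Fin n → V | ∑ i, D (v i) ≤ n * (m - s)} ⊆
      {v | Real.exp (-(l * (n * (m - s)))) ≤ ∏ i, Real.exp (-(l * D (v i)))} := by
    intro v hv
    simp only [Set.mem_ofPred_eq] at hv ⊢
    rw [← Real.exp_sum, Real.exp_le_exp, Finset.sum_neg_distrib, ← Finset.mul_sum]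
    exact neg_le_neg (mul_le_mul_of_nonneg_left hv hl)
  refine (measure_mono hsub).trans ?_
  rw [← ofReal_measureReal (measure_ne_top P _)]
  refine ENNReal.ofReal_le_ofReal ?_
  have h3 := hmk.trans hprod
  rw [← le_div_iff₀' (Real.exp_pos _), ← Real.exp_sub] at h3
  refine h3.trans (le_of_eq ?_)
  congr 1
  ring

/-- The uniform distribution on a finite family of points. -/
lemma exists_uniform_measure {J S : Type*} [Fintype J] [Nonempty J] [MeasurableSpace S]
    (pt : J → S) : ∃ Q : Measure S, IsProbabilityMeasure Q ∧
      ∀ f : S → ℝ, Measurable f → ∫ z, f z ∂Q = 1 / Fintype.card J * ∑ j, f (pt j) := by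
  have hJ : (Fintype.card J : ENNReal) ≠ 0 := by simp
  refine ⟨∑ j, (Fintype.card J : ENNReal)⁻¹ • Measure.dirac (pt j), ⟨?_⟩, fun f hf => ?_⟩
  · simp [ENNReal.mul_inv_cancel hJ (by simp)]
  · have hi : ∀ j, Integrable f ((Fintype.card J : ENNReal)⁻¹ • Measure.dirac (pt j)) := fun j =>
      (integrable_dirac' hf.stronglyMeasurable (by simp)).smul_measure (by simp)
    rw [integral_finsetSum_measure fun j _ => hi j, Finset.mul_sum]
    refine Finset.sum_congr rfl fun j _ => ?_
    rw [integral_smul_measure, integral_dirac' _ _ hf.stronglyMeasurable]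
    simp

variable {p q L N n m₁ m₂ : ℕ} {c : ℝ}

/-- The truncated network with parameter vector `θ` as a function of `x` and `u`. -/
noncomputable def netModel (c : ℝ) (θ : ParamIndex (p + q) L N → ℝ) (x : Fin p → ℝ)
    (u : Fin q → ℝ) : ℝ :=
  netFun c θ (x, u)

lemma measurable_netModel (hc : 0 < c) (θ : ParamIndex (p + q) L N → ℝ) :
    Measurable (Function.uncurry (netModel c θ : (Fin p → ℝ) → (Fin q → ℝ) → ℝ)) :=
  measurable_netFun hc θ

lemma abs_netModel_le (hc : 0 < c) (θ : ParamIndex (p + q) L N → ℝ) (x : Fin p → ℝ)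
    (u : Fin q → ℝ) : |netModel c θ x u| ≤ c :=
  abs_netFun_le hc θ _

lemma continuous_netModel (hc : 0 < c) (x : Fin p → ℝ) (u : Fin q → ℝ) :
    Continuous fun θ : ParamIndex (p + q) L N → ℝ => netModel c θ x u := by
  have h : Continuous fun θ : ParamIndex (p + q) L N → ℝ => (θ, (x, u)) :=
    continuous_id.prodMk continuous_const
  have h2 := (continuous_netFun (p := p) (q := q) (L := L) (N := N) hc).comp h
  simpa only [netModel, Function.comp_def] using h2

/-- Networks that are close in `L¹` at the points of two samples of size `n` produce close average
distances on these samples. -/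
lemma exists_net_meanDist (hc : 0 < c) (hn : 1 ≤ n) (hm₁ : 1 ≤ m₁) (hm₂ : 2 ≤ m₂) {M : ℕ}
    (Θ : Set (ParamIndex (p + q) L N → ℝ))
    (hnet : ∀ (Q : Measure ((Fin p → ℝ) × (Fin q → ℝ))) [IsProbabilityMeasure Q],
      ∃ T : Finset Θ, T.card ≤ M ∧ ∀ θ : Θ, ∃ θ' ∈ T,
        ∫ z, |netFun c (θ : ParamIndex (p + q) L N → ℝ) z -
          netFun c (θ' : ParamIndex (p + q) L N → ℝ) z| ∂Q ≤ 1 / n)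
    (w : Fin n → Sample p q m₁ m₂ × Sample p q m₁ m₂) :
    ∃ T : Finset (Θ × Θ), T.card ≤ M ^ 2 ∧ ∀ θ : Θ × Θ, ∃ θ' ∈ T,
      ∑ i, (|meanDist (netModel c θ.1.1) (netModel c θ.2.1) (w i).1 -
          meanDist (netModel c θ'.1.1) (netModel c θ'.2.1) (w i).1| +
        |meanDist (netModel c θ.1.1) (netModel c θ.2.1) (w i).2 -
          meanDist (netModel c θ'.1.1) (netModel c θ'.2.1) (w i).2|) ≤ n * (4 / n) := by
  classical
  have hn0 : (0 : ℝ) < n := by exact_mod_cast hn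
  have h1 : (0 : ℝ) < m₁ := by exact_mod_cast hm₁
  have h2 : (0 : ℝ) < m₂ := by exact_mod_cast (by omega : 0 < m₂)
  have : Nonempty ((Fin n × Fin 2) × (Fin m₁ × Fin m₂)) :=
    ⟨((⟨0, hn⟩, 0), (⟨0, hm₁⟩, ⟨0, by omega⟩))⟩
  let pt : (Fin n × Fin 2) × (Fin m₁ × Fin m₂) → (Fin p → ℝ) × (Fin q → ℝ) := fun j =>
    ((![(w j.1.1).1, (w j.1.1).2] j.1.2).1.1, (![(w j.1.1).1, (w j.1.1).2] j.1.2).2 j.2)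
  obtain ⟨Q, hQ, hQint⟩ := exists_uniform_measure pt
  obtain ⟨T, hT, hTnet⟩ := hnet Q
  -- the sum of the average distances over both samples is an integral with respect to `Q`
  have hsum : ∀ θ θ' : Θ,
      ∑ i, (meanDist (netModel c θ.1) (netModel c θ'.1) (w i).1 +
        meanDist (netModel c θ.1) (netModel c θ'.1) (w i).2) =
      2 * n * ∫ z, |netFun c (θ : ParamIndex (p + q) L N → ℝ) z -
        netFun c (θ' : ParamIndex (p + q) L N → ℝ) z| ∂Q := by
    intro θ θ'
    rw [hQint (fun z => |netFun c (θ : ParamIndex (p + q) L N → ℝ) z -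
        netFun c (θ' : ParamIndex (p + q) L N → ℝ) z|)
        ((measurable_netFun hc _).sub (measurable_netFun hc _)).abs,
      Fintype.sum_prod_type, Fintype.sum_prod_type]
    simp only [Fin.sum_univ_two, pt, Matrix.cons_val_zero, Matrix.cons_val_one,
      Fintype.card_prod, Fintype.card_fin]
    unfold meanDist netModel
    simp only [← mul_add, ← Finset.mul_sum]
    push_cast
    field_simp
  have htri : ∀ (f g f' g' : (Fin p → ℝ) → (Fin q → ℝ) → ℝ) (v : Sample p q m₁ m₂),
      |meanDist f g v - meanDist f' g' v| ≤ meanDist f f' v + meanDist g g' v := by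
    intro f g f' g' v
    unfold meanDist
    rw [← mul_sub, ← mul_add, abs_mul, abs_of_nonneg (by positivity), ← Finset.sum_sub_distrib,
      ← Finset.sum_add_distrib]
    refine mul_le_mul_of_nonneg_left ((Finset.abs_sum_le_sum_abs _ _).trans
      (Finset.sum_le_sum fun i _ => ?_)) (by positivity)
    refine (abs_abs_sub_abs_le _ _).trans ?_
    rw [show ∀ a b a' b' : ℝ, a - b - (a' - b') = (a - a') - (b - b') from
      fun _ _ _ _ => by ring]
    exact abs_sub _ _
  refine ⟨T ×ˢ T, ?_, fun θ => ?_⟩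
  · rw [Finset.card_product, sq]
    exact Nat.mul_le_mul hT hT
  · obtain ⟨a, haT, ha⟩ := hTnet θ.1
    obtain ⟨b, hbT, hb⟩ := hTnet θ.2
    refine ⟨(a, b), Finset.mk_mem_product haT hbT, ?_⟩
    calc _ ≤ ∑ i, ((meanDist (netModel c θ.1.1) (netModel c a.1) (w i).1 +
            meanDist (netModel c θ.2.1) (netModel c b.1) (w i).1) +
          (meanDist (netModel c θ.1.1) (netModel c a.1) (w i).2 +
            meanDist (netModel c θ.2.1) (netModel c b.1) (w i).2)) :=
          Finset.sum_le_sum fun i _ => add_le_add (htri _ _ _ _ _) (htri _ _ _ _ _)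
      _ = ∑ i, (meanDist (netModel c θ.1.1) (netModel c a.1) (w i).1 +
            meanDist (netModel c θ.1.1) (netModel c a.1) (w i).2) +
          ∑ i, (meanDist (netModel c θ.2.1) (netModel c b.1) (w i).1 +
            meanDist (netModel c θ.2.1) (netModel c b.1) (w i).2) := by
          rw [← Finset.sum_add_distrib]
          exact Finset.sum_congr rfl fun i _ => by ring
      _ ≤ 2 * n * (1 / n) + 2 * n * (1 / n) := by
          rw [hsum, hsum]
          gcongr
      _ = n * (4 / n) := by field_simp; norm_num

variable (μ₀ : Measure ((Fin p → ℝ) × ℝ)) (μu : Measure (Fin q → ℝ))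
  [IsProbabilityMeasure μ₀] [IsProbabilityMeasure μu]

/-- With high probability the empirical distance of any two networks of the class is bounded by
their mean distance. -/
theorem measure_exists_meanDist_gt_le (hc : 0 < c) (hn : 1 ≤ n) (hm₁ : 1 ≤ m₁) (hm₂ : 2 ≤ m₂)
    {κ M : ℕ} (hMκ : M = n ^ κ) {t : ℝ} (Θ : Set (ParamIndex (p + q) L N → ℝ))
    (hnet : ∀ (Q : Measure ((Fin p → ℝ) × (Fin q → ℝ))) [IsProbabilityMeasure Q],
      ∃ T : Finset Θ, T.card ≤ M ∧ ∀ θ : Θ, ∃ θ' ∈ T,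
        ∫ z, |netFun c (θ : ParamIndex (p + q) L N → ℝ) z -
          netFun c (θ' : ParamIndex (p + q) L N → ℝ) z| ∂Q ≤ 1 / n) :
    (Measure.pi fun _ : Fin n => sampleLaw μ₀ μu m₁ m₂)
      {v | ∃ θ : Θ × Θ, n * (8 * ∫ x, meanDist (netModel c θ.1.1) (netModel c θ.2.1) x
            ∂sampleLaw μ₀ μu m₁ m₂ + (16 / n + 12 * c * (2 * (κ * Real.log n) + t) / n)) <
          ∑ i, meanDist (netModel c θ.1.1) (netModel c θ.2.1) (v i)} ≤
      ENNReal.ofReal (2 * Real.exp (-t)) := by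
  have hn0 : (0 : ℝ) < n := by exact_mod_cast hn
  have hcont : ∀ v : Sample p q m₁ m₂, Continuous fun θ : Θ × Θ =>
      meanDist (netModel c θ.1.1) (netModel c θ.2.1) v := by
    intro v
    have hz := continuous_netModel (p := p) (q := q) (L := L) (N := N) hc
    unfold meanDist
    exact continuous_const.mul (continuous_finsetSum _ fun i _ =>
      (((hz _ _).comp (continuous_subtype_val.comp continuous_fst)).sub
        ((hz _ _).comp (continuous_subtype_val.comp continuous_snd))).abs)
  have hM : ((M : ℕ) : ℝ) ^ 2 = Real.exp (2 * (κ * Real.log n)) := by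
    rw [hMκ, Nat.cast_pow, ← pow_mul, ← Real.rpow_natCast, Real.rpow_def_of_pos hn0]
    congr 1
    push_cast
    ring
  have h := measure_exists_sum_gt_le (n := n) (M := M ^ 2) (sampleLaw μ₀ μu m₁ m₂) (b := 2 * c)
    (a := 16 / n + 12 * c * (2 * (κ * Real.log n) + t) / n) (η := 4 / n) (by linarith)
    (fun θ : Θ × Θ => meanDist (netModel c θ.1.1) (netModel c θ.2.1))
    (fun θ => measurable_meanDist (measurable_netModel hc _) (measurable_netModel hc _))
    (fun θ v => meanDist_nonneg v)
    (fun θ v => meanDist_le hm₁ hm₂ (abs_netModel_le hc _) (abs_netModel_le hc _) v)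
    hcont (exists_net_meanDist hc hn hm₁ hm₂ Θ hnet)
  refine h.trans (ENNReal.ofReal_le_ofReal (le_of_eq ?_))
  rw [Nat.cast_pow, hM, ← Real.exp_add]
  congr 2
  field_simp
  ring

/-- With high probability the excess empirical risks over a fixed network `θ₀` are bounded below in
terms of the excess risks, uniformly over a finite set of networks. -/
theorem measure_exists_excess_le (hc : 0 < c) (hY : ∀ᵐ z ∂μ₀, |z.2| ≤ c) (hn : 1 ≤ n)
    (hm₁ : 1 ≤ m₁) (hm₂ : 2 ≤ m₂) {κ : ℕ} {t l : ℝ} (hl : 0 < l) (hlc : l * (64 * c) ≤ 1)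
    (θ₀ : ParamIndex (p + q) L N → ℝ) (T : Finset (ParamIndex (p + q) L N → ℝ))
    (hT : T.card ≤ n ^ κ) :
    (Measure.pi fun _ : Fin n => sampleLaw μ₀ μu m₁ m₂)
      {v | ∃ θ ∈ T, ∑ i, (sampleLoss (netModel c θ) (v i) - sampleLoss (netModel c θ₀) (v i)) ≤
        n * ((∫ x, pointDist c μ₀ μu (netModel c θ) x ∂μ₀.fst) -
          3 * (∫ x, pointDist c μ₀ μu (netModel c θ₀) x ∂μ₀.fst) -
          ((κ * Real.log n + t) / (l * n) + l * (256 * c ^ 2 / (m₁ * m₂))))} ≤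
      ENNReal.ofReal (Real.exp (-t)) := by
  have hn0 : (0 : ℝ) < n := by exact_mod_cast hn
  set τ := κ * Real.log n + t with hτ
  set ν := sampleLaw μ₀ μu m₁ m₂ with hν
  set P := Measure.pi fun _ : Fin n => ν with hP
  set r : (ParamIndex (p + q) L N → ℝ) → ℝ := fun θ =>
    ∫ x, pointDist c μ₀ μu (netModel c θ) x ∂μ₀.fst with hr
  have hr0 : ∀ θ, 0 ≤ r θ := fun θ => integral_nonneg fun x => integral_nonneg fun s => sq_nonneg _
  have hone : ∀ θ, P {v | ∑ i, (sampleLoss (netModel c θ) (v i) -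
      sampleLoss (netModel c θ₀) (v i)) ≤
      n * (r θ - 3 * r θ₀ - (τ / (l * n) + l * (256 * c ^ 2 / (m₁ * m₂))))} ≤
      ENNReal.ofReal (Real.exp (-τ)) := by
    intro θ
    set σ := 64 * c * (r θ + r θ₀) + 256 * c ^ 2 / (m₁ * m₂) with hσ
    have hB := measure_sum_le_mean_sub_le (n := n) ν
      (D := fun v => sampleLoss (netModel c θ) v - sampleLoss (netModel c θ₀) v)
      ((measurable_sampleLoss (measurable_netModel hc θ)).sub
        (measurable_sampleLoss (measurable_netModel hc θ₀)))
      (abs_sampleLoss_sub_le' hm₁ hm₂ (abs_netModel_le hc θ) (abs_netModel_le hc θ₀))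
      (l := l) (s := τ / (l * n) + l * σ) (σ := σ) hl.le (by nlinarith)
      (integral_sq_sampleLoss_sub_le μu hc.le hY hm₁ hm₂ (measurable_netModel hc θ)
        (measurable_netModel hc θ₀) (abs_netModel_le hc θ) (abs_netModel_le hc θ₀))
    rw [integral_sampleLoss_sub μu hc.le hY hm₁ hm₂ (measurable_netModel hc θ)
        (measurable_netModel hc θ₀) (abs_netModel_le hc θ) (abs_netModel_le hc θ₀)] at hB
    have hexp : n * (l * (τ / (l * n) + l * σ) - l ^ 2 * σ) = τ := by field_simp; ring
    rw [hexp] at hB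
    refine (measure_mono fun v hv => ?_).trans hB
    simp only [Set.mem_ofPred_eq] at hv ⊢
    refine hv.trans (mul_le_mul_of_nonneg_left ?_ hn0.le)
    have hls : l * σ ≤ (r θ + r θ₀) + l * (256 * c ^ 2 / (m₁ * m₂)) := by
      rw [hσ, mul_add]
      have := mul_le_mul_of_nonneg_right hlc (add_nonneg (hr0 θ) (hr0 θ₀))
      linarith
    change r θ - 3 * r θ₀ - _ ≤ 2 * (r θ - r θ₀) - _
    linarith
  have hunion : {v : Fin n → Sample p q m₁ m₂ | ∃ θ ∈ T,
      ∑ i, (sampleLoss (netModel c θ) (v i) - sampleLoss (netModel c θ₀) (v i)) ≤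
      n * (r θ - 3 * r θ₀ - (τ / (l * n) + l * (256 * c ^ 2 / (m₁ * m₂))))} ⊆
      ⋃ θ ∈ T, {v | ∑ i, (sampleLoss (netModel c θ) (v i) - sampleLoss (netModel c θ₀) (v i)) ≤
      n * (r θ - 3 * r θ₀ - (τ / (l * n) + l * (256 * c ^ 2 / (m₁ * m₂))))} := by
    rintro v ⟨θ, hθ, hv⟩
    exact Set.mem_biUnion hθ hv
  refine (measure_mono hunion).trans ((measure_biUnion_finset_le _ _).trans ?_)
  refine (Finset.sum_le_card_nsmul _ _ _ fun θ _ => hone θ).trans ?_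
  have hTR : (T.card : ℝ) ≤ Real.exp (κ * Real.log n) := by
    rw [Real.exp_nat_mul, Real.exp_log hn0]
    exact_mod_cast hT
  rw [nsmul_eq_mul, ← ENNReal.ofReal_natCast, ← ENNReal.ofReal_mul (Nat.cast_nonneg _)]
  refine ENNReal.ofReal_le_ofReal ?_
  calc (T.card : ℝ) * Real.exp (-τ) ≤ Real.exp (κ * Real.log n) * Real.exp (-τ) := by gcongr
    _ = Real.exp (-t) := by rw [← Real.exp_add, hτ]; ring_nf

end Deviations

/-! ### The law of the samples -/

section SampleLaw

variable {p q n m₁ m₂ : ℕ} (μ₀ : Measure ((Fin p → ℝ) × ℝ)) (μu : Measure (Fin q → ℝ))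
  [IsProbabilityMeasure μ₀] [IsProbabilityMeasure μu]

/-- Grouping independent noise variables by the data point to which they belong. -/
lemma map_regroup_pi :
    (Measure.pi fun _ : Fin m₁ × Fin n × Fin m₂ => μu).map
        (fun u (i : Fin n) (x : Fin m₁ × Fin m₂) => u (x.1, i, x.2)) =
      Measure.pi fun _ => Measure.pi fun _ => μu := by
  have hinv : (Measure.pi fun _ : Fin n => Measure.pi fun _ : Fin m₁ × Fin m₂ => μu).map
      (fun w (j : Fin m₁ × Fin n × Fin m₂) => w j.2.1 (j.1, j.2.2)) =
      Measure.pi fun _ => μu := by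
    refine (Measure.pi_eq fun s hs => ?_).symm
    rw [Measure.map_apply (by fun_prop) (MeasurableSet.univ_pi hs)]
    have hset : (fun (w : Fin n → Fin m₁ × Fin m₂ → Fin q → ℝ) (j : Fin m₁ × Fin n × Fin m₂) =>
        w j.2.1 (j.1, j.2.2)) ⁻¹' (Set.univ.pi s) =
        Set.univ.pi fun i => Set.univ.pi fun x => s (x.1, i, x.2) := by
      ext w
      simp only [Set.mem_preimage, Set.mem_univ_pi, Prod.forall]
      exact ⟨fun h i b k => h b i k, fun h b i k => h i b k⟩
    rw [hset, Measure.pi_pi]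
    simp only [Measure.pi_pi, Fintype.prod_prod_type]
    rw [Finset.prod_comm]
  rw [← hinv, Measure.map_map (by fun_prop) (by fun_prop)]
  exact Measure.map_id

/-- The data points with their noise variables are independent with law `sampleLaw`. -/
lemma map_sample_eq_pi {Ω : Type*} [MeasurableSpace Ω] {P : Measure Ω} [IsProbabilityMeasure P]
    {Z : Fin n → Ω → (Fin p → ℝ) × ℝ} {U : Fin m₁ × Fin n × Fin m₂ → Ω → Fin q → ℝ}
    (hZ : ∀ i, HasLaw (Z i) μ₀ P) (hZi : iIndepFun Z P) (hU : ∀ j, HasLaw (U j) μu P)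
    (hUi : iIndepFun U P) (hZU : IndepFun (fun ω i => Z i ω) (fun ω j => U j ω) P) :
    AEMeasurable (fun ω i => ((Z i ω, fun x => U (x.1, i, x.2) ω) : Sample p q m₁ m₂)) P ∧
      P.map (fun ω i => ((Z i ω, fun x => U (x.1, i, x.2) ω) : Sample p q m₁ m₂)) =
        Measure.pi fun _ => sampleLaw μ₀ μu m₁ m₂ := by
  have hZm : ∀ i, AEMeasurable (Z i) P := fun i => (hZ i).aemeasurable
  have hUm : ∀ j, AEMeasurable (U j) P := fun j => (hU j).aemeasurable
  have hZm' : AEMeasurable (fun ω i => Z i ω) P := aemeasurable_pi_lambda _ hZm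
  have hUm' : AEMeasurable (fun ω j => U j ω) P := aemeasurable_pi_lambda _ hUm
  have hZl := (iIndepFun_iff_map_fun_eq_pi_map hZm).1 hZi
  have hUl := (iIndepFun_iff_map_fun_eq_pi_map hUm).1 hUi
  simp only [fun i => (hZ i).map_eq] at hZl
  simp only [fun j => (hU j).map_eq] at hUl
  have hpair := (indepFun_iff_map_prod_eq_prod_map_map hZm' hUm').1 hZU
  rw [hZl, hUl] at hpair
  have hg : MeasurePreserving
      (fun (u : Fin m₁ × Fin n × Fin m₂ → Fin q → ℝ) (i : Fin n) (x : Fin m₁ × Fin m₂) =>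
        u (x.1, i, x.2)) (Measure.pi fun _ => μu) (Measure.pi fun _ => Measure.pi fun _ => μu) :=
    ⟨by fun_prop, map_regroup_pi μu⟩
  have hid : MeasurePreserving id (Measure.pi fun _ : Fin n => μ₀) (Measure.pi fun _ => μ₀) :=
    MeasurePreserving.id _
  have : SigmaFinite (Measure.pi fun _ : Fin n => μ₀) := inferInstance
  have : SFinite (Measure.pi fun _ : Fin n => μ₀) := inferInstance
  have hprod := hid.prod hg
  have hmp := (measurePreserving_arrowProdEquivProdArrow ((Fin p → ℝ) × ℝ)
    (Fin m₁ × Fin m₂ → Fin q → ℝ) (Fin n) (fun _ => μ₀)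
    (fun _ => Measure.pi fun _ => μu)).symm _ |>.comp hprod
  have hm := hmp.measurable
  have heq : (fun ω i => ((Z i ω, fun x => U (x.1, i, x.2) ω) : Sample p q m₁ m₂)) =
      ((MeasurableEquiv.arrowProdEquivProdArrow ((Fin p → ℝ) × ℝ)
        (Fin m₁ × Fin m₂ → Fin q → ℝ) (Fin n)).symm ∘ Prod.map id
          fun (u : Fin m₁ × Fin n × Fin m₂ → Fin q → ℝ) (i : Fin n) (x : Fin m₁ × Fin m₂) =>
        u (x.1, i, x.2)) ∘ fun ω => (fun i => Z i ω, fun j => U j ω) := rfl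
  refine ⟨heq ▸ hm.comp_aemeasurable (hZm'.prodMk hUm'), ?_⟩
  rw [heq, ← AEMeasurable.map_map_of_aemeasurable hm.aemeasurable (hZm'.prodMk hUm'), hpair,
    hmp.map_eq]
  rfl

end SampleLaw

/-! ### The network class and its empirical risk -/

section NetClass

variable {p q L N n m₁ m₂ : ℕ} {c B : ℝ}

/-- The vector of the parameters that a network of depth `L` uses. -/
def Params.toVec {d : ℕ} (θ : Params d L N) : ParamIndex d L N → ℝ := fun a =>
  Sum.elim (fun ij => θ.weight a.1 ij.1 ij.2) (fun i => θ.bias a.1 i) a.2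

lemma weight_paramsOfVec_toVec {d l : ℕ} (θ : Params d L N) (hl : l ≤ L) :
    (paramsOfVec θ.toVec).weight l = θ.weight l := by
  funext i j
  have h1 : l < L + 1 := by omega
  simp only [paramsOfVec, Params.toVec, h1, dite_true, Sum.elim_inl, Sum.elim_inr]

lemma bias_paramsOfVec_toVec {d l : ℕ} (θ : Params d L N) (hl : l ≤ L) :
    (paramsOfVec θ.toVec).bias l = θ.bias l := by
  funext i
  have h1 : l < L + 1 := by omega
  simp only [paramsOfVec, Params.toVec, h1, dite_true, Sum.elim_inl, Sum.elim_inr]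

lemma hidden_paramsOfVec_toVec {d : ℕ} (θ : Params d L N) (z : Fin d → ℝ) :
    ∀ l ≤ L, (paramsOfVec θ.toVec).hidden z l = θ.hidden z l
  | 0, _ => rfl
  | l + 1, h => by
    have hl : l ≤ L := by omega
    funext i
    rw [Params.hidden, Params.hidden, hidden_paramsOfVec_toVec θ z l hl,
      weight_paramsOfVec_toVec θ hl, bias_paramsOfVec_toVec θ hl]

lemma eval_paramsOfVec_toVec {d : ℕ} (θ : Params d L N) (z : Fin d → ℝ) :
    (paramsOfVec θ.toVec).eval z = θ.eval z := by
  rw [Params.eval, Params.eval, hidden_paramsOfVec_toVec θ z L le_rfl,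
    weight_paramsOfVec_toVec θ le_rfl, bias_paramsOfVec_toVec θ le_rfl]

lemma mem_stochasticNets_iff {g : (Fin p → ℝ) → (Fin q → ℝ) → ℝ} :
    g ∈ stochasticNets p L N q c B ↔
      ∃ θ ∈ {θ : ParamIndex (p + q) L N → ℝ | ∀ a, |θ a| ≤ B}, g = netModel c θ := by
  constructor
  · rintro ⟨θ, hθ, hg⟩
    refine ⟨θ.toVec, ?_, ?_⟩
    · rintro ⟨l, ij | i⟩
      · exact (hθ l (by omega)).1 _ _
      · exact (hθ l (by omega)).2 _
    · funext x u
      rw [hg, netModel, netFun, eval_paramsOfVec_toVec]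
  · rintro ⟨θ, hθ, rfl⟩
    refine ⟨paramsOfVec θ, fun l hl => ?_, fun x u => rfl⟩
    have h1 : l < L + 1 := by omega
    simp only [paramsOfVec, h1, dite_true]
    exact ⟨fun i j => hθ _, fun i => hθ _⟩

lemma stochasticNets_nonempty (hB : 0 ≤ B) : (stochasticNets p L N q c B).Nonempty :=
  ⟨netModel c 0, mem_stochasticNets_iff.2 ⟨0, fun a => by simpa using hB, rfl⟩⟩

lemma empiricalRisk_eq (z : Fin n → (Fin p → ℝ) × ℝ) (u : Fin m₁ → Fin n → Fin m₂ → Fin q → ℝ)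
    (g : (Fin p → ℝ) → (Fin q → ℝ) → ℝ) :
    empiricalRisk z u g =
      1 / n * ∑ i, sampleLoss g ((z i, fun x => u x.1 i x.2) : Sample p q m₁ m₂) := by
  unfold empiricalRisk sampleLoss energyLoss
  rw [← Finset.mul_sum, ← Finset.mul_sum, Finset.sum_comm]
  ring

lemma bddBelow_empiricalRisk (hc : 0 < c) (hm₁ : 1 ≤ m₁) (hm₂ : 2 ≤ m₂)
    (z : Fin n → (Fin p → ℝ) × ℝ) (u : Fin m₁ → Fin n → Fin m₂ → Fin q → ℝ) :
    BddBelow (Set.range fun g : stochasticNets p L N q c B =>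
      empiricalRisk z u (g : (Fin p → ℝ) → (Fin q → ℝ) → ℝ)) := by
  refine ⟨1 / n * ∑ i, -(4 * c + 2 * |(z i).2|), ?_⟩
  rintro _ ⟨⟨g, hg⟩, rfl⟩
  obtain ⟨θ, -, rfl⟩ := mem_stochasticNets_iff.1 hg
  dsimp only
  rw [empiricalRisk_eq]
  refine mul_le_mul_of_nonneg_left (Finset.sum_le_sum fun i _ => ?_) (by positivity)
  exact neg_le_of_abs_le (abs_energyLoss_le hm₁ hm₂ _ fun x => abs_netModel_le hc _ _ _)

end NetClass

/-! ### The oracle inequality -/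

section Oracle

/-- The parameter of Bernstein's inequality that balances its two error terms. -/
lemma exists_balancing_parameter {c τ n m : ℝ} (hc : 0 < c) (hτ : 0 < τ) (hn : 0 < n)
    (hm : 0 < m) :
    ∃ l : ℝ, 0 < l ∧ l * (64 * c) ≤ 1 ∧
      τ / (l * n) + l * (256 * c ^ 2 / m) ≤ 64 * c * (τ / n) + (1 + 256 * c ^ 2) * √(τ / (n * m)) := by
  have hs0 : 0 < √(τ * m / n) := Real.sqrt_pos.2 (by positivity)
  have hs2 : √(τ * m / n) ^ 2 = τ * m / n := Real.sq_sqrt (by positivity)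
  set s := √(τ * m / n) with hs
  have hw : √(τ / (n * m)) = s / m := by
    rw [Real.sqrt_eq_iff_eq_sq (by positivity) (by positivity), div_pow, hs2]
    field_simp
  have hτs : τ / (s * n) = s / m := by
    rw [div_eq_div_iff (by positivity) (by positivity)]
    have h : τ * m = s ^ 2 * n := by rw [hs2]; field_simp
    rw [h]; ring
  rw [hw]
  rcases le_total (s * (64 * c)) 1 with h | h
  · refine ⟨s, hs0, h, ?_⟩
    rw [hτs]
    have h1 : 0 ≤ 64 * c * (τ / n) := by positivity
    have h2 : s * (256 * c ^ 2 / m) = 256 * c ^ 2 * (s / m) := by ring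
    rw [h2]; linarith
  · refine ⟨1 / (64 * c), by positivity, by field_simp; exact le_rfl, ?_⟩
    have h1 : τ / (1 / (64 * c) * n) = 64 * c * (τ / n) := by field_simp
    have h2 : 1 / (64 * c) ≤ s := by rwa [div_le_iff₀ (by positivity)]
    have h3 : 1 / (64 * c) * (256 * c ^ 2 / m) ≤ s * (256 * c ^ 2 / m) := by gcongr
    have h4 : s * (256 * c ^ 2 / m) = 256 * c ^ 2 * (s / m) := by ring
    have h5 : 0 ≤ s / m := by positivity
    rw [h1]; linarith

variable {p q L N n m₁ m₂ : ℕ} {c : ℝ} {μ₀ : Measure ((Fin p → ℝ) × ℝ)}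
  {μu : Measure (Fin q → ℝ)} [IsProbabilityMeasure μ₀] [IsProbabilityMeasure μu]

/-- The excess risk is a Lipschitz function of the model with respect to `L¹`, because a difference
of excess risks is half a mean loss difference. The numbers `m₁` and `m₂` are arbitrary. -/
lemma abs_risk_sub_le (m₁ m₂ : ℕ) {g h : (Fin p → ℝ) → (Fin q → ℝ) → ℝ} (hc : 0 ≤ c)
    (hY : ∀ᵐ z ∂μ₀, |z.2| ≤ c) (hm₁ : 1 ≤ m₁) (hm₂ : 2 ≤ m₂)
    (hg : Measurable (Function.uncurry g)) (hh : Measurable (Function.uncurry h))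
    (hgc : ∀ x u, |g x u| ≤ c) (hhc : ∀ x u, |h x u| ≤ c) :
    |(∫ x, pointDist c μ₀ μu g x ∂μ₀.fst) - ∫ x, pointDist c μ₀ μu h x ∂μ₀.fst| ≤
      2 * ∫ z, |g z.1 z.2 - h z.1 z.2| ∂μ₀.fst.prod μu := by
  have h1 := integral_sampleLoss_sub (m₁ := m₁) (m₂ := m₂) μu hc hY hm₁ hm₂ hg hh hgc hhc
  have h2 : |∫ v, (sampleLoss g v - sampleLoss h v) ∂sampleLaw μ₀ μu m₁ m₂| ≤
      ∫ v, 4 * meanDist g h v ∂sampleLaw μ₀ μu m₁ m₂ := by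
    refine abs_integral_le_integral_abs.trans (integral_mono_of_nonneg
      (ae_of_all _ fun v => abs_nonneg _) ?_ (ae_of_all _ fun v => abs_sampleLoss_sub_le hm₁ hm₂ v))
    exact (integrable_of_measurable_bounded (measurable_meanDist hg hh) (K := 2 * c) fun v => by
      rw [abs_of_nonneg (meanDist_nonneg v)]; exact meanDist_le hm₁ hm₂ hgc hhc v).const_mul 4
  rw [h1, integral_const_mul, integral_meanDist μ₀ μu hm₁ hm₂ hg hh hgc hhc, abs_mul, abs_two] at h2
  linarith

/-- On the event where the deviation inequalities hold, an approximate minimizer `θ` of the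
empirical risk has a risk close to that of `θ₀`: its neighbour `θ'` in the net has almost the same
empirical and population risk. -/
lemma risk_le_of_deviation_bounds (hc : 0 < c) (hY : ∀ᵐ z ∂μ₀, |z.2| ≤ c) (hn : 1 ≤ n)
    (hm₁ : 1 ≤ m₁) (hm₂ : 2 ≤ m₂) {v : Fin n → Sample p q m₁ m₂}
    {θ θ' θ₀ : ParamIndex (p + q) L N → ℝ} {ε a δ : ℝ}
    (hθ' : ∫ z, |netFun c θ z - netFun c θ' z| ∂μ₀.fst.prod μu ≤ 1 / n)
    (hexc : n * ((∫ x, pointDist c μ₀ μu (netModel c θ') x ∂μ₀.fst) -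
      3 * (∫ x, pointDist c μ₀ μu (netModel c θ₀) x ∂μ₀.fst) - ε) ≤
      ∑ i, (sampleLoss (netModel c θ') (v i) - sampleLoss (netModel c θ₀) (v i)))
    (hdist : ∑ i, meanDist (netModel c θ) (netModel c θ') (v i) ≤
      n * (8 * ∫ x, meanDist (netModel c θ) (netModel c θ') x ∂sampleLaw μ₀ μu m₁ m₂ + a))
    (hopt : 1 / n * ∑ i, sampleLoss (netModel c θ) (v i) ≤
      1 / n * ∑ i, sampleLoss (netModel c θ₀) (v i) + δ) :
    ∫ x, pointDist c μ₀ μu (netModel c θ) x ∂μ₀.fst ≤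
      3 * (∫ x, pointDist c μ₀ μu (netModel c θ₀) x ∂μ₀.fst) + ε + δ + 34 / n + 4 * a := by
  have hn0 : (0 : ℝ) < n := by exact_mod_cast hn
  have hrisk := abs_risk_sub_le (μ₀ := μ₀) (μu := μu) m₁ m₂ hc.le hY hm₁ hm₂
    (measurable_netModel hc θ) (measurable_netModel hc θ') (abs_netModel_le hc θ)
    (abs_netModel_le hc θ')
  rw [integral_meanDist μ₀ μu hm₁ hm₂ (measurable_netModel hc θ) (measurable_netModel hc θ')
    (abs_netModel_le hc θ) (abs_netModel_le hc θ')] at hdist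
  change _ ≤ 2 * ∫ z, |netFun c θ z - netFun c θ' z| ∂μ₀.fst.prod μu at hrisk
  change _ ≤ n * (8 * ∫ z, |netFun c θ z - netFun c θ' z| ∂μ₀.fst.prod μu + a) at hdist
  set I := ∫ z, |netFun c θ z - netFun c θ' z| ∂μ₀.fst.prod μu
  set r := ∫ x, pointDist c μ₀ μu (netModel c θ) x ∂μ₀.fst
  set r' := ∫ x, pointDist c μ₀ μu (netModel c θ') x ∂μ₀.fst
  set r₀ := ∫ x, pointDist c μ₀ μu (netModel c θ₀) x ∂μ₀.fst
  have hloss : ∑ i, sampleLoss (netModel c θ') (v i) ≤ ∑ i, sampleLoss (netModel c θ) (v i) +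
      4 * ∑ i, meanDist (netModel c θ) (netModel c θ') (v i) := by
    rw [Finset.mul_sum, ← Finset.sum_add_distrib]
    refine Finset.sum_le_sum fun i _ => ?_
    have := (abs_le.1 (abs_sampleLoss_sub_le (g := netModel c θ) (h := netModel c θ')
      hm₁ hm₂ (v i))).1
    linarith
  rw [Finset.sum_sub_distrib] at hexc
  have hopt' : ∑ i, sampleLoss (netModel c θ) (v i) ≤
      ∑ i, sampleLoss (netModel c θ₀) (v i) + n * δ := by
    have := mul_le_mul_of_nonneg_left hopt hn0.le
    rwa [mul_add, ← mul_assoc, ← mul_assoc, mul_one_div_cancel hn0.ne', one_mul, one_mul] at this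
  have hI : n * (8 * I + a) ≤ n * (8 * (1 / n) + a) := by gcongr
  have hkey : n * (r' - 3 * r₀ - ε) ≤ n * (δ + 4 * (8 * (1 / n) + a)) := by linarith
  have hkey' := le_of_mul_le_mul_left hkey hn0
  have hr := (abs_le.1 hrisk).2
  have h34 : (34 : ℝ) / n = 34 * (1 / n) := by ring
  rw [h34]
  linarith

/-- The constant of the oracle inequality absorbs the constants of the individual error terms. -/
lemma div_le_of_risk_le {c k δa δs w δ r r₀ ε a τ n : ℝ} (hc : 0 < c) (hk : 1 ≤ k) (hδa : 0 ≤ δa)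
    (hδs : 0 ≤ δs) (hw : 0 ≤ w) (hδ : 0 ≤ δ) (hr : r ≤ 3 * r₀ + ε + δ + 34 / n + 4 * a)
    (hr₀ : r₀ ≤ δa + δs) (hn : 1 / n ≤ δs) (hτ : τ / n ≤ k * δs)
    (hε : ε ≤ 64 * c * (τ / n) + (1 + 256 * c ^ 2) * (k * w))
    (ha : a ≤ 16 / n + 24 * c * (τ / n)) :
    r / (101 + 160 * c * k + k * (1 + 256 * c ^ 2)) ≤ δa + δs + w + δ := by
  rw [div_le_iff₀ (by positivity)]
  have h34 : 34 / n = 34 * (1 / n) := by ring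
  have h16 : 16 / n = 16 * (1 / n) := by ring
  have h1 : c * (τ / n) ≤ c * (k * δs) := mul_le_mul_of_nonneg_left hτ hc.le
  have hr' : r ≤ 3 * (δa + δs) + 160 * (c * (k * δs)) + (1 + 256 * c ^ 2) * (k * w) + δ +
      98 * δs := by
    rw [h34] at hr
    rw [h16] at ha
    linarith
  have h2 : 0 ≤ (98 + 160 * c * k + k * (1 + 256 * c ^ 2)) * δa := by positivity
  have h3 : 0 ≤ (k * (1 + 256 * c ^ 2)) * δs := by positivity
  have h4 : 0 ≤ (101 + 160 * c * k) * w := by positivity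
  have h5 : 0 ≤ (100 + 160 * c * k + k * (1 + 256 * c ^ 2)) * δ := by positivity
  linarith

end Oracle

end NDRE

theorem theorem1 (c₀ c₁ : ℝ) (hc₀ : 0 < c₀) :
    ∃ C : ℝ, 0 < C ∧
      ∀ (p L N q n m₁ m₂ : ℕ) (B t : ℝ)
        (μ₀ : Measure ((Fin p → ℝ) × ℝ)) (μu : Measure (Fin q → ℝ))
        (Ω : Type*) (mΩ : MeasurableSpace Ω) (P : Measure Ω)
        (Z : Fin n → Ω → (Fin p → ℝ) × ℝ)
        (U : Fin m₁ × Fin n × Fin m₂ → Ω → Fin q → ℝ)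
        (ghat : Ω → (Fin p → ℝ) → (Fin q → ℝ) → ℝ) (δopt : Ω → ℝ),
        IsProbabilityMeasure μ₀ → IsProbabilityMeasure μu → IsProbabilityMeasure P →
        -- parameter ranges
        3 ≤ n → 3 ≤ L → 1 ≤ q → q + (p + q) + 2 ≤ N → 1 ≤ m₁ → 2 ≤ m₂ → 0 < B → 0 < t →
        Real.log B ≤ c₁ * Real.log n → Real.log ((N : ℝ) * L) ≤ c₁ * Real.log n →
        -- boundedness of the data
        (∀ᵐ z ∂μ₀, (∀ j, |z.1 j| ≤ c₀) ∧ |z.2| ≤ c₀) →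
        -- i.i.d. data, i.i.d. noise, independent of each other
        (∀ i, HasLaw (Z i) μ₀ P) → iIndepFun Z P →
        (∀ j, HasLaw (U j) μu P) → iIndepFun U P →
        IndepFun (fun ω i => Z i ω) (fun ω j => U j ω) P →
        -- approximate minimization of the empirical energy loss over the class
        (∀ᵐ ω ∂P, ghat ω ∈ NDRE.stochasticNets p L N q c₀ B ∧
          NDRE.empiricalRisk (fun i => Z i ω) (fun b i k => U (b, i, k) ω) (ghat ω) ≤
            (⨅ g : NDRE.stochasticNets p L N q c₀ B,
              NDRE.empiricalRisk (fun i => Z i ω) (fun b i k => U (b, i, k) ω)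
                (g : (Fin p → ℝ) → (Fin q → ℝ) → ℝ)) + δopt ω) →
        -- the bound fails with probability at most `C * exp (-t)`
        P {ω | ¬ (NDRE.cdfDist (μ₀.map Prod.fst) (NDRE.inducedCDF μu (ghat ω))
                    (NDRE.trueCDF μ₀) ^ 2 / C ≤
                  NDRE.approxError p L N q c₀ B μ₀ μu + NDRE.stochError L N n t
                    + √(NDRE.stochError L N n t) * √(1 / ((m₁ : ℝ) * m₂)) + δopt ω)}
          ≤ ENNReal.ofReal (C * Real.exp (-t)) := by
  obtain ⟨K, hK⟩ := NDRE.exists_net_netFun c₀ c₁ hc₀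
  refine ⟨101 + 160 * c₀ * (K + 1) + (K + 1) * (1 + 256 * c₀ ^ 2), by positivity, ?_⟩
  intro p L N q n m₁ m₂ B t μ₀ μu Ω mΩ P Z U ghat δopt hμ₀ hμu hP hn hL hq hN hm₁ hm₂ hB ht _ hNL
    hbdd hZ hZi hU hUi hZU hopt
  have hY : ∀ᵐ z ∂μ₀, |z.2| ≤ c₀ := hbdd.mono fun z h => h.2
  have hn1 : 1 ≤ n := by omega
  have hn0 : (0 : ℝ) < n := by exact_mod_cast hn1
  have hm : (0 : ℝ) < (m₁ : ℝ) * m₂ := by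
    exact_mod_cast Nat.mul_pos (by omega : 0 < m₁) (by omega : 0 < m₂)
  have hlogn : 1 ≤ Real.log n := by
    rw [Real.le_log_iff_exp_le hn0]
    have h3 : (3 : ℝ) ≤ n := by exact_mod_cast hn
    linarith [Real.exp_one_lt_d9]
  have hNL1 : 1 ≤ ((N : ℝ) * L) ^ 2 := by
    have h : 1 ≤ (N * L) ^ 2 :=
      Nat.one_le_pow _ _ (Nat.mul_pos (by omega : 0 < N) (by omega : 0 < L))
    exact_mod_cast h
  -- the uniform deviation inequalities are applied with `κ = K (N L)²`
  obtain ⟨κ, hκ⟩ : ∃ κ : ℕ, κ = K * (N * L) ^ 2 := ⟨_, rfl⟩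
  have hκR : (κ : ℝ) = K * ((N : ℝ) * L) ^ 2 := by rw [hκ]; push_cast; ring
  obtain ⟨M, hM⟩ : ∃ M : ℕ, M = n ^ κ := ⟨_, rfl⟩
  have hXpos : 1 ≤ ((N : ℝ) * L) ^ 2 * Real.log n := one_le_mul_of_one_le_of_one_le hNL1 hlogn
  set δs := NDRE.stochError L N n t with hδs
  have hnδ : 1 / (n : ℝ) ≤ δs := by
    rw [hδs, NDRE.stochError]
    gcongr
    linarith
  have hδs0 : 0 < δs := lt_of_lt_of_le (by positivity) hnδ
  set τ := κ * Real.log n + t with hτ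
  have hτ0 : 0 < τ := by positivity
  have hτn : τ / n ≤ (K + 1) * δs := by
    rw [hδs, NDRE.stochError, ← mul_div_assoc, hτ, hκR]
    gcongr
    have h1 : 0 ≤ (K : ℝ) * t := by positivity
    linarith
  set Θ : Set (NDRE.ParamIndex (p + q) L N → ℝ) := {θ | ∀ a, |θ a| ≤ B} with hΘ
  have hnet : ∀ (Q : Measure ((Fin p → ℝ) × (Fin q → ℝ))) [IsProbabilityMeasure Q],
      ∃ T : Finset Θ, T.card ≤ M ∧ ∀ θ : Θ, ∃ θ' ∈ T,
        ∫ z, |NDRE.netFun c₀ (θ : NDRE.ParamIndex (p + q) L N → ℝ) z -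
          NDRE.netFun c₀ (θ' : NDRE.ParamIndex (p + q) L N → ℝ) z| ∂Q ≤ 1 / n := by
    rw [hM, hκ]
    exact fun Q _ => hK p q L N n hn (by omega) (by omega) (by omega) hNL Q Θ
  obtain ⟨T, hTc, hT⟩ := hnet (μ₀.fst.prod μu)
  -- a network of almost minimal approximation error
  have hne : Nonempty (NDRE.stochasticNets p L N q c₀ B) :=
    (NDRE.stochasticNets_nonempty hB.le).to_subtype
  obtain ⟨⟨g₀, hg₀⟩, hg₀δ⟩ := exists_lt_of_ciInf_lt
    (lt_add_of_pos_right (NDRE.approxError p L N q c₀ B μ₀ μu) hδs0)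
  obtain ⟨θ₀, -, rfl⟩ := NDRE.mem_stochasticNets_iff.1 hg₀
  rw [NDRE.cdfDist_sq_eq μ₀ μu hY (NDRE.abs_netModel_le hc₀ θ₀)] at hg₀δ
  obtain ⟨l, hl, hlc, hlε⟩ := NDRE.exists_balancing_parameter (n := n) hc₀ hτ0 hn0 hm
  -- the exceptional events
  classical
  have hV := NDRE.map_sample_eq_pi μ₀ μu hZ hZi hU hUi hZU
  set V : Ω → Fin n → NDRE.Sample p q m₁ m₂ := fun ω i => (Z i ω, fun x => U (x.1, i, x.2) ω)
    with hVdef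
  have hE₁ := NDRE.measure_exists_meanDist_gt_le (t := t) μ₀ μu hc₀ hn1 hm₁ hm₂ hM Θ hnet
  have hE₂ := NDRE.measure_exists_excess_le (t := t) μ₀ μu hc₀ hY hn1 hm₁ hm₂ hl hlc θ₀
    (T.image Subtype.val) (Finset.card_image_le.trans (hTc.trans hM.le))
  rw [← hV.2] at hE₁ hE₂
  have hE₁' := (Measure.le_map_apply hV.1 _).trans hE₁
  have hE₂' := (Measure.le_map_apply hV.1 _).trans hE₂
  refine (measure_mono_ae ?_).trans ((measure_union_le _ _).trans
    ((add_le_add hE₁' hE₂').trans ?_))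
  · filter_upwards [hopt] with ω hω hbad
    by_contra hgood
    apply hbad
    obtain ⟨hgood₁, hgood₂⟩ := not_or.1 hgood
    simp only [Set.mem_preimage, Set.mem_ofPred_eq, not_exists, not_and, not_lt, not_le]
      at hgood₁ hgood₂
    obtain ⟨hmem, hmin⟩ := hω
    have hbdd := NDRE.bddBelow_empiricalRisk (p := p) (q := q) (L := L) (N := N) (B := B) hc₀
      hm₁ hm₂ (fun i => Z i ω) (fun b i k => U (b, i, k) ω)
    have hδ0 : 0 ≤ δopt ω := by
      have := ciInf_le hbdd ⟨ghat ω, hmem⟩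
      linarith
    have hmin₀ := hmin.trans (add_le_add_left (ciInf_le hbdd ⟨_, hg₀⟩) (δopt ω))
    obtain ⟨θ, hθ, hgθ⟩ := NDRE.mem_stochasticNets_iff.1 hmem
    rw [hgθ, NDRE.empiricalRisk_eq, NDRE.empiricalRisk_eq] at hmin₀
    obtain ⟨θ', hθ'T, hθ'⟩ := hT ⟨θ, hθ⟩
    have hrisk := NDRE.risk_le_of_deviation_bounds hc₀ hY hn1 hm₁ hm₂ hθ'
      (hgood₂ θ' (Finset.mem_image_of_mem _ hθ'T)).le (hgood₁ (⟨θ, hθ⟩, θ')) hmin₀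
    rw [hgθ, NDRE.cdfDist_sq_eq μ₀ μu hY (NDRE.abs_netModel_le hc₀ θ)]
    refine NDRE.div_le_of_risk_le (τ := τ) hc₀ (by simp) (Real.iInf_nonneg fun _ => sq_nonneg _)
      hδs0.le (by positivity) hδ0 hrisk hg₀δ.le hnδ hτn ?_ ?_
    · refine hlε.trans ?_
      gcongr
      have h1 : τ / (n * ((m₁ : ℝ) * m₂)) ≤ (K + 1) ^ 2 * (δs * (1 / ((m₁ : ℝ) * m₂))) := by
        have h2 : ((K : ℝ) + 1) * δs ≤ (K + 1) ^ 2 * δs := by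
          gcongr
          exact le_self_pow₀ (by simp) (by norm_num)
        rw [← div_div, div_eq_mul_one_div (τ / (n : ℝ)), ← mul_assoc]
        gcongr
        exact hτn.trans h2
      refine (Real.sqrt_le_sqrt h1).trans (le_of_eq ?_)
      rw [Real.sqrt_mul (by positivity), Real.sqrt_sq (by positivity), Real.sqrt_mul hδs0.le]
    · have h1 : 12 * c₀ * (2 * (κ * Real.log n) + t) / n ≤ 24 * c₀ * (τ / n) := by
        rw [← mul_div_assoc, show 24 * c₀ * τ = 12 * c₀ * (2 * τ) by ring]
        gcongr
        linarith
      linarith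
  · rw [← ENNReal.ofReal_add (by positivity) (by positivity)]
    refine ENNReal.ofReal_le_ofReal ?_
    have h1 : (3 : ℝ) ≤ 101 + 160 * c₀ * (K + 1) + (K + 1) * (1 + 256 * c₀ ^ 2) := by
      have : 0 ≤ 160 * c₀ * (K + 1) + (K + 1) * (1 + 256 * c₀ ^ 2) := by positivity
      linarith
    have := mul_le_mul_of_nonneg_right h1 (Real.exp_pos (-t)).le
    linarith
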